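/- Let $m\ge 1$, $\vec h\in\mathbb R^m$, and let $\vec\beta_p\in\mathbb R^m$ ($p\ge 2$) satisfy $\vec\beta_p=0$ for odd $p$ and $\sum_{p\ge2}2^p\vec\beta_p(j)^2<\infty$ for all $1\le j\le m$ (the inverse temperature is absorbed into $\vec\beta_p$ and $\vec h$). For an $m\times m$ matrix $A$ with entries in $[-1,1]$ put $\xi'(A)=\sum_{p\ge 2}p\,(\vec\beta_p\vec\beta_p^T)\odot A^{\circ(p-1)}$, where $\odot$ and $A^{\circ k}$ denote the entrywise product and power. Let $Q$ be a positive semidefinite $m\times m$ matrix with entries in $[-1,1]$ and unit diagonal. Let $\mathcal A$ be the set of pairs $(x,\Phi)$ such that $x:[0,m]\to[0,1]$ is nondecreasing and right-continuous with $x(m)=1$; $\Phi$ is a $1$-Lipschitz path of positive semidefinite $m\times m$ matrices on $[0,m]$, nondecreasing in the semidefinite order, with $\mathrm{Trace}\,\Phi(t)=t$, $\Phi(0)=0$, $\Phi(m)=Q$; and $t_x:=\inf\{t\in[0,m]:x(t)=1\}$ satisfies $t_x<m$ and $\det(Q-\Phi(t_x))>0$. For $(x,\Phi)\in\mathcal A$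 set $\hat\Phi(t)=\int_t^m x(s)\Phi'(s)\,ds$ and $$\mathscr C(x,\Phi)=\frac12\Big[\int_0^m x(t)\big\langle \xi'(\Phi(t))+\vec h\vec h^T,\Phi'(t)\big\rangle dt+\log\det(\Phi(m)-\Phi(\hat T))+\int_0^{\hat T}\big\langle\hat\Phi(t)^{-1},\Phi'(t)\big\rangle dt\Big],$$ where $\langle\cdot,\cdot\rangle$ is the Frobenius inner product and $\hat T\in(t_x,m)$ is any point with $\det(Q-\Phi(\hat T))>0$ (the value does not depend on $\hat T$). Let $(x,\Phi)\in\mathcal A$ attain the infimum of the Crisanti–Sommers functional, in the sense that $\mathscr C(x,\Phi)\le\mathscr C(y,\Psi)$ for all $(y,\Psi)\in\mathcal A$ with $y(0)=0$ (this includes every minimizer of $\mathscr C$ over $\{(y,\Psi)\in\mathcal A: y(0)=0\}$ and every minimizer over $\mathcal A$), and let $\mu$ be the Parisi measure, i.e. the probability measure on $[0,m]$ with $\mu([0,t])=x(t)$ for all $t\in[0,m]$. Then for every $t\in\operatorname{supp}\mu$ the matrices $\hat\Phi(s)$, $0\le s\le t$, are invertible, the integral below converges absolutely, and $$\xi'(\Phi(t))+\vec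 h\vec h^T=\int_0^t\hat\Phi(s)^{-1}\Phi'(s)\hat\Phi(s)^{-1}\,ds .$$ -/

import Mathlib

open MeasureTheory

noncomputable section

namespace VectorSpin

variable {m : ℕ}

/-- The Frobenius inner product of two matrices. -/
def frob (A B : Matrix (Fin m) (Fin m) ℝ) : ℝ := ∑ i, ∑ j, A i j * B i j

/-- The matrix `ξ'(A) = ∑_{p ≥ 2} p (β_p ⊗ β_p) ⊙ A^{∘(p-1)}` (the summation index is `p + 2`). -/
def xiPrime (β : ℕ → Fin m → ℝ) (A : Matrix (Fin m) (Fin m) ℝ) : Matrix (Fin m) (Fin m) ℝ :=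
  Matrix.of fun i j => ∑' p : ℕ, ((p : ℝ) + 2) * (β (p + 2) i * β (p + 2) j) * A i j ^ (p + 1)

/-- The self-overlap constraints: positive semidefinite matrices with entries in `[-1, 1]` and
unit diagonal. -/
structure IsOverlapConstraint (Q : Matrix (Fin m) (Fin m) ℝ) : Prop where
  posSemidef : Q.PosSemidef
  entries : ∀ i j, Q i j ∈ Set.Icc (-1 : ℝ) 1
  diag : ∀ i, Q i i = 1

/-- Distribution functions on `[0, m]`: nondecreasing right-continuous `x : [0, m] → [0, 1]` with
`x m = 1`. The value `x 0` is the mass at `0`; the requirement `x 0 = 0` is imposed separately.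
Only the restriction of `x` to `[0, m]` matters. -/
structure IsDistributionPath (m : ℕ) (x : ℝ → ℝ) : Prop where
  mem : ∀ t ∈ Set.Icc (0 : ℝ) m, x t ∈ Set.Icc (0 : ℝ) 1
  mono : MonotoneOn x (Set.Icc (0 : ℝ) m)
  rightCont : ∀ t ∈ Set.Ico (0 : ℝ) m, ContinuousWithinAt x (Set.Ici t) t
  right_end : x m = 1

/-- `1`-Lipschitz (for the Frobenius norm) monotone paths of positive semidefinite matrices on
`[0, m]` from `0` to `Q`, parametrized by their trace. Only the restriction to `[0, m]` matters. -/
structure IsMatrixPath (Q : Matrix (Fin m) (Fin m) ℝ) (Φ : ℝ → Matrix (Fin m) (Fin m) ℝ) :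
    Prop where
  posSemidef : ∀ t ∈ Set.Icc (0 : ℝ) m, (Φ t).PosSemidef
  mono : ∀ s ∈ Set.Icc (0 : ℝ) m, ∀ t ∈ Set.Icc (0 : ℝ) m, s ≤ t → (Φ t - Φ s).PosSemidef
  lipschitz : ∀ s ∈ Set.Icc (0 : ℝ) m, ∀ t ∈ Set.Icc (0 : ℝ) m,
    √(frob (Φ t - Φ s) (Φ t - Φ s)) ≤ |t - s|
  trace_eq : ∀ t ∈ Set.Icc (0 : ℝ) m, (Φ t).trace = t
  left_end : Φ 0 = 0
  right_end : Φ m = Q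

/-- `t_x = inf {t ∈ [0, m] | x t = 1}`. -/
def topTime (m : ℕ) (x : ℝ → ℝ) : ℝ := sInf {t | t ∈ Set.Icc (0 : ℝ) m ∧ x t = 1}

/-- The entrywise derivative `Φ'(t)`, which exists for almost every `t` when `Φ` is Lipschitz. -/
def pathDeriv (Φ : ℝ → Matrix (Fin m) (Fin m) ℝ) (t : ℝ) : Matrix (Fin m) (Fin m) ℝ :=
  Matrix.of fun i j => deriv (fun s => Φ s i j) t

/-- `Φ̂(t) = ∫_t^m x(s) Φ'(s) ds`. -/
def pathHat (x : ℝ → ℝ) (Φ : ℝ → Matrix (Fin m) (Fin m) ℝ) (t : ℝ) :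
    Matrix (Fin m) (Fin m) ℝ :=
  Matrix.of fun i j => ∫ s in t..(m : ℝ), x s * pathDeriv Φ s i j

/-- The pairs `(x, Φ)` on which the Crisanti–Sommers functional is defined, except that `x 0` is
not required to vanish. -/
structure IsAdmissible (Q : Matrix (Fin m) (Fin m) ℝ) (x : ℝ → ℝ)
    (Φ : ℝ → Matrix (Fin m) (Fin m) ℝ) : Prop where
  distr : IsDistributionPath m x
  path : IsMatrixPath Q Φ
  topTime_lt : topTime m x < m
  det_pos : 0 < (Q - Φ (topTime m x)).det

/-- The truncation points `T ∈ (t_x, m)` at which `log |Q - Φ(T)|` makes sense. -/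
def IsCutoff (Q : Matrix (Fin m) (Fin m) ℝ) (x : ℝ → ℝ) (Φ : ℝ → Matrix (Fin m) (Fin m) ℝ)
    (T : ℝ) : Prop :=
  topTime m x < T ∧ T < m ∧ 0 < (Q - Φ T).det

/-- The Crisanti–Sommers functional, written with the truncation point `T`; its value does not
depend on the choice of `T` with `IsCutoff Q x Φ T`. -/
def crisantiSommers (β : ℕ → Fin m → ℝ) (h : Fin m → ℝ) (x : ℝ → ℝ)
    (Φ : ℝ → Matrix (Fin m) (Fin m) ℝ) (T : ℝ) : ℝ :=
  (1 / 2) *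
    ((∫ t in (0 : ℝ)..m,
        x t * frob (xiPrime β (Φ t) + Matrix.vecMulVec h h) (pathDeriv Φ t))
      + Real.log (Φ m - Φ T).det
      + ∫ t in (0 : ℝ)..T, frob (pathHat x Φ t)⁻¹ (pathDeriv Φ t))

/-- `(x, Φ)` attains the infimum of the Crisanti–Sommers functional over the admissible pairs
`(y, Ψ)` with `y 0 = 0`. The minimizing distribution itself may have an atom at `0`. This covers
the minimizers among the pairs with `x 0 = 0` as well as those among all admissible pairs. -/
def IsMinimizer (β : ℕ → Fin m → ℝ) (h : Fin m → ℝ) (Q : Matrix (Fin m) (Fin m) ℝ)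
    (x : ℝ → ℝ) (Φ : ℝ → Matrix (Fin m) (Fin m) ℝ) : Prop :=
  IsAdmissible Q x Φ ∧
    ∀ (y : ℝ → ℝ) (Ψ : ℝ → Matrix (Fin m) (Fin m) ℝ), IsAdmissible Q y Ψ → y 0 = 0 →
      ∀ T S : ℝ, IsCutoff Q x Φ T → IsCutoff Q y Ψ S →
        crisantiSommers β h x Φ T ≤ crisantiSommers β h y Ψ S

/-- `μ` is the measure on `[0, m]` with distribution function `x`: `μ([0, t]) = x(t)`. -/
def IsParisiMeasure (m : ℕ) (x : ℝ → ℝ) (μ : Measure ℝ) : Prop :=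
  μ (Set.Icc (0 : ℝ) m)ᶜ = 0 ∧
    ∀ t ∈ Set.Icc (0 : ℝ) m, μ (Set.Icc 0 t) = ENNReal.ofReal (x t)

end VectorSpin

end

open MeasureTheory Set Filter Topology
open scoped Matrix.Norms.L2Operator NNReal

noncomputable section

namespace VectorSpin

variable {m : ℕ}

/-! ### Calculus of Lipschitz functions with an almost everywhere derivative -/

section LipDerivOn

variable {E : Type*} [NormedAddCommGroup E] [NormedSpace ℝ E]

/-! Fix a cutoff `τ`, a point of `(t_x, m)` with `Q - Φ τ` positive definite. Write D for `pathHat x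
Φ`, A = ξ'(Φ) + hhᵀ, B(t) = ∫_0^t D⁻¹ Φ' D⁻¹ (`conjIntegral`), F = A - B (`defect`) and N(r) =
∫_{[r,τ]} F dμ. The claim is F = 0 on supp μ.

The minimizer is tested on one family of perturbations: shrink the path by the factor 1 - aε, insert
at a time r a jump bεP with P positive semidefinite of trace 1, and reach Q by a straight segment
after the cutoff (`pertPath`, `pertDistr`). The derivative at ε = 0⁺ is nonnegative
(`IsMinimizer.firstVariation_nonneg`). A competitor must have no mass at 0, while the perturbed pair
may have some; this costs nothing, because the mass of a short interval [0, δ) can be pushed to δ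
and δ sent to 0 (`IsMinimizer.le_of_isFrame`).

The two extreme directions suffice. A pure jump gives N(r) ≤ 0 in the semidefinite order, for every
r. Pure shrinking gives tr ∫ F Φ dμ ≥ 0. By Fubini this trace equals ∫_0^τ tr(N Φ') dq, whose
integrand is nonpositive since N ≤ 0 ≤ Φ'. So tr(N Φ') = 0, hence N Φ' = 0, almost everywhere:
complementary slackness (`IsMinimizer.setIntegral_defect_mul_deriv`).

The rest uses only this slackness, the sign of N, and F' = A' - D⁻¹ Φ' D⁻¹ with A' ≥ 0 (Schur
product theorem) and F(0) = hhᵀ ≥ 0. As D' = -xΦ' is annihilated by N, the tail M(r) = ∫_{[r,τ]} D F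
D dμ equals D(r) N(r) D(r) (`IsSlackDefect.setIntegral_conj_pathHat`); in particular M ≤ 0 and D⁻¹
Φ' D⁻¹ M = 0. Integration by parts then yields F(s) M(s) = F(0) M(0) + ∫_0^s A' M dq - ∫_{[0,s)} F D
F D dμ, and each term on the right has nonpositive trace
(`IsSlackDefect.trace_mul_conj_tail_nonpos`). Expanding tr(N(r) M(r)) as a double integral over
[r,τ]² and splitting along the diagonal gives tr(N D N D) ≤ 0 at r. With N semidefinite and D
definite this forces N(r) = 0 (`IsSlackDefect.tail_eq_zero`).

Once all tails vanish, ∫ F² dμ = F(0) N(0) + ∫ F' N dq = 0, so F = 0 μ-almost everywhere, and on the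
support by continuity. -/

/-- `f` is Lipschitz on `[a, b]` and has derivative `f'` almost everywhere there. -/
structure LipDerivOn (f f' : ℝ → E) (a b : ℝ) : Prop where
  lip : ∃ K, LipschitzOnWith K f (Icc a b)
  deriv : ∀ᵐ t, t ∈ Ioo a b → HasDerivAt f (f' t) t

namespace LipDerivOn

variable {f f' g g' : ℝ → E} {a b : ℝ}

lemma mono (hf : LipDerivOn f f' a b) {c d : ℝ} (hc : a ≤ c) (hd : d ≤ b) :
    LipDerivOn f f' c d := by
  obtain ⟨K, hK⟩ := hf.lip
  refine ⟨⟨K, hK.mono (Icc_subset_Icc hc hd)⟩, ?_⟩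
  filter_upwards [hf.deriv] with t ht hm using ht (Ioo_subset_Ioo hc hd hm)

lemma continuousOn (hf : LipDerivOn f f' a b) : ContinuousOn f (Icc a b) :=
  hf.lip.choose_spec.continuousOn

lemma exists_norm_le (hf : LipDerivOn f f' a b) : ∃ C, ∀ t ∈ Icc a b, ‖f t‖ ≤ C :=
  isCompact_Icc.exists_bound_of_continuousOn hf.continuousOn

lemma exists_norm_deriv_le (hf : LipDerivOn f f' a b) :
    ∃ C : ℝ≥0, ∀ᵐ t, t ∈ Ioo a b → ‖f' t‖ ≤ C := by
  obtain ⟨K, hK⟩ := hf.lip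
  refine ⟨K, ?_⟩
  filter_upwards [hf.deriv] with t ht hm
  exact (ht hm).le_of_lipschitzOn (Icc_mem_nhds hm.1 hm.2) hK

/-- `f'` agrees almost everywhere with `deriv f`, which is measurable, and the Lipschitz constant
bounds it. -/
lemma integrableOn [CompleteSpace E] (hf : LipDerivOn f f' a b) :
    IntegrableOn f' (Ioo a b) := by
  obtain ⟨C, hC⟩ := hf.exists_norm_deriv_le
  have h1 : AEStronglyMeasurable f' (volume.restrict (Ioo a b)) := by
    refine (stronglyMeasurable_deriv f).aestronglyMeasurable.congr ?_
    refine (ae_restrict_iff' measurableSet_Ioo).2 ?_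
    filter_upwards [hf.deriv] with t ht hm using (ht hm).deriv
  exact ⟨h1, HasFiniteIntegral.restrict_of_bounded C (by simp)
    ((ae_restrict_iff' measurableSet_Ioo).2 hC)⟩

lemma intervalIntegrable [CompleteSpace E] (hf : LipDerivOn f f' a b) (hab : a ≤ b) :
    IntervalIntegrable f' volume a b :=
  (intervalIntegrable_iff_integrableOn_Ioo_of_le hab).2 hf.integrableOn

lemma of_integral [CompleteSpace E] {C : ℝ} (hab : a ≤ b)
    (hf : IntervalIntegrable f' volume a b)
    (hC : ∀ᵐ t, t ∈ Ioo a b → ‖f' t‖ ≤ C) {c : ℝ} (hc : c ∈ Icc a b) :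
    LipDerivOn (fun t => ∫ s in c..t, f' s) f' a b := by
  refine ⟨⟨C.toNNReal, ?_⟩, ?_⟩
  · have hsub : ∀ s ∈ Icc a b, IntervalIntegrable f' volume c s := fun s hs =>
      hf.mono_set (by rw [uIcc_of_le hab]; exact uIcc_subset_Icc hc hs)
    refine LipschitzOnWith.of_dist_le_mul fun s hs t ht => ?_
    rw [dist_eq_norm, intervalIntegral.integral_interval_sub_left (hsub s hs) (hsub t ht)]
    have : ∀ᵐ q, q ∈ Set.uIoc t s → ‖f' q‖ ≤ (C.toNNReal : ℝ) := by
      have h1 : ∀ᵐ q : ℝ, q ≠ b := by simp [ae_iff, measure_singleton]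
      filter_upwards [hC, h1] with q hq hqb hm
      refine (hq ⟨?_, lt_of_le_of_ne ?_ hqb⟩).trans (Real.le_coe_toNNReal C)
      · exact lt_of_le_of_lt (le_min ht.1 hs.1) hm.1
      · exact hm.2.trans (max_le ht.2 hs.2)
    simpa [Real.dist_eq] using intervalIntegral.norm_integral_le_of_norm_le_const_ae this
  · filter_upwards [hf.ae_hasDerivAt_integral] with t ht hm
    rw [uIcc_of_le hab] at ht
    exact ht (Ioo_subset_Icc_self hm) c hc

lemma add (hf : LipDerivOn f f' a b) (hg : LipDerivOn g g' a b) :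
    LipDerivOn (fun t => f t + g t) (fun t => f' t + g' t) a b := by
  obtain ⟨K, hK⟩ := hf.lip
  obtain ⟨L, hL⟩ := hg.lip
  refine ⟨⟨K + L, hK.add hL⟩, ?_⟩
  filter_upwards [hf.deriv, hg.deriv] with t h1 h2 hm using (h1 hm).add (h2 hm)

lemma neg (hf : LipDerivOn f f' a b) :
    LipDerivOn (fun t => - f t) (fun t => - f' t) a b := by
  obtain ⟨K, hK⟩ := hf.lip
  refine ⟨⟨K, hK.neg⟩, ?_⟩
  filter_upwards [hf.deriv] with t h1 hm using (h1 hm).neg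

lemma sub (hf : LipDerivOn f f' a b) (hg : LipDerivOn g g' a b) :
    LipDerivOn (fun t => f t - g t) (fun t => f' t - g' t) a b := by
  simpa [sub_eq_add_neg] using hf.add hg.neg

lemma const (e : E) (a b : ℝ) : LipDerivOn (fun _ => e) (fun _ => 0) a b :=
  ⟨⟨0, (LipschitzWith.const e).lipschitzOnWith⟩, ae_of_all _ fun t _ => hasDerivAt_const t e⟩

lemma congr_deriv (hf : LipDerivOn f f' a b) (h : ∀ᵐ t, t ∈ Ioo a b → f' t = g' t) :
    LipDerivOn f g' a b := by
  refine ⟨hf.lip, ?_⟩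
  filter_upwards [hf.deriv, h] with t h1 h2 hm using h2 hm ▸ h1 hm

lemma congr (hf : LipDerivOn f f' a b) (h : EqOn f g (Icc a b)) : LipDerivOn g f' a b := by
  obtain ⟨K, hK⟩ := hf.lip
  refine ⟨⟨K, fun s hs t ht => by rw [← h hs, ← h ht]; exact hK hs ht⟩, ?_⟩
  filter_upwards [hf.deriv] with t ht hm
  exact (ht hm).congr_of_eventuallyEq
    (h.symm.eventuallyEq_of_mem (Icc_mem_nhds hm.1 hm.2))

lemma clm {G : Type*} [NormedAddCommGroup G] [NormedSpace ℝ G] (hf : LipDerivOn f f' a b)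
    (T : E →L[ℝ] G) : LipDerivOn (fun t => T (f t)) (fun t => T (f' t)) a b := by
  obtain ⟨K, hK⟩ := hf.lip
  refine ⟨⟨_, T.lipschitz.comp_lipschitzOnWith hK⟩, ?_⟩
  filter_upwards [hf.deriv] with t h1 hm using T.hasFDerivAt.comp_hasDerivAt t (h1 hm)

/-- The fundamental theorem of calculus for Lipschitz functions. -/
lemma integral_eq_sub [CompleteSpace E] (hf : LipDerivOn f f' a b) (hab : a ≤ b) :
    ∫ s in a..b, f' s = f b - f a := by
  obtain ⟨C, hC⟩ := hf.exists_norm_deriv_le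
  -- The difference of `f` and the primitive of `f'` is Lipschitz with derivative zero almost
  -- everywhere, hence constant by absolute continuity.
  have hg := hf.sub (of_integral hab (hf.intervalIntegrable hab) hC (left_mem_Icc.2 hab))
  obtain ⟨K, hK⟩ := hg.lip
  rw [← uIcc_of_le hab] at hK
  have h1 : ∀ᵐ q : ℝ, q ≠ a := by simp [ae_iff, measure_singleton]
  have h2 : ∀ᵐ q : ℝ, q ≠ b := by simp [ae_iff, measure_singleton]
  obtain ⟨e, he⟩ := hK.absolutelyContinuousOnInterval.const_of_ae_hasDerivAt_zero (by
    filter_upwards [hg.deriv, h1, h2] with t ht hta htb hm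
    rw [uIcc_of_le hab] at hm
    simpa using ht ⟨lt_of_le_of_ne hm.1 (Ne.symm hta), lt_of_le_of_ne hm.2 htb⟩)
  have ha := he a left_mem_uIcc
  have hb := he b right_mem_uIcc
  simp only [intervalIntegral.integral_same, sub_zero] at ha
  rw [← ha] at hb
  rw [← hb]; abel

lemma eq_add_integral [CompleteSpace E] (hf : LipDerivOn f f' a b) {s : ℝ} (hs : s ∈ Icc a b) :
    f s = f a + ∫ q in a..s, f' q := by
  rw [(hf.mono le_rfl hs.2).integral_eq_sub hs.1]; abel

end LipDerivOn

section Ring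

variable {R : Type*} [NormedRing R] [NormedAlgebra ℝ R] {f f' g g' : ℝ → R} {a b : ℝ}

lemma LipDerivOn.mul (hf : LipDerivOn f f' a b) (hg : LipDerivOn g g' a b) :
    LipDerivOn (fun t => f t * g t) (fun t => f' t * g t + f t * g' t) a b := by
  obtain ⟨K, hK⟩ := hf.lip
  obtain ⟨L, hL⟩ := hg.lip
  obtain ⟨A, hA⟩ := hf.exists_norm_le
  obtain ⟨B, hB⟩ := hg.exists_norm_le
  refine ⟨⟨K * B.toNNReal + A.toNNReal * L, LipschitzOnWith.of_dist_le_mul fun s hs t ht => ?_⟩, ?_⟩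
  · rw [dist_eq_norm]
    have h1 := hK.dist_le_mul s hs t ht
    have h2 := hL.dist_le_mul s hs t ht
    rw [dist_eq_norm] at h1 h2
    have h3 : f s * g s - f t * g t = (f s - f t) * g s + f t * (g s - g t) := by noncomm_ring
    rw [h3]
    refine (norm_add_le _ _).trans ?_
    have h4 : ‖(f s - f t) * g s‖ ≤ K * dist s t * B.toNNReal :=
      (norm_mul_le _ _).trans (mul_le_mul h1 ((hB s hs).trans (Real.le_coe_toNNReal B))
        (norm_nonneg _) (by positivity))
    have h5 : ‖f t * (g s - g t)‖ ≤ A.toNNReal * (L * dist s t) :=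
      (norm_mul_le _ _).trans (mul_le_mul ((hA t ht).trans (Real.le_coe_toNNReal A)) h2
        (norm_nonneg _) (by positivity))
    push_cast
    nlinarith
  · filter_upwards [hf.deriv, hg.deriv] with t h1 h2 hm
    exact (h1 hm).mul (h2 hm)

lemma LipDerivOn.mul_const (hf : LipDerivOn f f' a b) (c : R) :
    LipDerivOn (fun t => f t * c) (fun t => f' t * c) a b := by
  simpa using hf.mul (LipDerivOn.const c a b)

end Ring

end LipDerivOn

/-! ### Fubini's theorem for products in a normed ring -/

section Fubini

variable {R : Type*} [NormedRing R] [NormedAlgebra ℝ R] [CompleteSpace R]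

lemma integral_const_mul_ring {α : Type*} [MeasurableSpace α] {μ : Measure α} {f : α → R}
    (c : R) (hf : Integrable f μ) : ∫ t, c * f t ∂μ = c * ∫ t, f t ∂μ :=
  (ContinuousLinearMap.mul ℝ R c).integral_comp_comm hf

lemma integral_mul_const_ring {α : Type*} [MeasurableSpace α] {μ : Measure α} {f : α → R}
    (hf : Integrable f μ) (c : R) : ∫ t, f t * c ∂μ = (∫ t, f t ∂μ) * c :=
  ((ContinuousLinearMap.mul ℝ R).flip c).integral_comp_comm hf

/-- Exchange of the order of integration over a measurable set of the plane. -/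
lemma integral_mul_setIntegral_swap {ν₁ ν₂ : Measure ℝ} [SFinite ν₁] [SFinite ν₂] {f g : ℝ → R}
    (hf : Integrable f ν₁) (hg : Integrable g ν₂) {K : Set (ℝ × ℝ)} (hK : MeasurableSet K) :
    ∫ s, f s * (∫ q in {q | (s, q) ∈ K}, g q ∂ν₂) ∂ν₁ =
      ∫ q, (∫ s in {s | (s, q) ∈ K}, f s ∂ν₁) * g q ∂ν₂ := by
  have hint : Integrable (Function.uncurry fun s q => K.indicator (fun z => f z.1 * g z.2) (s, q))
      (ν₁.prod ν₂) := by
    have h := (hf.mul_prod hg).indicator hK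
    exact h
  have h1 : ∀ s, MeasurableSet {q | (s, q) ∈ K} := fun s => measurable_prodMk_left hK
  have h2 : ∀ q, MeasurableSet {s | (s, q) ∈ K} := fun q => measurable_prodMk_right hK
  have := integral_integral_swap hint
  convert this using 2
  · ext s
    rw [← integral_const_mul_ring _ hg.integrableOn, ← integral_indicator (h1 s)]
    rfl
  · ext q
    rw [← integral_mul_const_ring hf.integrableOn, ← integral_indicator (h2 q)]
    rfl

end Fubini

/-! ### Frobenius product, traces and positive semidefinite matrices -/

section MatrixAlgebra

lemma frob_eq_trace (A B : Matrix (Fin m) (Fin m) ℝ) : frob A B = (A.transpose * B).trace := by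
  simp only [frob, Matrix.trace, Matrix.diag, Matrix.mul_apply, Matrix.transpose_apply]
  exact Finset.sum_comm

lemma frob_comm (A B : Matrix (Fin m) (Fin m) ℝ) : frob A B = frob B A := by
  simp only [frob, mul_comm]

lemma frob_add_left (A B C : Matrix (Fin m) (Fin m) ℝ) :
    frob (A + B) C = frob A C + frob B C := by
  simp only [frob, Matrix.add_apply, add_mul, Finset.sum_add_distrib]

lemma frob_add_right (A B C : Matrix (Fin m) (Fin m) ℝ) :
    frob A (B + C) = frob A B + frob A C := by
  rw [frob_comm, frob_add_left, frob_comm B, frob_comm C]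

lemma frob_smul_left (r : ℝ) (A B : Matrix (Fin m) (Fin m) ℝ) :
    frob (r • A) B = r * frob A B := by
  simp only [frob, Matrix.smul_apply, smul_eq_mul, mul_assoc, Finset.mul_sum]

lemma frob_smul_right (r : ℝ) (A B : Matrix (Fin m) (Fin m) ℝ) :
    frob A (r • B) = r * frob A B := by
  rw [frob_comm, frob_smul_left, frob_comm]

lemma frob_sub_left (A B C : Matrix (Fin m) (Fin m) ℝ) :
    frob (A - B) C = frob A C - frob B C := by
  simp only [frob, Matrix.sub_apply, sub_mul, Finset.sum_sub_distrib]

lemma frob_sub_right (A B C : Matrix (Fin m) (Fin m) ℝ) :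
    frob A (B - C) = frob A B - frob A C := by
  rw [frob_comm, frob_sub_left, frob_comm B, frob_comm C]

lemma frob_neg_left (A B : Matrix (Fin m) (Fin m) ℝ) : frob (-A) B = - frob A B := by
  simp only [frob, Matrix.neg_apply, neg_mul, Finset.sum_neg_distrib]

lemma frob_zero_right (B : Matrix (Fin m) (Fin m) ℝ) : frob B 0 = 0 := by simp [frob]

/-- The Frobenius inner product with a fixed matrix, as a continuous linear map. -/
def frobCLM (A : Matrix (Fin m) (Fin m) ℝ) : Matrix (Fin m) (Fin m) ℝ →L[ℝ] ℝ :=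
  LinearMap.toContinuousLinearMap
    { toFun := fun B => frob A B
      map_add' := frob_add_right A
      map_smul' := fun r B => frob_smul_right r A B }

@[simp] lemma frobCLM_apply (A B : Matrix (Fin m) (Fin m) ℝ) : frobCLM A B = frob A B := rfl

/-- The trace as a continuous linear map. -/
def traceCLM : Matrix (Fin m) (Fin m) ℝ →L[ℝ] ℝ :=
  LinearMap.toContinuousLinearMap (Matrix.traceLinearMap (Fin m) ℝ ℝ)

/-- A matrix entry as a continuous linear map. -/
def entryCLM (i j : Fin m) : Matrix (Fin m) (Fin m) ℝ →L[ℝ] ℝ :=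
  LinearMap.toContinuousLinearMap (Matrix.entryLinearMap ℝ ℝ i j)

@[simp] lemma entryCLM_apply (i j : Fin m) (A : Matrix (Fin m) (Fin m) ℝ) :
    entryCLM i j A = A i j := rfl

lemma abs_entry_le_norm (A : Matrix (Fin m) (Fin m) ℝ) (i j : Fin m) : |A i j| ≤ ‖A‖ := by
  have h1 := Matrix.l2_opNorm_mulVec A (EuclideanSpace.single j (1 : ℝ))
  have h2 := PiLp.norm_apply_le (WithLp.toLp 2 (A.mulVec (Pi.single j 1)) :
    EuclideanSpace ℝ (Fin m)) i
  simp only [PiLp.norm_single, norm_one, mul_one] at h1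
  refine le_trans ?_ (h2.trans h1)
  simp

lemma abs_frob_le (A B : Matrix (Fin m) (Fin m) ℝ) : |frob A B| ≤ m ^ 2 * (‖A‖ * ‖B‖) := by
  have h : ∀ i j : Fin m, |A i j * B i j| ≤ ‖A‖ * ‖B‖ := fun i j => by
    rw [abs_mul]
    exact mul_le_mul (abs_entry_le_norm A i j) (abs_entry_le_norm B i j) (abs_nonneg _)
      (norm_nonneg _)
  calc |frob A B| ≤ ∑ i, ∑ j, |A i j * B i j| :=
        (Finset.abs_sum_le_sum_abs _ _).trans
          (Finset.sum_le_sum fun i _ => Finset.abs_sum_le_sum_abs _ _)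
    _ ≤ ∑ _i : Fin m, ∑ _j : Fin m, ‖A‖ * ‖B‖ :=
        Finset.sum_le_sum fun i _ => Finset.sum_le_sum fun j _ => h i j
    _ = m ^ 2 * (‖A‖ * ‖B‖) := by simp; ring

lemma exists_eq_transpose_mul_self {A : Matrix (Fin m) (Fin m) ℝ} (hA : A.PosSemidef) :
    ∃ C : Matrix (Fin m) (Fin m) ℝ, A = C.transpose * C := by
  open scoped MatrixOrder in
  obtain ⟨C, hC⟩ := CStarAlgebra.nonneg_iff_eq_star_mul_self.1 hA.nonneg
  exact ⟨C, by simpa [Matrix.star_eq_conjTranspose] using hC⟩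

lemma transpose_eq_of_posSemidef {A : Matrix (Fin m) (Fin m) ℝ} (hA : A.PosSemidef) :
    A.transpose = A := by
  simpa [Matrix.IsHermitian] using hA.isHermitian

lemma posSemidef_conj {A : Matrix (Fin m) (Fin m) ℝ} (hA : A.PosSemidef)
    (C : Matrix (Fin m) (Fin m) ℝ) : (C.transpose * A * C).PosSemidef := by
  simpa using hA.conjTranspose_mul_mul_same C

lemma posSemidef_conj_symm {A C : Matrix (Fin m) (Fin m) ℝ} (hA : A.PosSemidef)
    (hC : C.transpose = C) : (C * A * C).PosSemidef := by
  simpa [hC] using posSemidef_conj hA C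

lemma trace_mul_nonneg {A B : Matrix (Fin m) (Fin m) ℝ} (hA : A.PosSemidef) (hB : B.PosSemidef) :
    0 ≤ (A * B).trace := by
  obtain ⟨C, rfl⟩ := exists_eq_transpose_mul_self hB
  rw [← Matrix.mul_assoc, Matrix.trace_mul_comm, ← Matrix.mul_assoc]
  simpa using (hA.mul_mul_conjTranspose_same C).trace_nonneg

/-- With A = EᵀE and B = CᵀC, the trace of AB is the squared Frobenius norm of ECᵀ, so ECᵀ = 0. This
turns a vanishing trace into complementary slackness. -/
lemma mul_eq_zero_of_trace_mul_eq_zero {A B : Matrix (Fin m) (Fin m) ℝ} (hA : A.PosSemidef)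
    (hB : B.PosSemidef) (h : (A * B).trace = 0) : A * B = 0 := by
  obtain ⟨C, rfl⟩ := exists_eq_transpose_mul_self hB
  obtain ⟨E, rfl⟩ := exists_eq_transpose_mul_self hA
  have h1 : ((E * C.transpose).transpose * (E * C.transpose)).trace = 0 := by
    rw [← h, Matrix.transpose_mul, Matrix.transpose_transpose, Matrix.mul_assoc,
      Matrix.trace_mul_comm]
    simp only [Matrix.mul_assoc]
  have h2 : E * C.transpose = 0 := by
    apply Matrix.trace_conjTranspose_mul_self_eq_zero_iff.1
    simpa using h1
  calc E.transpose * E * (C.transpose * C) = E.transpose * (E * C.transpose) * C := by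
        simp only [Matrix.mul_assoc]
    _ = 0 := by simp [h2]

/-- DND is semidefinite, so the trace is also nonnegative and N(DND) = 0. Cancelling D gives NDN =
0, that is, the form of D vanishes on the range of N; definiteness leaves only N = 0. -/
lemma eq_zero_of_trace_mul_conj_eq_zero {N D : Matrix (Fin m) (Fin m) ℝ} (hN : N.PosSemidef)
    (hD : D.PosDef) (h : (N * (D * N * D)).trace ≤ 0) : N = 0 := by
  have hDt := transpose_eq_of_posSemidef hD.posSemidef
  have hK := posSemidef_conj_symm hN hDt
  have h0 := mul_eq_zero_of_trace_mul_eq_zero hN hK (le_antisymm h (trace_mul_nonneg hN hK))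
  have hu := (Matrix.isUnit_iff_isUnit_det D).1 hD.isUnit
  have h1 : N * D * N = 0 := by
    have : N * (D * N * D) * D⁻¹ = 0 := by rw [h0, Matrix.zero_mul]
    rw [← Matrix.mul_assoc, Matrix.mul_nonsing_inv_cancel_right _ _ hu] at this
    rw [Matrix.mul_assoc]; exact this
  by_contra hne
  obtain ⟨v, hv⟩ : ∃ v, N.mulVec v ≠ 0 := by
    by_contra! hall
    exact hne (Matrix.ext_of_mulVec_single fun i => by rw [hall, Matrix.zero_mulVec])
  have := hD.dotProduct_mulVec_pos hv
  have h2 : star (N.mulVec v) ⬝ᵥ D.mulVec (N.mulVec v) = v ⬝ᵥ (N * D * N).mulVec v := by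
    have h3 : N.mulVec v = Matrix.vecMul v N := by
      rw [← Matrix.vecMul_transpose, transpose_eq_of_posSemidef hN]
    rw [star_trivial, ← Matrix.mulVec_mulVec, ← Matrix.mulVec_mulVec,
      Matrix.dotProduct_mulVec v, ← h3]
  rw [h2, h1] at this
  simp at this

/-- No sign is assumed on F: with D = CᵀC the trace is the squared Frobenius norm of CFCᵀ. -/
lemma trace_mul_conj_self_nonneg {F D : Matrix (Fin m) (Fin m) ℝ} (hF : F.transpose = F)
    (hD : D.PosSemidef) : 0 ≤ (F * (D * F * D)).trace := by
  obtain ⟨C, rfl⟩ := exists_eq_transpose_mul_self hD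
  have h : (F * (C.transpose * C * F * (C.transpose * C))).trace =
      ((C * F * C.transpose).transpose * (C * F * C.transpose)).trace := by
    simp only [Matrix.transpose_mul, Matrix.transpose_transpose, hF]
    have h1 : F * (C.transpose * C * F * (C.transpose * C)) =
        (F * C.transpose * (C * F * C.transpose)) * C := by simp only [Matrix.mul_assoc]
    rw [h1, Matrix.trace_mul_comm]
    simp only [Matrix.mul_assoc]
  rw [h]
  simpa using (Matrix.posSemidef_conjTranspose_mul_self (C * F * C.transpose)).trace_nonneg

lemma sq_entry_le {A : Matrix (Fin m) (Fin m) ℝ} (hA : A.PosSemidef) (i j : Fin m) :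
    A i j ^ 2 ≤ A i i * A j j := by
  obtain ⟨C, rfl⟩ := exists_eq_transpose_mul_self hA
  simp only [Matrix.mul_apply, Matrix.transpose_apply, ← sq]
  exact Finset.sum_mul_sq_le_sq_mul_sq _ _ _

/-- Cauchy–Schwarz bounds A_ij² by A_ii A_jj, and these sum to the squared trace. This is why
monotonicity and the trace parametrization make a path 1-Lipschitz. -/
lemma sqrt_frob_self_le_trace {A : Matrix (Fin m) (Fin m) ℝ} (hA : A.PosSemidef) :
    √(frob A A) ≤ A.trace := by
  rw [Real.sqrt_le_left hA.trace_nonneg]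
  calc frob A A ≤ ∑ i, ∑ j, A i i * A j j :=
        Finset.sum_le_sum fun i _ => Finset.sum_le_sum fun j _ => by
          rw [← sq]; exact sq_entry_le hA i j
    _ = A.trace ^ 2 := by
        simp only [Matrix.trace, Matrix.diag, sq, Finset.sum_mul_sum]

lemma abs_entry_le_one {A B : Matrix (Fin m) (Fin m) ℝ} (hA : A.PosSemidef)
    (hAB : (B - A).PosSemidef) (hB : ∀ i, B i i = 1) (i j : Fin m) : |A i j| ≤ 1 := by
  have h : ∀ i, A i i ≤ 1 := fun i => by
    have := hAB.diag_nonneg (i := i)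
    rw [Matrix.sub_apply, hB i] at this
    linarith
  have h2 := sq_entry_le hA i j
  have h3 : A i j ^ 2 ≤ 1 := h2.trans (mul_le_one₀ (h i) hA.diag_nonneg (h j))
  exact (sq_le_one_iff_abs_le_one _).1 h3

lemma posDef_of_posSemidef_of_det_pos {A : Matrix (Fin m) (Fin m) ℝ} (hA : A.PosSemidef)
    (h : 0 < A.det) : A.PosDef :=
  hA.posDef_iff_det_ne_zero.2 h.ne'

lemma posSemidef_iff_transpose_quadForm {A : Matrix (Fin m) (Fin m) ℝ} :
    A.PosSemidef ↔ A.transpose = A ∧ ∀ v : Fin m → ℝ, 0 ≤ v ⬝ᵥ A.mulVec v := by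
  rw [Matrix.posSemidef_iff_dotProduct_mulVec]
  simp [Matrix.IsHermitian]

lemma frob_vecMulVec_self (A : Matrix (Fin m) (Fin m) ℝ) (v : Fin m → ℝ) :
    frob A (Matrix.vecMulVec v v) = v ⬝ᵥ A.mulVec v := by
  simp only [frob, Matrix.vecMulVec_apply, dotProduct, Matrix.mulVec, Finset.mul_sum]
  exact Finset.sum_congr rfl fun i _ => Finset.sum_congr rfl fun j _ => by ring

/-- For each v the condition is linear in A, so it passes through Bochner integrals. -/
lemma posSemidef_iff_frob_vecMulVec {A : Matrix (Fin m) (Fin m) ℝ} :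
    A.PosSemidef ↔ A.transpose = A ∧ ∀ v : Fin m → ℝ, 0 ≤ frob A (Matrix.vecMulVec v v) := by
  simp only [posSemidef_iff_transpose_quadForm, frob_vecMulVec_self]

lemma posSemidef_vecMulVec (v : Fin m → ℝ) : (Matrix.vecMulVec v v).PosSemidef := by
  simpa using Matrix.posSemidef_vecMulVec_self_star v

lemma isClosed_posSemidef : IsClosed {A : Matrix (Fin m) (Fin m) ℝ | A.PosSemidef} := by
  simp only [posSemidef_iff_transpose_quadForm, ← frob_vecMulVec_self, ofPred_and, ofPred_forall]
  refine (isClosed_eq (by fun_prop) continuous_id).inter (isClosed_iInter fun v => ?_)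
  refine isClosed_le continuous_const ?_
  simp only [frob]
  fun_prop

/-- The quadratic form is jointly continuous in ε and v and positive on the compact unit sphere at ε
= 0; homogeneity handles the other vectors. -/
lemma eventually_posDef_add_smul {A S : Matrix (Fin m) (Fin m) ℝ} (hA : A.PosDef)
    (hS : S.transpose = S) : ∀ᶠ ε in 𝓝 (0 : ℝ), (A + ε • S).PosDef := by
  have hc : IsCompact (Metric.sphere (0 : Fin m → ℝ) 1) := isCompact_sphere _ _
  have h : ∀ᶠ ε in 𝓝 (0 : ℝ), ∀ v ∈ Metric.sphere (0 : Fin m → ℝ) 1,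
      0 < v ⬝ᵥ (A + ε • S).mulVec v := by
    refine hc.eventually_forall_of_forall_eventually fun v hv => ?_
    have hcont : Continuous fun z : ℝ × (Fin m → ℝ) => z.2 ⬝ᵥ (A + z.1 • S).mulVec z.2 := by
      fun_prop
    refine hcont.continuousAt.eventually (lt_mem_nhds ?_)
    have hv0 : v ≠ 0 := by rintro rfl; simp at hv
    simpa using hA.dotProduct_mulVec_pos hv0
  filter_upwards [h] with ε hε
  refine Matrix.PosDef.of_dotProduct_mulVec_pos ?_ fun v hv => ?_
  · have := transpose_eq_of_posSemidef hA.posSemidef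
    simp [Matrix.IsHermitian, hS, this]
  · have hn : 0 < ‖v‖ := norm_pos_iff.2 hv
    have h1 := hε (‖v‖⁻¹ • v) (by simp [norm_smul, hn.ne'])
    rw [Matrix.mulVec_smul, smul_dotProduct, dotProduct_smul, smul_eq_mul, smul_eq_mul] at h1
    have : 0 < ‖v‖⁻¹ := inv_pos.2 hn
    rw [star_trivial]
    exact pos_of_mul_pos_right (pos_of_mul_pos_right h1 this.le) this.le

end MatrixAlgebra

/-! ### Inverses, log-determinants and semidefinite cones under limits -/

section MatrixAnalysis

/-- A remainder bounded by Kε² can be obtained pointwise and then integrated, which replaces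
dominated convergence when differentiating under an integral. -/
lemma hasDerivAt_zero_of_quadratic {f : ℝ → ℝ} {L K : ℝ}
    (h : ∀ᶠ ε in 𝓝 (0 : ℝ), |f ε - f 0 - ε * L| ≤ K * ε ^ 2) : HasDerivAt f L 0 := by
  have h1 : (fun ε : ℝ => f ε - f 0 - ε * L) =O[𝓝 0] fun ε => ‖ε - 0‖ ^ 2 := by
    refine Asymptotics.IsBigO.of_bound K ?_
    filter_upwards [h] with ε hε
    simpa using hε
  have h2 := (h1.hasFDerivAt (by norm_num)).hasDerivAt
  have h3 : HasDerivAt (fun ε : ℝ => f 0 + ε * L) L 0 := by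
    simpa using ((hasDerivAt_id (0 : ℝ)).mul_const L).const_add (f 0)
  have h4 := h2.add h3
  have h5 : ((fun ε => f ε - f 0 - ε * L) + fun ε => f 0 + ε * L) = f := by
    ext ε; simp only [Pi.add_apply]; ring
  rw [h5] at h4
  simpa using h4

lemma continuousAt_matrix_inv {A : Matrix (Fin m) (Fin m) ℝ} (hA : IsUnit A.det) :
    ContinuousAt (fun B : Matrix (Fin m) (Fin m) ℝ => B⁻¹) A := by
  obtain ⟨u, rfl⟩ := (Matrix.isUnit_iff_isUnit_det A).2 hA
  simp only [Matrix.nonsing_inv_eq_ringInverse]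
  exact NormedRing.inverse_continuousAt u

lemma ContinuousOn.matrix_inv {s : Set ℝ} {f : ℝ → Matrix (Fin m) (Fin m) ℝ}
    (hf : ContinuousOn f s) (hu : ∀ t ∈ s, IsUnit (f t).det) :
    ContinuousOn (fun t => (f t)⁻¹) s := fun t ht =>
  (continuousAt_matrix_inv (hu t ht)).comp_continuousWithinAt (hf t ht)

lemma inv_sub_inv {A B : Matrix (Fin m) (Fin m) ℝ} (hA : IsUnit A.det) (hB : IsUnit B.det) :
    A⁻¹ - B⁻¹ = A⁻¹ * (B - A) * B⁻¹ := by
  rw [Matrix.mul_sub, Matrix.sub_mul, Matrix.nonsing_inv_mul _ hA, Matrix.one_mul,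
    Matrix.mul_nonsing_inv_cancel_right _ _ hB]

/-- The resolvent identity, with the perturbed inverse kept on the right: substituted into itself it
gives an exact second-order expansion. -/
lemma inv_add_smul {A B : Matrix (Fin m) (Fin m) ℝ} {ε : ℝ} (hA : IsUnit A.det)
    (hB : IsUnit (A + ε • B).det) :
    (A + ε • B)⁻¹ = A⁻¹ - ε • ((A + ε • B)⁻¹ * (B * A⁻¹)) := by
  have h := inv_sub_inv hB hA
  rw [sub_add_cancel_left, Matrix.mul_neg, Matrix.neg_mul, Matrix.mul_smul, Matrix.smul_mul,
    Matrix.mul_assoc] at h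
  rw [← neg_add_eq_sub, ← h, sub_add_cancel]

lemma LipDerivOn.matrix_inv {f f' : ℝ → Matrix (Fin m) (Fin m) ℝ} {a b : ℝ}
    (hf : LipDerivOn f f' a b) (hu : ∀ t ∈ Icc a b, IsUnit (f t).det) :
    LipDerivOn (fun t => (f t)⁻¹) (fun t => -((f t)⁻¹ * f' t * (f t)⁻¹)) a b := by
  obtain ⟨K, hK⟩ := hf.lip
  obtain ⟨A, hA⟩ := isCompact_Icc.exists_bound_of_continuousOn
    (ContinuousOn.matrix_inv hf.continuousOn hu)
  refine ⟨⟨A.toNNReal * K * A.toNNReal, LipschitzOnWith.of_dist_le_mul fun s hs t ht => ?_⟩, ?_⟩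
  · rw [dist_eq_norm, inv_sub_inv (hu s hs) (hu t ht)]
    have h1 := hK.dist_le_mul t ht s hs
    rw [dist_eq_norm, dist_comm] at h1
    have h2 : ‖(f s)⁻¹‖ ≤ A.toNNReal := (hA s hs).trans (Real.le_coe_toNNReal A)
    have h3 : ‖(f t)⁻¹‖ ≤ A.toNNReal := (hA t ht).trans (Real.le_coe_toNNReal A)
    calc ‖(f s)⁻¹ * (f t - f s) * (f t)⁻¹‖ ≤ ‖(f s)⁻¹‖ * ‖f t - f s‖ * ‖(f t)⁻¹‖ :=
          (norm_mul_le _ _).trans (mul_le_mul_of_nonneg_right (norm_mul_le _ _) (norm_nonneg _))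
      _ ≤ A.toNNReal * (K * dist s t) * A.toNNReal := by gcongr
      _ = _ := by push_cast; ring
  · filter_upwards [hf.deriv] with t ht hm
    obtain ⟨u, hu'⟩ := (Matrix.isUnit_iff_isUnit_det (f t)).2 (hu t (Ioo_subset_Icc_self hm))
    have h1 := hasFDerivAt_ringInverse (𝕜 := ℝ) u
    rw [hu'] at h1
    have h2 := h1.comp_hasDerivAt t (ht hm)
    have h3 : (↑u⁻¹ : Matrix (Fin m) (Fin m) ℝ) = (f t)⁻¹ := by
      rw [← hu', Matrix.coe_units_inv]
    rw [h3] at h2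
    have h4 : (fun s => (f s)⁻¹) = Ring.inverse ∘ f := by
      ext1 s; exact Matrix.nonsing_inv_eq_ringInverse _
    rw [h4]
    simpa using h2

lemma intervalIntegrable_univ_sum {f : Fin m → ℝ → ℝ} {a b : ℝ}
    (h : ∀ i, IntervalIntegrable (f i) volume a b) :
    IntervalIntegrable (fun t => ∑ i, f i t) volume a b := by
  have := IntervalIntegrable.sum Finset.univ fun i _ => h i
  rwa [Finset.sum_fn] at this

lemma intervalIntegrable_clm {E G : Type*} [NormedAddCommGroup E] [NormedSpace ℝ E]
    [NormedAddCommGroup G] [NormedSpace ℝ G] {f : ℝ → E} {a b : ℝ}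
    (hf : IntervalIntegrable f volume a b) (T : E →L[ℝ] G) :
    IntervalIntegrable (fun t => T (f t)) volume a b :=
  ⟨T.integrable_comp hf.1, T.integrable_comp hf.2⟩

lemma intervalIntegrable_frob {X Z : ℝ → Matrix (Fin m) (Fin m) ℝ} {a b : ℝ} (hab : a ≤ b)
    (hX : ContinuousOn X (Icc a b)) (hZ : IntervalIntegrable Z volume a b) :
    IntervalIntegrable (fun t => frob (X t) (Z t)) volume a b := by
  simp only [frob]
  refine intervalIntegrable_univ_sum fun i => intervalIntegrable_univ_sum fun j => ?_
  refine IntervalIntegrable.continuousOn_mul (intervalIntegrable_clm hZ (entryCLM i j)) ?_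
  rw [uIcc_of_le hab]
  exact (entryCLM i j).continuous.comp_continuousOn hX

/-- Differentiation of a perturbed inverse under the integral sign. -/
lemma hasDerivAt_integral_frob_inv {D M Z : ℝ → Matrix (Fin m) (Fin m) ℝ} {a b : ℝ} (hab : a ≤ b)
    (hD : ContinuousOn D (Icc a b)) (hM : ContinuousOn M (Icc a b))
    (hu : ∀ t ∈ Icc a b, IsUnit (D t).det) (hZ : IntervalIntegrable Z volume a b) :
    HasDerivAt (fun ε : ℝ => ∫ t in a..b, frob (D t + ε • M t)⁻¹ (Z t))
      (-∫ t in a..b, frob ((D t)⁻¹ * M t * (D t)⁻¹) (Z t)) 0 := by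
  have hDi := ContinuousOn.matrix_inv hD hu
  obtain ⟨A, hA⟩ := isCompact_Icc.exists_bound_of_continuousOn hDi
  obtain ⟨B, hB⟩ := isCompact_Icc.exists_bound_of_continuousOn (hM.mul hDi)
  obtain ⟨B', hB'⟩ := isCompact_Icc.exists_bound_of_continuousOn (hDi.mul hM)
  -- Both products are needed: D⁻¹M for invertibility of D + εM by a Neumann series, MD⁻¹ in the
  -- resolvent identity.
  set C : ℝ := max B (max B' 0) with hC
  have hCn : 0 ≤ C := (le_max_right _ _).trans (le_max_right _ _)
  have hB1 : ∀ t ∈ Icc a b, ‖M t * (D t)⁻¹‖ ≤ C := fun t ht => (hB t ht).trans (le_max_left _ _)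
  have hB2 : ∀ t ∈ Icc a b, ‖(D t)⁻¹ * M t‖ ≤ C := fun t ht =>
    (hB' t ht).trans ((le_max_left _ _).trans (le_max_right _ _))
  have hsmall : ∀ᶠ ε in 𝓝 (0 : ℝ), |ε| * C ≤ 1 / 2 := by
    have : Tendsto (fun ε : ℝ => |ε| * C) (𝓝 0) (𝓝 0) := by
      have h : Continuous fun ε : ℝ => |ε| * C := by fun_prop
      simpa using h.tendsto 0
    filter_upwards [this.eventually (gt_mem_nhds (show (0 : ℝ) < 1 / 2 by norm_num))] with ε hε
    exact hε.le
  refine hasDerivAt_zero_of_quadratic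
    (K := |∫ t in a..b, (m : ℝ) ^ 2 * (2 * A * C * C * ‖Z t‖)|) ?_
  filter_upwards [hsmall] with ε hε
  have hunit : ∀ t ∈ Icc a b, IsUnit (D t + ε • M t).det := fun t ht => by
    have h1 : D t + ε • M t = D t * (1 - (-(ε • ((D t)⁻¹ * M t)))) := by
      rw [sub_neg_eq_add, Matrix.mul_add, Matrix.mul_one, Matrix.mul_smul, ← Matrix.mul_assoc,
        Matrix.mul_nonsing_inv _ (hu t ht), Matrix.one_mul]
    have h2 : ‖-(ε • ((D t)⁻¹ * M t))‖ < 1 := by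
      rw [norm_neg, norm_smul, Real.norm_eq_abs]
      have := mul_le_mul_of_nonneg_left (hB2 t ht) (abs_nonneg ε)
      linarith
    rw [h1, Matrix.det_mul]
    exact (hu t ht).mul ((Matrix.isUnit_iff_isUnit_det _).1 (isUnit_one_sub_of_norm_lt_one h2))
  -- The resolvent identity used twice: the error after the linear term is exactly of order ε².
  have hexp : ∀ t ∈ Icc a b, (D t + ε • M t)⁻¹ - (D t)⁻¹ + ε • ((D t)⁻¹ * M t * (D t)⁻¹) =
      ε ^ 2 • ((D t + ε • M t)⁻¹ * (M t * (D t)⁻¹) * (M t * (D t)⁻¹)) := fun t ht => by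
    have h1 : (D t + ε • M t)⁻¹ = (D t)⁻¹ - ε • ((D t + ε • M t)⁻¹ * (M t * (D t)⁻¹)) :=
      inv_add_smul (hu t ht) (hunit t ht)
    set V := (D t + ε • M t)⁻¹
    have h2 : V - (D t)⁻¹ = - (ε • (V * (M t * (D t)⁻¹))) := by
      nth_rewrite 1 [h1]; abel
    rw [h2, Matrix.mul_assoc (D t)⁻¹, neg_add_eq_sub, ← smul_sub, ← Matrix.sub_mul]
    have h3 : (D t)⁻¹ - V = ε • (V * (M t * (D t)⁻¹)) := by rw [← neg_sub, h2, neg_neg]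
    rw [h3, Matrix.smul_mul, smul_smul, sq]
  -- The identity gives ‖V‖ ≤ A + |ε| C ‖V‖ with |ε| C ≤ 1/2, and the last term is absorbed on the
  -- left.
  have hnorm : ∀ t ∈ Icc a b, ‖(D t + ε • M t)⁻¹‖ ≤ 2 * A := fun t ht => by
    have h1 : (D t + ε • M t)⁻¹ = (D t)⁻¹ - ε • ((D t + ε • M t)⁻¹ * (M t * (D t)⁻¹)) :=
      inv_add_smul (hu t ht) (hunit t ht)
    set V := (D t + ε • M t)⁻¹
    have h2 : ‖V‖ ≤ A + |ε| * (‖V‖ * C) := by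
      calc ‖V‖ = ‖(D t)⁻¹ - ε • (V * (M t * (D t)⁻¹))‖ := by rw [← h1]
        _ ≤ ‖(D t)⁻¹‖ + ‖ε • (V * (M t * (D t)⁻¹))‖ := norm_sub_le _ _
        _ ≤ A + |ε| * (‖V‖ * C) := by
          rw [norm_smul, Real.norm_eq_abs]
          gcongr
          · exact hA t ht
          · exact (norm_mul_le _ _).trans (mul_le_mul_of_nonneg_left (hB1 t ht) (norm_nonneg _))
    nlinarith [norm_nonneg V]
  have hi1 : IntervalIntegrable (fun t => frob (D t + ε • M t)⁻¹ (Z t)) volume a b :=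
    intervalIntegrable_frob hab (ContinuousOn.matrix_inv (hD.add (hM.const_smul ε)) hunit) hZ
  have hi2 := intervalIntegrable_frob hab hDi hZ
  have hi3 : IntervalIntegrable (fun t => frob ((D t)⁻¹ * M t * (D t)⁻¹) (Z t)) volume a b :=
    intervalIntegrable_frob hab ((hDi.mul hM).mul hDi) hZ
  have heq : (∫ t in a..b, frob (D t + ε • M t)⁻¹ (Z t)) -
      (∫ t in a..b, frob (D t + (0 : ℝ) • M t)⁻¹ (Z t))
      - ε * (-∫ t in a..b, frob ((D t)⁻¹ * M t * (D t)⁻¹) (Z t)) =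
      ∫ t in a..b, frob ((D t + ε • M t)⁻¹ - (D t)⁻¹ + ε • ((D t)⁻¹ * M t * (D t)⁻¹)) (Z t) := by
    simp only [frob_add_left, frob_sub_left, frob_smul_left, zero_smul, add_zero]
    rw [intervalIntegral.integral_add (hi1.sub hi2) (hi3.const_mul ε),
      intervalIntegral.integral_sub hi1 hi2, intervalIntegral.integral_const_mul]
    ring
  rw [heq]
  have hZn := hZ.norm
  calc |∫ t in a..b, frob ((D t + ε • M t)⁻¹ - (D t)⁻¹ + ε • ((D t)⁻¹ * M t * (D t)⁻¹)) (Z t)|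
      ≤ |∫ t in a..b, ε ^ 2 * ((m : ℝ) ^ 2 * (2 * A * C * C * ‖Z t‖))| := by
        rw [← Real.norm_eq_abs]
        refine intervalIntegral.norm_integral_le_abs_of_norm_le ?_ ?_
        · refine (ae_restrict_iff' measurableSet_uIoc).2 (ae_of_all _ fun t ht => ?_)
          have ht' : t ∈ Icc a b := by
            rw [uIoc_of_le hab] at ht; exact Ioc_subset_Icc_self ht
          have hA0 : 0 ≤ A := (norm_nonneg _).trans (hA t ht')
          rw [Real.norm_eq_abs, hexp t ht', frob_smul_left, abs_mul, abs_of_nonneg (sq_nonneg ε)]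
          refine mul_le_mul_of_nonneg_left ((abs_frob_le _ _).trans ?_) (sq_nonneg _)
          gcongr
          calc ‖(D t + ε • M t)⁻¹ * (M t * (D t)⁻¹) * (M t * (D t)⁻¹)‖
              ≤ ‖(D t + ε • M t)⁻¹‖ * ‖M t * (D t)⁻¹‖ * ‖M t * (D t)⁻¹‖ :=
                (norm_mul_le _ _).trans
                  (mul_le_mul_of_nonneg_right (norm_mul_le _ _) (norm_nonneg _))
            _ ≤ 2 * A * C * C := by
                have := hB1 t ht'
                have := hnorm t ht'
                gcongr
        · exact ((hZn.const_mul _).const_mul _).const_mul _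
    _ = _ := by
        rw [intervalIntegral.integral_const_mul, abs_mul, abs_of_nonneg (sq_nonneg ε), mul_comm]

/-- Factor out det D; then det(1 + εD⁻¹M) is 1 + ε tr(D⁻¹M) plus ε² times a polynomial in ε. -/
lemma hasDerivAt_log_det {D M : Matrix (Fin m) (Fin m) ℝ} (hD : IsUnit D.det) :
    HasDerivAt (fun ε : ℝ => Real.log (D + ε • M).det) (D⁻¹ * M).trace 0 := by
  have h1 : ∀ ε : ℝ, (D + ε • M).det = D.det * (1 + ε • (D⁻¹ * M)).det := fun ε => by
    rw [← Matrix.det_mul, Matrix.mul_add, Matrix.mul_one, Matrix.mul_smul, ← Matrix.mul_assoc,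
      Matrix.mul_nonsing_inv _ hD, Matrix.one_mul]
  obtain ⟨p, hp⟩ : ∃ p : Polynomial ℝ, ∀ ε : ℝ, (1 + ε • (D⁻¹ * M)).det =
      1 + (D⁻¹ * M).trace * ε + Polynomial.eval ε p * ε ^ 2 :=
    ⟨_, fun ε => Matrix.det_one_add_smul ε _⟩
  simp only [h1, hp]
  have h2 : HasDerivAt (fun ε : ℝ => 1 + (D⁻¹ * M).trace * ε + Polynomial.eval ε p * ε ^ 2)
      (D⁻¹ * M).trace 0 := by
    have h3 := (p.hasDerivAt 0).mul ((hasDerivAt_id (0 : ℝ)).pow 2)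
    have h4 := ((hasDerivAt_id (0 : ℝ)).const_mul (D⁻¹ * M).trace).const_add 1
    have h5 := h4.add h3
    refine HasDerivAt.congr_deriv (f := fun ε : ℝ => 1 + (D⁻¹ * M).trace * ε +
      Polynomial.eval ε p * ε ^ 2) h5 ?_
    simp
  have h5 := (h2.const_mul D.det).log (by simpa using hD.ne_zero)
  convert h5 using 1
  simp [hD.ne_zero]

lemma posSemidef_intervalIntegral {f : ℝ → Matrix (Fin m) (Fin m) ℝ} {a b : ℝ} (hab : a ≤ b)
    (hf : IntervalIntegrable f volume a b) (h : ∀ᵐ t, t ∈ Ioo a b → (f t).PosSemidef) :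
    (∫ t in a..b, f t).PosSemidef := by
  have h1 : ∀ᵐ q : ℝ, q ≠ b := by simp [ae_iff, measure_singleton]
  have h' : ∀ᵐ t, t ∈ Ioc a b → (f t).PosSemidef := by
    filter_upwards [h, h1] with t ht hb hm using ht ⟨hm.1, lt_of_le_of_ne hm.2 hb⟩
  have htr : ∀ i j, (∫ t in a..b, f t) i j = ∫ t in a..b, f t i j := fun i j =>
    ((entryCLM i j).intervalIntegral_comp_comm hf).symm
  refine posSemidef_iff_frob_vecMulVec.2 ⟨?_, fun v => ?_⟩
  · ext i j
    rw [Matrix.transpose_apply, htr, htr]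
    refine intervalIntegral.integral_congr_ae ?_
    rw [uIoc_of_le hab]
    filter_upwards [h'] with t ht hm
    exact congr_fun (congr_fun (transpose_eq_of_posSemidef (ht hm)) i) j
  · rw [frob_comm, ← frobCLM_apply, ← ContinuousLinearMap.intervalIntegral_comp_comm _ hf]
    refine intervalIntegral.integral_nonneg_of_ae_restrict hab ?_
    rw [EventuallyLE, ← restrict_Ioc_eq_restrict_Icc, ae_restrict_iff' measurableSet_Ioc]
    filter_upwards [h'] with t ht hm
    rw [frobCLM_apply, frob_comm]
    exact (posSemidef_iff_frob_vecMulVec.1 (ht hm)).2 v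

/-- The derivative is a limit of right difference quotients, and the semidefinite cone is closed. -/
lemma HasDerivAt.posSemidef {f : ℝ → Matrix (Fin m) (Fin m) ℝ} {A : Matrix (Fin m) (Fin m) ℝ}
    {t : ℝ} (hf : HasDerivAt f A t) (h : ∀ᶠ s in 𝓝[>] t, (f s - f t).PosSemidef) :
    A.PosSemidef := by
  have h1 := hasDerivWithinAt_iff_tendsto_slope.1 (hf.hasDerivWithinAt (s := Ioi t))
  rw [sdiff_singleton_eq_self (by simp)] at h1
  refine isClosed_posSemidef.mem_of_tendsto h1 ?_
  filter_upwards [h, self_mem_nhdsWithin] with s hs hts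
  rw [slope_def_module]
  exact hs.smul (inv_nonneg.2 (sub_nonneg.2 (le_of_lt hts)))

end MatrixAnalysis

/-! ### Lipschitz calculus entry by entry -/

section LipDerivOnEntries

lemma LipDerivOn.finset_sum {E ι : Type*} [NormedAddCommGroup E] [NormedSpace ℝ E]
    (s : Finset ι) {f f' : ι → ℝ → E} {a b : ℝ} (h : ∀ i ∈ s, LipDerivOn (f i) (f' i) a b) :
    LipDerivOn (fun t => ∑ i ∈ s, f i t) (fun t => ∑ i ∈ s, f' i t) a b := by
  classical
  induction s using Finset.induction_on with
  | empty => simpa using LipDerivOn.const (0 : E) a b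
  | insert i s hi ih =>
    simp only [Finset.sum_insert hi]
    exact (h i (Finset.mem_insert_self i s)).add
      (ih fun j hj => h j (Finset.mem_insert_of_mem hj))

lemma LipDerivOn.of_entries {f f' : ℝ → Matrix (Fin m) (Fin m) ℝ} {a b : ℝ}
    (h : ∀ i j, LipDerivOn (fun t => f t i j) (fun t => f' t i j) a b) : LipDerivOn f f' a b := by
  have h1 : ∀ A : Matrix (Fin m) (Fin m) ℝ,
      A = ∑ i, ∑ j, (ContinuousLinearMap.toSpanSingleton ℝ (Matrix.single i j (1 : ℝ)))
        (A i j) := by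
    intro A
    nth_rewrite 1 [Matrix.matrix_eq_sum_single A]
    simp [Matrix.smul_single]
  have h2 := LipDerivOn.finset_sum Finset.univ fun i _ =>
    LipDerivOn.finset_sum Finset.univ fun j _ =>
      (h i j).clm (ContinuousLinearMap.toSpanSingleton ℝ (Matrix.single i j (1 : ℝ)))
  simpa only [← h1] using h2

lemma LipDerivOn.comp_real {g g' f f' : ℝ → ℝ} {a b : ℝ} {K : ℝ≥0} {s : Set ℝ}
    (hf : LipDerivOn f f' a b) (hs : ∀ t ∈ Icc a b, f t ∈ s) (hg : LipschitzOnWith K g s)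
    (hg' : ∀ z ∈ s, HasDerivAt g (g' z) z) :
    LipDerivOn (fun t => g (f t)) (fun t => g' (f t) * f' t) a b := by
  obtain ⟨L, hL⟩ := hf.lip
  refine ⟨⟨K * L, hg.comp hL hs⟩, ?_⟩
  filter_upwards [hf.deriv] with t ht hm
  exact (hg' _ (hs t (Ioo_subset_Icc_self hm))).comp t (ht hm)

end LipDerivOnEntries

/-! ### The covariance function: smoothness, Schur monotonicity and variation -/

section Covariance

/-- The entry `(i, j)` of `ξ`, as a function of the overlap. -/
def xiEntry (β : ℕ → Fin m → ℝ) (i j : Fin m) (z : ℝ) : ℝ :=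
  ∑' p : ℕ, (β (p + 2) i * β (p + 2) j) * z ^ (p + 2)

/-- The derivative of `xiEntry`. -/
def xiEntryDeriv (β : ℕ → Fin m → ℝ) (i j : Fin m) (z : ℝ) : ℝ :=
  ∑' p : ℕ, ((p : ℝ) + 2) * (β (p + 2) i * β (p + 2) j) * z ^ (p + 1)

/-- The second derivative of `xiEntry`. -/
def xiEntryDeriv₂ (β : ℕ → Fin m → ℝ) (i j : Fin m) (z : ℝ) : ℝ :=
  ∑' p : ℕ, ((p : ℝ) + 2) * (β (p + 2) i * β (p + 2) j) * ((p + 1) * z ^ p)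

/-- The sum of the entries of `ξ(A) + (h hᵀ) ⊙ A`. -/
def xiTotal (β : ℕ → Fin m → ℝ) (h : Fin m → ℝ) (A : Matrix (Fin m) (Fin m) ℝ) : ℝ :=
  (∑ i, ∑ j, xiEntry β i j (A i j)) + frob (Matrix.vecMulVec h h) A

variable {β : ℕ → Fin m → ℝ}

lemma xiPrime_apply (A : Matrix (Fin m) (Fin m) ℝ) (i j : Fin m) :
    xiPrime β A i j = xiEntryDeriv β i j (A i j) := rfl

/-- Since (5/4)^p = (5/8)^p 2^p, the factor (5/8)^p absorbs the polynomial weight and 2^p is paid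
for by the summability hypothesis. The one majorant serves both derivatives of ξ. The radius 5/4
exceeds 1, so small perturbations of overlaps stay inside the domain. -/
lemma exists_summable_majorant (hβ : ∀ j, Summable fun p : ℕ => (2 : ℝ) ^ p * β p j ^ 2)
    (i j : Fin m) : ∃ u : ℕ → ℝ, Summable u ∧
    ∀ p : ℕ, ((p : ℝ) + 2) ^ 2 * |β (p + 2) i * β (p + 2) j| * (5 / 4) ^ (p + 2) ≤ u p := by
  have ht := tendsto_pow_const_mul_const_pow_of_abs_lt_one 2
    (show |(5 / 8 : ℝ)| < 1 by norm_num [abs_of_pos])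
  obtain ⟨B, hB⟩ := ht.bddAbove_range
  have hs : Summable fun p : ℕ => (2 : ℝ) ^ (p + 2) * β (p + 2) i ^ 2 +
      (2 : ℝ) ^ (p + 2) * β (p + 2) j ^ 2 :=
    ((summable_nat_add_iff 2).2 (hβ i)).add ((summable_nat_add_iff 2).2 (hβ j))
  refine ⟨_, hs.mul_left B, fun p => ?_⟩
  have h1 : ((p : ℝ) + 2) ^ 2 * (5 / 8) ^ (p + 2) ≤ B := by
    have := hB (mem_range_self (p + 2))
    push_cast at this
    exact this
  have h2 : |β (p + 2) i * β (p + 2) j| ≤ β (p + 2) i ^ 2 + β (p + 2) j ^ 2 := by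
    rw [abs_le]; constructor <;> nlinarith [sq_nonneg (β (p + 2) i + β (p + 2) j),
      sq_nonneg (β (p + 2) i - β (p + 2) j)]
  have h3 : ((5 : ℝ) / 4) ^ (p + 2) = (5 / 8) ^ (p + 2) * 2 ^ (p + 2) := by
    rw [← mul_pow]; norm_num
  have hB0 : 0 ≤ B := le_trans (by positivity) h1
  calc ((p : ℝ) + 2) ^ 2 * |β (p + 2) i * β (p + 2) j| * (5 / 4) ^ (p + 2)
      = (((p : ℝ) + 2) ^ 2 * (5 / 8) ^ (p + 2)) * (2 ^ (p + 2) * |β (p + 2) i * β (p + 2) j|) := by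
        rw [h3]; ring
    _ ≤ B * (2 ^ (p + 2) * (β (p + 2) i ^ 2 + β (p + 2) j ^ 2)) := by gcongr
    _ = _ := by ring

lemma term_deriv_bound {c z : ℝ} (p : ℕ) (hz : z ∈ Metric.ball (0 : ℝ) (5 / 4)) :
    |((p : ℝ) + 2) * c * z ^ (p + 1)| ≤ ((p : ℝ) + 2) ^ 2 * |c| * (5 / 4) ^ (p + 2) := by
  have hz' : |z| ≤ 5 / 4 := by simpa using (Metric.mem_ball.1 hz).le
  rw [abs_mul, abs_mul, abs_pow, abs_of_nonneg (by positivity : (0 : ℝ) ≤ p + 2)]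
  have h1 : |z| ^ (p + 1) ≤ (5 / 4) ^ (p + 2) :=
    (pow_le_pow_left₀ (abs_nonneg z) hz' _).trans
      (pow_le_pow_right₀ (by norm_num) (Nat.le_succ _))
  have h2 : ((p : ℝ) + 2) ≤ (p + 2) ^ 2 := by nlinarith [(Nat.cast_nonneg p : (0 : ℝ) ≤ p)]
  gcongr

lemma term_deriv₂_bound {c z : ℝ} (p : ℕ) (hz : z ∈ Metric.ball (0 : ℝ) (5 / 4)) :
    |((p : ℝ) + 2) * c * ((p + 1) * z ^ p)| ≤ ((p : ℝ) + 2) ^ 2 * |c| * (5 / 4) ^ (p + 2) := by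
  have hz' : |z| ≤ 5 / 4 := by simpa using (Metric.mem_ball.1 hz).le
  rw [abs_mul, abs_mul, abs_mul, abs_pow, abs_of_nonneg (by positivity : (0 : ℝ) ≤ p + 2),
    abs_of_nonneg (by positivity : (0 : ℝ) ≤ p + 1)]
  have h1 : |z| ^ p ≤ (5 / 4) ^ (p + 2) :=
    (pow_le_pow_left₀ (abs_nonneg z) hz' _).trans
      (pow_le_pow_right₀ (by norm_num) (by omega))
  calc ((p : ℝ) + 2) * |c| * ((p + 1) * |z| ^ p)
      ≤ ((p : ℝ) + 2) * |c| * ((p + 2) * (5 / 4) ^ (p + 2)) := by gcongr; norm_num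
    _ = _ := by ring

lemma summable_xiEntryDeriv
    (hβ : ∀ j, Summable fun p : ℕ => (2 : ℝ) ^ p * β p j ^ 2)
    (i j : Fin m) {z : ℝ} (hz : z ∈ Metric.ball (0 : ℝ) (5 / 4)) :
    Summable fun p : ℕ => ((p : ℝ) + 2) * (β (p + 2) i * β (p + 2) j) * z ^ (p + 1) := by
  obtain ⟨u, hu, hb⟩ := exists_summable_majorant hβ i j
  exact Summable.of_norm_bounded hu fun p => (term_deriv_bound p hz).trans (hb p)

lemma hasDerivAt_xiEntry
    (hβ : ∀ j, Summable fun p : ℕ => (2 : ℝ) ^ p * β p j ^ 2)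
    (i j : Fin m) {z : ℝ} (hz : z ∈ Metric.ball (0 : ℝ) (5 / 4)) :
    HasDerivAt (xiEntry β i j) (xiEntryDeriv β i j z) z := by
  obtain ⟨u, hu, hb⟩ := exists_summable_majorant hβ i j
  refine hasDerivAt_tsum_of_isPreconnected
    (g := fun p z => (β (p + 2) i * β (p + 2) j) * z ^ (p + 2))
    (g' := fun p z => ((p : ℝ) + 2) * (β (p + 2) i * β (p + 2) j) * z ^ (p + 1)) hu
    Metric.isOpen_ball (convex_ball _ _).isPreconnected (fun p y _ => ?_)
    (fun p y hy => (term_deriv_bound p hy).trans (hb p)) (y₀ := 0) (by simp) (by simp) hz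
  refine ((hasDerivAt_pow (p + 2) y).const_mul (β (p + 2) i * β (p + 2) j)).congr_deriv ?_
  have : p + 2 - 1 = p + 1 := rfl
  rw [this]
  push_cast
  ring

lemma hasDerivAt_xiEntryDeriv
    (hβ : ∀ j, Summable fun p : ℕ => (2 : ℝ) ^ p * β p j ^ 2)
    (i j : Fin m) {z : ℝ} (hz : z ∈ Metric.ball (0 : ℝ) (5 / 4)) :
    HasDerivAt (xiEntryDeriv β i j) (xiEntryDeriv₂ β i j z) z := by
  obtain ⟨u, hu, hb⟩ := exists_summable_majorant hβ i j
  refine hasDerivAt_tsum_of_isPreconnected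
    (g := fun (p : ℕ) z => ((p : ℝ) + 2) * (β (p + 2) i * β (p + 2) j) * z ^ (p + 1))
    (g' := fun (p : ℕ) z => ((p : ℝ) + 2) * (β (p + 2) i * β (p + 2) j) * ((p + 1) * z ^ p)) hu
    Metric.isOpen_ball (convex_ball _ _).isPreconnected (fun p y _ => ?_)
    (fun p y hy => (term_deriv₂_bound p hy).trans (hb p)) (y₀ := 0) (by simp) (by simp) hz
  refine ((hasDerivAt_pow (p + 1) y).const_mul _).congr_deriv ?_
  push_cast
  simp

lemma exists_lipschitzOnWith_xiEntryDeriv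
    (hβ : ∀ j, Summable fun p : ℕ => (2 : ℝ) ^ p * β p j ^ 2) (i j : Fin m) :
    ∃ K : ℝ≥0, LipschitzOnWith K (xiEntryDeriv β i j) (Metric.ball 0 (5 / 4)) := by
  obtain ⟨u, hu, hb⟩ := exists_summable_majorant hβ i j
  refine ⟨(∑' p, u p).toNNReal, (convex_ball _ _).lipschitzOnWith_of_nnnorm_hasDerivWithin_le
    (fun z hz => (hasDerivAt_xiEntryDeriv hβ i j hz).hasDerivWithinAt) fun z hz => ?_⟩
  rw [← NNReal.coe_le_coe, coe_nnnorm]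
  exact (tsum_of_norm_bounded hu.hasSum fun p => (term_deriv₂_bound p hz).trans (hb p)).trans
    (Real.le_coe_toNNReal _)

lemma exists_lipschitzOnWith_xiEntry
    (hβ : ∀ j, Summable fun p : ℕ => (2 : ℝ) ^ p * β p j ^ 2) (i j : Fin m) :
    ∃ K : ℝ≥0, LipschitzOnWith K (xiEntry β i j) (Metric.ball 0 (5 / 4)) := by
  obtain ⟨u, hu, hb⟩ := exists_summable_majorant hβ i j
  refine ⟨(∑' p, u p).toNNReal, (convex_ball _ _).lipschitzOnWith_of_nnnorm_hasDerivWithin_le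
    (fun z hz => (hasDerivAt_xiEntry hβ i j hz).hasDerivWithinAt) fun z hz => ?_⟩
  rw [← NNReal.coe_le_coe, coe_nnnorm]
  exact (tsum_of_norm_bounded hu.hasSum fun p => (term_deriv_bound p hz).trans (hb p)).trans
    (Real.le_coe_toNNReal _)

/-- Mean value inequality on the segment from z to w for y ↦ ξ(y) - ξ'(z) y, whose derivative ξ'(y)
- ξ'(z) is at most K|w - z|. -/
lemma exists_xiEntry_taylor
    (hβ : ∀ j, Summable fun p : ℕ => (2 : ℝ) ^ p * β p j ^ 2) (i j : Fin m) : ∃ K : ℝ, 0 ≤ K ∧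
    ∀ z ∈ Metric.ball (0 : ℝ) (5 / 4), ∀ w ∈ Metric.ball (0 : ℝ) (5 / 4),
      |xiEntry β i j w - xiEntry β i j z - xiEntryDeriv β i j z * (w - z)| ≤ K * (w - z) ^ 2 := by
  obtain ⟨K, hK⟩ := exists_lipschitzOnWith_xiEntryDeriv hβ i j
  refine ⟨K, K.2, fun z hz w hw => ?_⟩
  have hseg : segment ℝ z w ⊆ Metric.ball (0 : ℝ) (5 / 4) :=
    (convex_ball _ _).segment_subset hz hw
  have h := (convex_segment z w).norm_image_sub_le_of_norm_hasDerivWithin_le (C := K * |w - z|)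
    (f := fun y => xiEntry β i j y - xiEntryDeriv β i j z * y)
    (f' := fun y => xiEntryDeriv β i j y - xiEntryDeriv β i j z * 1) (fun y hy =>
      ((hasDerivAt_xiEntry hβ i j (hseg hy)).sub
        ((hasDerivAt_id y).const_mul (xiEntryDeriv β i j z))).hasDerivWithinAt) (fun y hy => by
      have h1 := hK.dist_le_mul y (hseg hy) z hz
      rw [Real.dist_eq, Real.dist_eq] at h1
      rw [mul_one, Real.norm_eq_abs]
      refine h1.trans (mul_le_mul_of_nonneg_left ?_ K.2)
      rw [segment_eq_uIcc] at hy
      exact abs_sub_left_of_mem_uIcc hy)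
    (left_mem_segment ℝ z w) (right_mem_segment ℝ z w)
  rw [Real.norm_eq_abs, Real.norm_eq_abs] at h
  calc _ = |xiEntry β i j w - xiEntryDeriv β i j z * w -
        (xiEntry β i j z - xiEntryDeriv β i j z * z)| := by congr 1; ring
    _ ≤ K * |w - z| * |w - z| := h
    _ = K * (w - z) ^ 2 := by rw [mul_assoc, ← sq, sq_abs]

lemma mem_ball_of_abs_le_one {z : ℝ} (hz : |z| ≤ 1) : z ∈ Metric.ball (0 : ℝ) (5 / 4) := by
  rw [Metric.mem_ball, Real.dist_eq, sub_zero]; linarith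

lemma LipDerivOn.xiTotal
    (hβ : ∀ j, Summable fun p : ℕ => (2 : ℝ) ^ p * β p j ^ 2)
    (h : Fin m → ℝ) {X X' : ℝ → Matrix (Fin m) (Fin m) ℝ} {a b : ℝ}
    (hX : LipDerivOn X X' a b) (h1 : ∀ t ∈ Icc a b, ∀ i j, |X t i j| ≤ 1) :
    LipDerivOn (fun t => xiTotal β h (X t))
      (fun t => frob (xiPrime β (X t) + Matrix.vecMulVec h h) (X' t)) a b := by
  have h2 := (LipDerivOn.finset_sum Finset.univ fun i _ =>
    LipDerivOn.finset_sum Finset.univ fun j _ =>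
      (hX.clm (entryCLM i j)).comp_real (fun t ht => mem_ball_of_abs_le_one (h1 t ht i j))
        (exists_lipschitzOnWith_xiEntry hβ i j).choose_spec
        (fun z hz => hasDerivAt_xiEntry hβ i j hz)).add
    (hX.clm (frobCLM (Matrix.vecMulVec h h)))
  refine h2.congr_deriv (ae_of_all _ fun t _ => ?_)
  simp only [frob_add_left]
  rfl

lemma LipDerivOn.xiPrime
    (hβ : ∀ j, Summable fun p : ℕ => (2 : ℝ) ^ p * β p j ^ 2)
    {X X' : ℝ → Matrix (Fin m) (Fin m) ℝ} {a b : ℝ}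
    (hX : LipDerivOn X X' a b) (h1 : ∀ t ∈ Icc a b, ∀ i j, |X t i j| ≤ 1) :
    LipDerivOn (fun t => xiPrime β (X t))
      (fun t => Matrix.of fun i j => xiEntryDeriv₂ β i j (X t i j) * X' t i j) a b :=
  LipDerivOn.of_entries fun i j =>
    (hX.clm (entryCLM i j)).comp_real (fun t ht => mem_ball_of_abs_le_one (h1 t ht i j))
      (exists_lipschitzOnWith_xiEntryDeriv hβ i j).choose_spec
      (fun _ hz => hasDerivAt_xiEntryDeriv hβ i j hz)

lemma xiPrime_zero : xiPrime β (0 : Matrix (Fin m) (Fin m) ℝ) = 0 := by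
  ext i j
  simp [xiPrime]

/-- Induction with the telescoping Y^{k+2} - X^{k+2} = Y^{k+1} ⊙ (Y - X) + (Y^{k+1} - X^{k+1}) ⊙ X;
the Schur product theorem makes both terms semidefinite. -/
lemma posSemidef_hadamard_pow_sub {X Y : Matrix (Fin m) (Fin m) ℝ} (hX : X.PosSemidef)
    (hY : Y.PosSemidef) (hXY : (Y - X).PosSemidef) (k : ℕ) :
    (Matrix.of fun i j => Y i j ^ (k + 1)).PosSemidef ∧
      (Matrix.of fun i j => Y i j ^ (k + 1) - X i j ^ (k + 1)).PosSemidef := by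
  induction k with
  | zero =>
    constructor
    · convert hY using 1; ext i j; simp
    · convert hXY using 1; ext i j; simp
  | succ k ih =>
    refine ⟨?_, ?_⟩
    · have h1 : (Matrix.of fun i j => Y i j ^ (k + 1 + 1)) =
          (Matrix.of fun i j => Y i j ^ (k + 1)).hadamard Y := by
        ext i j; simp [pow_succ]
      exact h1 ▸ ih.1.hadamard hY
    · have h1 : (Matrix.of fun i j => Y i j ^ (k + 1 + 1) - X i j ^ (k + 1 + 1)) =
          (Matrix.of fun i j => Y i j ^ (k + 1)).hadamard (Y - X) +
            (Matrix.of fun i j => Y i j ^ (k + 1) - X i j ^ (k + 1)).hadamard X := by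
        ext i j; simp [pow_succ]; ring
      exact h1 ▸ (ih.1.hadamard hXY).add (ih.2.hadamard hX)

/-- By the Schur product theorem `ξ'` is monotone on positive semidefinite matrices. -/
lemma posSemidef_xiPrime_sub
    (hβ : ∀ j, Summable fun p : ℕ => (2 : ℝ) ^ p * β p j ^ 2)
    {X Y : Matrix (Fin m) (Fin m) ℝ} (hX : X.PosSemidef)
    (hY : Y.PosSemidef) (hXY : (Y - X).PosSemidef) (hX1 : ∀ i j, |X i j| ≤ 1)
    (hY1 : ∀ i j, |Y i j| ≤ 1) : (xiPrime β Y - xiPrime β X).PosSemidef := by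
  set T : ℕ → Matrix (Fin m) (Fin m) ℝ := fun p => ((p : ℝ) + 2) •
    (Matrix.hadamard (Matrix.vecMulVec (β (p + 2)) (β (p + 2)))
      (Matrix.of fun i j => Y i j ^ (p + 1) - X i j ^ (p + 1))) with hT
  have hTp : ∀ p, (T p).PosSemidef := fun p =>
    ((posSemidef_vecMulVec _).hadamard (posSemidef_hadamard_pow_sub hX hY hXY p).2).smul
      (by positivity)
  have hsum : HasSum T (xiPrime β Y - xiPrime β X) := by
    refine Pi.hasSum.2 fun i => Pi.hasSum.2 fun j => ?_
    have h1 := (summable_xiEntryDeriv hβ i j (mem_ball_of_abs_le_one (hY1 i j))).hasSum.sub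
      (summable_xiEntryDeriv hβ i j (mem_ball_of_abs_le_one (hX1 i j))).hasSum
    have h2 : (fun p => T p i j) = fun p : ℕ =>
        ((p : ℝ) + 2) * (β (p + 2) i * β (p + 2) j) * Y i j ^ (p + 1) -
          ((p : ℝ) + 2) * (β (p + 2) i * β (p + 2) j) * X i j ^ (p + 1) := funext fun p => ?_
    · rw [h2]; exact h1
    simp only [hT, Matrix.smul_apply, Matrix.hadamard_apply, Matrix.vecMulVec_apply,
      Matrix.of_apply, smul_eq_mul]
    ring
  exact isClosed_posSemidef.mem_of_tendsto hsum
    (Eventually.of_forall fun s => Matrix.posSemidef_sum _ fun p _ => hTp p)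

lemma continuousOn_xiTotal
    (hβ : ∀ j, Summable fun p : ℕ => (2 : ℝ) ^ p * β p j ^ 2)
    (h : Fin m → ℝ) {X : ℝ → Matrix (Fin m) (Fin m) ℝ} {s : Set ℝ}
    (hX : ContinuousOn X s) (h1 : ∀ t ∈ s, ∀ i j, X t i j ∈ Metric.ball (0 : ℝ) (5 / 4)) :
    ContinuousOn (fun t => xiTotal β h (X t)) s := by
  refine ContinuousOn.add (continuousOn_finsetSum _ fun i _ =>
    continuousOn_finsetSum _ fun j _ => ?_)
    ((frobCLM _).continuous.comp_continuousOn hX)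
  exact fun t ht => (hasDerivAt_xiEntry hβ i j (h1 t ht i j)).continuousAt.comp_continuousWithinAt
    (f := fun t => X t i j) (((entryCLM i j).continuous.comp_continuousOn hX) t ht)

lemma continuousOn_xiPrime
    (hβ : ∀ j, Summable fun p : ℕ => (2 : ℝ) ^ p * β p j ^ 2)
    {X : ℝ → Matrix (Fin m) (Fin m) ℝ} {s : Set ℝ}
    (hX : ContinuousOn X s) (h1 : ∀ t ∈ s, ∀ i j, |X t i j| ≤ 1) :
    ContinuousOn (fun t => xiPrime β (X t)) s := by
  refine continuousOn_pi.2 fun i => continuousOn_pi.2 fun j => ?_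
  exact fun t ht => (hasDerivAt_xiEntryDeriv hβ i j
    (mem_ball_of_abs_le_one (h1 t ht i j))).continuousAt.comp_continuousWithinAt
    (f := fun t => X t i j) (((entryCLM i j).continuous.comp_continuousOn hX) t ht)

lemma continuousOn_frob {X Y : ℝ → Matrix (Fin m) (Fin m) ℝ} {s : Set ℝ} (hX : ContinuousOn X s)
    (hY : ContinuousOn Y s) : ContinuousOn (fun t => frob (X t) (Y t)) s :=
  continuousOn_finsetSum _ fun i _ => continuousOn_finsetSum _ fun j _ =>
    ((entryCLM i j).continuous.comp_continuousOn hX).mul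
      ((entryCLM i j).continuous.comp_continuousOn hY)

/-- Differentiation of `xiTotal` along an affine perturbation, under the integral sign. -/
lemma hasDerivAt_integral_xiTotal
    (hβ : ∀ j, Summable fun p : ℕ => (2 : ℝ) ^ p * β p j ^ 2)
    (h : Fin m → ℝ) {X V : ℝ → Matrix (Fin m) (Fin m) ℝ} {a b : ℝ}
    {μ : Measure ℝ} [IsFiniteMeasure μ] {s : Set ℝ} (hsab : s ⊆ Icc a b)
    (hX : ContinuousOn X (Icc a b)) (hV : ContinuousOn V (Icc a b))
    (h1 : ∀ t ∈ Icc a b, ∀ i j, |X t i j| ≤ 1) :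
    HasDerivAt (fun ε : ℝ => ∫ t in s, xiTotal β h (X t + ε • V t) ∂μ)
      (∫ t in s, frob (xiPrime β (X t) + Matrix.vecMulVec h h) (V t) ∂μ) 0 := by
  obtain ⟨C, hC⟩ := isCompact_Icc.exists_bound_of_continuousOn hV
  have hent : ∀ t ∈ Icc a b, ∀ i j, |V t i j| ≤ |C| := fun t ht i j =>
    (abs_entry_le_norm _ i j).trans ((hC t ht).trans (le_abs_self C))
  choose K hK0 hK using fun i j => exists_xiEntry_taylor hβ i j
  -- The room between the bound 1 on the entries and the radius 5/4.
  have hsmall : ∀ᶠ ε in 𝓝 (0 : ℝ), |ε| * |C| < 1 / 4 := by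
    have hc : Continuous fun ε : ℝ => |ε| * |C| := by fun_prop
    have := hc.tendsto 0
    simp only [abs_zero, zero_mul] at this
    exact this.eventually (gt_mem_nhds (by norm_num))
  refine hasDerivAt_zero_of_quadratic
    (K := (∑ i, ∑ j, K i j) * |C| ^ 2 * μ.real s) ?_
  filter_upwards [hsmall] with ε hε
  have hball : ∀ t ∈ Icc a b, ∀ i j, (X t + ε • V t) i j ∈ Metric.ball (0 : ℝ) (5 / 4) := by
    intro t ht i j
    rw [Metric.mem_ball, Real.dist_eq, sub_zero, Matrix.add_apply, Matrix.smul_apply, smul_eq_mul]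
    refine (abs_add_le _ _).trans_lt ?_
    rw [abs_mul]
    have := mul_le_mul_of_nonneg_left (hent t ht i j) (abs_nonneg ε)
    linarith [h1 t ht i j]
  have hint : ∀ f : ℝ → ℝ, ContinuousOn f (Icc a b) → IntegrableOn f s μ := fun f hf =>
    (hf.integrableOn_compact isCompact_Icc).mono_set hsab
  have hi1 := hint _ (continuousOn_xiTotal hβ h (hX.add (hV.const_smul ε)) hball)
  have hi2 := hint _ (continuousOn_xiTotal hβ h hX
    fun t ht i j => mem_ball_of_abs_le_one (h1 t ht i j))
  have hi3 := hint _ (continuousOn_frob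
    ((continuousOn_xiPrime hβ hX h1).add (continuousOn_const (c := Matrix.vecMulVec h h))) hV)
  simp only [zero_smul, add_zero]
  have hi1' : IntegrableOn (fun t => xiTotal β h (X t + ε • V t)) s μ := hi1
  have hi3' : IntegrableOn (fun t => frob (xiPrime β (X t) + Matrix.vecMulVec h h) (V t)) s μ := hi3
  have hi4 : IntegrableOn (fun t => xiTotal β h (X t + ε • V t) - xiTotal β h (X t)) s μ :=
    hi1'.sub hi2
  rw [← integral_sub hi1' hi2, ← integral_const_mul,
    ← integral_sub hi4 (hi3'.const_mul ε), ← Real.norm_eq_abs]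
  refine (norm_setIntegral_le_of_norm_le_const (measure_lt_top μ s)
    (C := (∑ i, ∑ j, K i j) * |C| ^ 2 * ε ^ 2) fun t ht => ?_).trans (le_of_eq (by ring))
  have ht' := hsab ht
  rw [Real.norm_eq_abs]
  have heq : xiTotal β h (X t + ε • V t) - xiTotal β h (X t) -
      ε * frob (xiPrime β (X t) + Matrix.vecMulVec h h) (V t) =
      ∑ i, ∑ j, (xiEntry β i j ((X t + ε • V t) i j) - xiEntry β i j (X t i j) -
        xiEntryDeriv β i j (X t i j) * ((X t + ε • V t) i j - X t i j)) := by
    simp only [xiTotal, frob_add_left, frob_add_right, frob_smul_right, Finset.sum_sub_distrib]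
    have h2 : frob (xiPrime β (X t)) (V t) * ε = ∑ i, ∑ j,
        xiEntryDeriv β i j (X t i j) * ((X t + ε • V t) i j - X t i j) := by
      simp only [frob, Finset.sum_mul, xiPrime_apply]
      refine Finset.sum_congr rfl fun i _ => Finset.sum_congr rfl fun j _ => ?_
      simp; ring
    rw [← h2]; ring
  simp only [heq]
  refine (Finset.abs_sum_le_sum_abs _ _).trans ?_
  rw [Finset.sum_mul, Finset.sum_mul]
  refine Finset.sum_le_sum fun i _ => (Finset.abs_sum_le_sum_abs _ _).trans ?_
  rw [Finset.sum_mul, Finset.sum_mul]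
  refine Finset.sum_le_sum fun j _ => ?_
  refine (hK i j _ (mem_ball_of_abs_le_one (h1 t ht' i j)) _ (hball t ht' i j)).trans ?_
  rw [mul_assoc]
  refine mul_le_mul_of_nonneg_left ?_ (hK0 i j)
  rw [Matrix.add_apply, Matrix.smul_apply, smul_eq_mul, add_sub_cancel_left, ← mul_pow, ← sq_abs]
  have := mul_le_mul_of_nonneg_left (hent t ht' i j) (abs_nonneg ε)
  rw [← sq_abs (|C| * ε), abs_mul, abs_mul, abs_abs]
  gcongr ?_ ^ 2
  linarith [mul_comm |C| |ε|]

end Covariance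

/-! ### Admissible pairs and the functional in terms of a cutoff -/

section Paths

variable {Q : Matrix (Fin m) (Fin m) ℝ} {x : ℝ → ℝ} {Φ : ℝ → Matrix (Fin m) (Fin m) ℝ}

lemma abs_entry_le_sqrt_frob (A : Matrix (Fin m) (Fin m) ℝ) (i j : Fin m) :
    |A i j| ≤ √(frob A A) := by
  rw [← Real.sqrt_sq_eq_abs]
  refine Real.sqrt_le_sqrt ?_
  have h1 : A i j ^ 2 ≤ ∑ j, A i j * A i j := by
    rw [sq]
    exact Finset.single_le_sum (f := fun j => A i j * A i j)
      (fun k _ => mul_self_nonneg _) (Finset.mem_univ j)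
  exact h1.trans (Finset.single_le_sum (f := fun i => ∑ j, A i j * A i j)
    (fun k _ => Finset.sum_nonneg fun l _ => mul_self_nonneg _) (Finset.mem_univ i))

lemma IsMatrixPath.lipDerivOn (hΦ : IsMatrixPath Q Φ) : LipDerivOn Φ (pathDeriv Φ) 0 m := by
  refine LipDerivOn.of_entries fun i j => ?_
  have hlip : LipschitzOnWith 1 (fun t => Φ t i j) (Icc (0 : ℝ) m) := by
    refine LipschitzOnWith.of_dist_le_mul fun s hs t ht => ?_
    rw [Real.dist_eq, Real.dist_eq, NNReal.coe_one, one_mul]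
    exact (abs_entry_le_sqrt_frob (Φ s - Φ t) i j).trans (hΦ.lipschitz t ht s hs)
  refine ⟨⟨1, hlip⟩, ?_⟩
  have hm : (0 : ℝ) ≤ m := Nat.cast_nonneg m
  rw [← uIcc_of_le hm] at hlip
  filter_upwards [hlip.absolutelyContinuousOnInterval.ae_differentiableAt] with t ht hmem
  rw [uIcc_of_le hm] at ht
  exact (ht (Ioo_subset_Icc_self hmem)).hasDerivAt

lemma IsMatrixPath.posSemidef_deriv (hΦ : IsMatrixPath Q Φ) :
    ∀ᵐ t, t ∈ Ioo (0 : ℝ) m → (pathDeriv Φ t).PosSemidef := by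
  filter_upwards [hΦ.lipDerivOn.deriv] with t ht hm
  refine HasDerivAt.posSemidef (ht hm) ?_
  filter_upwards [Ioo_mem_nhdsGT hm.2] with s hs
  exact hΦ.mono t (Ioo_subset_Icc_self hm) s ⟨hm.1.le.trans hs.1.le, hs.2.le⟩ hs.1.le

lemma IsMatrixPath.posSemidef_sub (hΦ : IsMatrixPath Q Φ) {t : ℝ} (ht : t ∈ Icc (0 : ℝ) m) :
    (Q - Φ t).PosSemidef := by
  rw [← hΦ.right_end]
  exact hΦ.mono t ht m (right_mem_Icc.2 (Nat.cast_nonneg m)) ht.2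

lemma IsMatrixPath.abs_entry_le_one (hΦ : IsMatrixPath Q Φ) (hQ : IsOverlapConstraint Q) {t : ℝ}
    (ht : t ∈ Icc (0 : ℝ) m) (i j : Fin m) : |Φ t i j| ≤ 1 :=
  VectorSpin.abs_entry_le_one (hΦ.posSemidef t ht) (hΦ.posSemidef_sub ht) hQ.diag i j

lemma IsOverlapConstraint.trace (hQ : IsOverlapConstraint Q) : Q.trace = m := by
  simp [Matrix.trace, hQ.diag]

/-- A path that is monotone and parametrized by its trace is automatically `1`-Lipschitz. -/
lemma IsMatrixPath.of_mono (hm : ∀ s ∈ Icc (0 : ℝ) m, ∀ t ∈ Icc (0 : ℝ) m, s ≤ t →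
    (Φ t - Φ s).PosSemidef) (htr : ∀ t ∈ Icc (0 : ℝ) m, (Φ t).trace = t) (h0 : Φ 0 = 0)
    (h1 : Φ m = Q) : IsMatrixPath Q Φ := by
  have hm0 : (0 : ℝ) ≤ m := Nat.cast_nonneg m
  have key : ∀ s ∈ Icc (0 : ℝ) m, ∀ t ∈ Icc (0 : ℝ) m, s ≤ t →
      √(frob (Φ t - Φ s) (Φ t - Φ s)) ≤ |t - s| := fun s hs t ht hst => by
    refine (sqrt_frob_self_le_trace (hm s hs t ht hst)).trans ?_
    rw [Matrix.trace_sub, htr s hs, htr t ht]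
    exact le_abs_self _
  refine ⟨fun t ht => ?_, hm, fun s hs t ht => ?_, htr, h0, h1⟩
  · simpa [h0] using hm 0 (left_mem_Icc.2 hm0) t ht ht.1
  · rcases le_total s t with hst | hst
    · exact key s hs t ht hst
    · have := key t ht s hs hst
      rw [abs_sub_comm]
      have h2 : frob (Φ t - Φ s) (Φ t - Φ s) = frob (Φ s - Φ t) (Φ s - Φ t) := by
        rw [← neg_sub (Φ s), frob_neg_left, frob_comm, frob_neg_left, neg_neg]
      rwa [h2]

lemma IsDistributionPath.intervalIntegrable_smul {E : Type*} [NormedAddCommGroup E]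
    [NormedSpace ℝ E] (hx : IsDistributionPath m x) {f : ℝ → E} {a b : ℝ} (ha : 0 ≤ a)
    (hb : b ≤ m) (hab : a ≤ b) (hf : IntervalIntegrable f volume a b) :
    IntervalIntegrable (fun t => x t • f t) volume a b := by
  have hsub : Ioc a b ⊆ Icc (0 : ℝ) m := fun t ht => ⟨ha.trans ht.1.le, ht.2.trans hb⟩
  have hxm : IntervalIntegrable x volume a b := by
    refine MonotoneOn.intervalIntegrable (hx.mono.mono ?_)
    rw [uIcc_of_le hab]
    exact Icc_subset_Icc ha hb
  rw [intervalIntegrable_iff_integrableOn_Ioc_of_le hab] at hf hxm ⊢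
  refine Integrable.bdd_smul hf 1 hxm.aestronglyMeasurable ?_
  refine (ae_restrict_iff' measurableSet_Ioc).2 (ae_of_all _ fun t ht => ?_)
  have := hx.mem t (hsub ht)
  rw [Real.norm_eq_abs, abs_of_nonneg this.1]
  exact this.2

/-- The data at which the Crisanti–Sommers functional is evaluated: a pair together with a point
`τ < m` at which `x = 1` and `Q - Φ τ` is positive definite. -/
structure IsFrame (Q : Matrix (Fin m) (Fin m) ℝ) (x : ℝ → ℝ)
    (Φ : ℝ → Matrix (Fin m) (Fin m) ℝ) (τ : ℝ) : Prop where
  distr : IsDistributionPath m x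
  path : IsMatrixPath Q Φ
  nonneg : 0 ≤ τ
  lt : τ < m
  eq_one : x τ = 1
  posDef : (Q - Φ τ).PosDef

lemma exists_eq_one_of_topTime_lt {T : ℝ} (hx : IsDistributionPath m x) (hT : topTime m x < T) :
    ∃ s ∈ Icc (0 : ℝ) m, x s = 1 ∧ s < T := by
  have hne : {t | t ∈ Icc (0 : ℝ) m ∧ x t = 1}.Nonempty :=
    ⟨m, right_mem_Icc.2 (Nat.cast_nonneg m), hx.right_end⟩
  obtain ⟨s, hs, hsT⟩ := exists_lt_of_csInf_lt hne hT
  exact ⟨s, hs.1, hs.2, hsT⟩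

lemma topTime_le {s : ℝ} (hs : s ∈ Icc (0 : ℝ) m) (h : x s = 1) : topTime m x ≤ s :=
  csInf_le ⟨0, fun _ ht => ht.1.1⟩ ⟨hs, h⟩

lemma topTime_nonneg : 0 ≤ topTime m x :=
  Real.sInf_nonneg fun _ ht => ht.1.1

lemma IsDistributionPath.eq_one_of_le (hx : IsDistributionPath m x) {s t : ℝ}
    (hs : s ∈ Icc (0 : ℝ) m) (h : x s = 1) (hst : s ≤ t) (ht : t ≤ m) : x t = 1 := by
  have ht' : t ∈ Icc (0 : ℝ) m := ⟨hs.1.trans hst, ht⟩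
  exact le_antisymm (hx.mem t ht').2 (h ▸ hx.mono hs ht' hst)

lemma IsAdmissible.isFrame {T : ℝ} (ha : IsAdmissible Q x Φ) (hT : IsCutoff Q x Φ T) :
    IsFrame Q x Φ T := by
  have h0 : 0 ≤ T := topTime_nonneg.trans hT.1.le
  obtain ⟨s, hs, h1, hsT⟩ := exists_eq_one_of_topTime_lt ha.distr hT.1
  exact ⟨ha.distr, ha.path, h0, hT.2.1, ha.distr.eq_one_of_le hs h1 hsT.le hT.2.1.le,
    posDef_of_posSemidef_of_det_pos (ha.path.posSemidef_sub ⟨h0, hT.2.1.le⟩) hT.2.2⟩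

lemma posDef_sub_of_le {A B : Matrix (Fin m) (Fin m) ℝ} (hA : (Q - A).PosDef)
    (hAB : (A - B).PosSemidef) : (Q - B).PosDef := by
  rw [← sub_add_sub_cancel Q A B]
  exact hA.add_posSemidef hAB

namespace IsFrame

variable {τ : ℝ}

/-- A frame tolerates τ equal to t_x, while a cutoff lies strictly above it; the point s < τ
supplies the strictness. -/
lemma isAdmissible (hf : IsFrame Q x Φ τ) {s : ℝ} (hs : s ∈ Icc (0 : ℝ) m) (h1 : x s = 1)
    (hsτ : s < τ) : IsAdmissible Q x Φ ∧ IsCutoff Q x Φ τ := by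
  have ht := (topTime_le hs h1).trans_lt hsτ
  refine ⟨⟨hf.distr, hf.path, ht.trans hf.lt, (posDef_sub_of_le hf.posDef ?_).det_pos⟩,
    ht, hf.lt, hf.posDef.det_pos⟩
  exact hf.path.mono _ ⟨topTime_nonneg, (ht.trans hf.lt).le⟩ _ ⟨hf.nonneg, hf.lt.le⟩ ht.le

lemma mem_Icc (hf : IsFrame Q x Φ τ) : τ ∈ Icc (0 : ℝ) m := ⟨hf.nonneg, hf.lt.le⟩

lemma Icc_subset (hf : IsFrame Q x Φ τ) : Icc 0 τ ⊆ Icc (0 : ℝ) m :=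
  Icc_subset_Icc_right hf.lt.le

lemma intervalIntegrable_deriv (hf : IsFrame Q x Φ τ) {a b : ℝ} (ha : 0 ≤ a) (hab : a ≤ b)
    (hb : b ≤ m) : IntervalIntegrable (pathDeriv Φ) volume a b :=
  (hf.path.lipDerivOn.mono ha hb).intervalIntegrable hab

lemma intervalIntegrable_smul_deriv (hf : IsFrame Q x Φ τ) {a b : ℝ} (ha : 0 ≤ a) (hab : a ≤ b)
    (hb : b ≤ m) : IntervalIntegrable (fun t => x t • pathDeriv Φ t) volume a b :=
  hf.distr.intervalIntegrable_smul ha hb hab (hf.intervalIntegrable_deriv ha hab hb)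

lemma pathHat_eq (hf : IsFrame Q x Φ τ) {t : ℝ} (ht : t ∈ Icc (0 : ℝ) m) :
    pathHat x Φ t = ∫ s in t..(m : ℝ), x s • pathDeriv Φ s := by
  ext i j
  rw [← entryCLM_apply i j (∫ s in t..(m : ℝ), x s • pathDeriv Φ s),
    ← (entryCLM i j).intervalIntegral_comp_comm (hf.intervalIntegrable_smul_deriv ht.1 ht.2 le_rfl)]
  rfl

lemma pathHat_add (hf : IsFrame Q x Φ τ) {s t : ℝ} (hs : 0 ≤ s) (hst : s ≤ t) (ht : t ≤ m) :
    pathHat x Φ s = (∫ q in s..t, x q • pathDeriv Φ q) + pathHat x Φ t := by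
  rw [hf.pathHat_eq ⟨hs, hst.trans ht⟩, hf.pathHat_eq ⟨hs.trans hst, ht⟩,
    intervalIntegral.integral_add_adjacent_intervals (hf.intervalIntegrable_smul_deriv hs hst ht)
      (hf.intervalIntegrable_smul_deriv (hs.trans hst) ht le_rfl)]

lemma pathHat_eq_sub (hf : IsFrame Q x Φ τ) {t : ℝ} (ht : τ ≤ t) (htm : t ≤ m) :
    pathHat x Φ t = Q - Φ t := by
  have ht0 := hf.nonneg.trans ht
  rw [hf.pathHat_eq ⟨ht0, htm⟩, ← hf.path.right_end,
    ← (hf.path.lipDerivOn.mono ht0 le_rfl).integral_eq_sub htm]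
  refine intervalIntegral.integral_congr fun s hs => ?_
  rw [uIcc_of_le htm] at hs
  simp only [hf.distr.eq_one_of_le hf.mem_Icc hf.eq_one (ht.trans hs.1) hs.2, one_smul]

lemma lipDerivOn_pathHat (hf : IsFrame Q x Φ τ) :
    LipDerivOn (pathHat x Φ) (fun t => -(x t • pathDeriv Φ t)) 0 m := by
  have hm0 : (0 : ℝ) ≤ m := Nat.cast_nonneg m
  obtain ⟨C, hC⟩ := hf.path.lipDerivOn.exists_norm_deriv_le
  have h1 := (LipDerivOn.of_integral (C := C) hm0
    (hf.intervalIntegrable_smul_deriv le_rfl hm0 le_rfl) (by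
      filter_upwards [hC] with t ht hm
      have := hf.distr.mem t (Ioo_subset_Icc_self hm)
      rw [norm_smul, Real.norm_eq_abs, abs_of_nonneg this.1]
      exact (mul_le_mul this.2 (ht hm) (norm_nonneg _) zero_le_one).trans (one_mul _).le)
    (right_mem_Icc.2 hm0)).neg
  refine h1.congr fun t ht => ?_
  rw [hf.pathHat_eq ht, intervalIntegral.integral_symm]

lemma posSemidef_pathHat_sub (hf : IsFrame Q x Φ τ) {s t : ℝ} (hs : 0 ≤ s) (hst : s ≤ t)
    (ht : t ≤ m) : (pathHat x Φ s - pathHat x Φ t).PosSemidef := by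
  rw [hf.pathHat_add hs hst ht, add_sub_cancel_right]
  refine posSemidef_intervalIntegral hst (hf.intervalIntegrable_smul_deriv hs hst ht) ?_
  filter_upwards [hf.path.posSemidef_deriv] with q hq hm
  have hq' : q ∈ Ioo (0 : ℝ) m := ⟨hs.trans_lt hm.1, hm.2.trans_le ht⟩
  exact (hq hq').smul (hf.distr.mem q (Ioo_subset_Icc_self hq')).1

/-- Φ̂ decreases in the semidefinite order, so up to τ it dominates Φ̂(τ) = Q - Φ(τ), which is
definite. -/
lemma posDef_pathHat (hf : IsFrame Q x Φ τ) {t : ℝ} (ht : t ∈ Icc 0 τ) :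
    (pathHat x Φ t).PosDef := by
  have h1 := hf.posSemidef_pathHat_sub ht.1 ht.2 hf.lt.le
  rw [← sub_add_cancel (pathHat x Φ t) (pathHat x Φ τ), add_comm]
  rw [hf.pathHat_eq_sub le_rfl hf.lt.le] at h1 ⊢
  exact hf.posDef.add_posSemidef h1

lemma isUnit_pathHat (hf : IsFrame Q x Φ τ) {t : ℝ} (ht : t ∈ Icc 0 τ) :
    IsUnit (pathHat x Φ t).det :=
  (Matrix.isUnit_iff_isUnit_det _).1 (hf.posDef_pathHat ht).isUnit

lemma continuousOn_pathHat (hf : IsFrame Q x Φ τ) : ContinuousOn (pathHat x Φ) (Icc (0 : ℝ) m) :=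
  hf.lipDerivOn_pathHat.continuousOn

lemma continuousOn_path (hf : IsFrame Q x Φ τ) : ContinuousOn Φ (Icc (0 : ℝ) m) :=
  hf.path.lipDerivOn.continuousOn

lemma continuousOn_pathHat_inv (hf : IsFrame Q x Φ τ) :
    ContinuousOn (fun t => (pathHat x Φ t)⁻¹) (Icc 0 τ) :=
  ContinuousOn.matrix_inv (hf.continuousOn_pathHat.mono hf.Icc_subset)
    fun _ ht => hf.isUnit_pathHat ht

lemma intervalIntegrable_entropy (hf : IsFrame Q x Φ τ) {a b : ℝ} (ha : 0 ≤ a) (hab : a ≤ b)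
    (hb : b ≤ τ) :
    IntervalIntegrable (fun t => frob (pathHat x Φ t)⁻¹ (pathDeriv Φ t)) volume a b :=
  intervalIntegrable_frob hab (hf.continuousOn_pathHat_inv.mono (Icc_subset_Icc ha hb))
    (hf.intervalIntegrable_deriv ha hab (hb.trans hf.lt.le))

variable {β : ℕ → Fin m → ℝ}

lemma lipDerivOn_xiTotal (hβ : ∀ j, Summable fun p : ℕ => (2 : ℝ) ^ p * β p j ^ 2)
    (h : Fin m → ℝ) (hQ : IsOverlapConstraint Q) (hf : IsFrame Q x Φ τ) :
    LipDerivOn (fun t => xiTotal β h (Φ t))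
      (fun t => frob (xiPrime β (Φ t) + Matrix.vecMulVec h h) (pathDeriv Φ t)) 0 m :=
  hf.path.lipDerivOn.xiTotal hβ h fun _ ht => hf.path.abs_entry_le_one hQ ht

lemma intervalIntegrable_energy (hβ : ∀ j, Summable fun p : ℕ => (2 : ℝ) ^ p * β p j ^ 2)
    (h : Fin m → ℝ) (hQ : IsOverlapConstraint Q) (hf : IsFrame Q x Φ τ) {a b : ℝ} (ha : 0 ≤ a)
    (hab : a ≤ b) (hb : b ≤ m) : IntervalIntegrable
      (fun t => x t * frob (xiPrime β (Φ t) + Matrix.vecMulVec h h) (pathDeriv Φ t))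
      volume a b :=
  hf.distr.intervalIntegrable_smul ha hb hab
    (((hf.lipDerivOn_xiTotal hβ h hQ).mono ha hb).intervalIntegrable hab)

/-- The functional in terms of the restriction of the pair to `[0, τ]`. -/
lemma two_mul_crisantiSommers (hβ : ∀ j, Summable fun p : ℕ => (2 : ℝ) ^ p * β p j ^ 2)
    (h : Fin m → ℝ) (hQ : IsOverlapConstraint Q) (hf : IsFrame Q x Φ τ) :
    2 * crisantiSommers β h x Φ τ =
      (∫ t in (0 : ℝ)..τ, x t * frob (xiPrime β (Φ t) + Matrix.vecMulVec h h) (pathDeriv Φ t))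
      + (xiTotal β h Q - xiTotal β h (Φ τ)) + Real.log (Q - Φ τ).det
      + ∫ t in (0 : ℝ)..τ, frob (pathHat x Φ t)⁻¹ (pathDeriv Φ t) := by
  rw [crisantiSommers, hf.path.right_end,
    ← intervalIntegral.integral_add_adjacent_intervals
      (hf.intervalIntegrable_energy hβ h hQ le_rfl hf.nonneg hf.lt.le)
      (hf.intervalIntegrable_energy hβ h hQ hf.nonneg hf.lt.le le_rfl)]
  -- Beyond τ the weight is 1 and the integrand is an exact derivative, so the path there enters
  -- only through its endpoints.
  have h1 : (∫ t in τ..(m : ℝ), x t *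
      frob (xiPrime β (Φ t) + Matrix.vecMulVec h h) (pathDeriv Φ t)) =
      xiTotal β h Q - xiTotal β h (Φ τ) := by
    rw [← hf.path.right_end, ← ((hf.lipDerivOn_xiTotal hβ h hQ).mono hf.nonneg
      le_rfl).integral_eq_sub hf.lt.le]
    refine intervalIntegral.integral_congr fun s hs => ?_
    rw [uIcc_of_le hf.lt.le] at hs
    simp only [hf.distr.eq_one_of_le hf.mem_Icc hf.eq_one hs.1 hs.2, one_mul]
  rw [h1]; ring

end IsFrame

end Paths

/-! ### Competitors with an atom at zero -/

section RemoveAtom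

variable {Q : Matrix (Fin m) (Fin m) ℝ} {y : ℝ → ℝ} {Ψ : ℝ → Matrix (Fin m) (Fin m) ℝ} {S : ℝ}

/-- The distribution function obtained by moving the mass of `[0, δ)` to `δ`. -/
def cutBelow (δ : ℝ) (y : ℝ → ℝ) (t : ℝ) : ℝ := if t < δ then 0 else y t

lemma cutBelow_of_lt {δ t : ℝ} (h : t < δ) : cutBelow δ y t = 0 := if_pos h

lemma cutBelow_of_le {δ t : ℝ} (h : δ ≤ t) : cutBelow δ y t = y t := if_neg (not_lt.2 h)

lemma integral_congr_Ioo {E : Type*} [NormedAddCommGroup E] [NormedSpace ℝ E] {f g : ℝ → E}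
    {a b : ℝ} (hab : a ≤ b) (h : ∀ t ∈ Ioo a b, f t = g t) :
    ∫ t in a..b, f t = ∫ t in a..b, g t := by
  rw [intervalIntegral.integral_of_le hab, intervalIntegral.integral_of_le hab,
    integral_Ioc_eq_integral_Ioo, integral_Ioc_eq_integral_Ioo]
  exact setIntegral_congr_fun measurableSet_Ioo h

lemma IsFrame.cutBelow (hf : IsFrame Q y Ψ S) {δ : ℝ} (hδS : δ ≤ S) :
    IsFrame Q (cutBelow δ y) Ψ S := by
  refine ⟨⟨fun t ht => ?_, fun s hs t ht hst => ?_, fun t ht => ?_, ?_⟩, hf.path, hf.nonneg, hf.lt,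
    ?_, hf.posDef⟩
  · rw [VectorSpin.cutBelow]
    split_ifs
    · simp
    · exact hf.distr.mem t ht
  · rcases lt_or_ge s δ with h | h
    · rw [cutBelow_of_lt h, VectorSpin.cutBelow]
      split_ifs
      · exact le_rfl
      · exact (hf.distr.mem t ht).1
    · rw [cutBelow_of_le h, cutBelow_of_le (h.trans hst)]
      exact hf.distr.mono hs ht hst
  · rcases lt_or_ge t δ with h | h
    · refine ContinuousAt.continuousWithinAt ?_
      refine (continuousAt_const (y := (0 : ℝ))).congr ?_
      filter_upwards [gt_mem_nhds h] with s hs using (cutBelow_of_lt hs).symm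
    · refine (hf.distr.rightCont t ht).congr (fun s hs => cutBelow_of_le (h.trans hs))
        (cutBelow_of_le h)
  · rw [cutBelow_of_le (hδS.trans hf.lt.le), hf.distr.right_end]
  · rw [cutBelow_of_le hδS, hf.eq_one]

lemma pathHat_cutBelow_of_le (hf : IsFrame Q y Ψ S) {δ t : ℝ} (hδS : δ ≤ S) (h0 : 0 ≤ t)
    (h : δ ≤ t) (ht : t ≤ m) : pathHat (cutBelow δ y) Ψ t = pathHat y Ψ t := by
  rw [hf.pathHat_eq ⟨h0, ht⟩, (hf.cutBelow hδS).pathHat_eq ⟨h0, ht⟩]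
  refine integral_congr_Ioo ht fun s hs => ?_
  rw [cutBelow_of_le (h.trans hs.1.le)]

lemma pathHat_cutBelow_of_ge (hf : IsFrame Q y Ψ S) {δ t : ℝ} (hδS : δ ≤ S) (h0 : 0 ≤ t)
    (h : t ≤ δ) : pathHat (cutBelow δ y) Ψ t = pathHat y Ψ δ := by
  have hδm := hδS.trans hf.lt.le
  rw [(hf.cutBelow hδS).pathHat_add h0 h hδm,
    pathHat_cutBelow_of_le hf hδS (h0.trans h) le_rfl hδm, add_eq_right]
  rw [integral_congr_Ioo (g := fun _ => 0) h fun s hs => by rw [cutBelow_of_lt hs.2, zero_smul]]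
  simp

variable {β : ℕ → Fin m → ℝ}

/-- Below δ the weight is zero, so the energy there disappears and Φ̂ is frozen at its value at δ;
above δ nothing changes. Every correction lives on [0, δ] and tends to 0 with δ. -/
lemma two_mul_crisantiSommers_cutBelow
    (hβ : ∀ j, Summable fun p : ℕ => (2 : ℝ) ^ p * β p j ^ 2)
    (h : Fin m → ℝ) (hQ : IsOverlapConstraint Q) (hf : IsFrame Q y Ψ S) {δ : ℝ} (hδ : 0 ≤ δ)
    (hδS : δ ≤ S) :
    2 * crisantiSommers β h (cutBelow δ y) Ψ S = 2 * crisantiSommers β h y Ψ S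
      - (∫ t in (0 : ℝ)..δ, y t * frob (xiPrime β (Ψ t) + Matrix.vecMulVec h h) (pathDeriv Ψ t))
      + (frob (pathHat y Ψ δ)⁻¹ (Ψ δ)
        - ∫ t in (0 : ℝ)..δ, frob (pathHat y Ψ t)⁻¹ (pathDeriv Ψ t)) := by
  have hf' := hf.cutBelow hδS
  have hSm := hf.lt.le
  rw [hf'.two_mul_crisantiSommers hβ h hQ, hf.two_mul_crisantiSommers hβ h hQ,
    ← intervalIntegral.integral_add_adjacent_intervals
      (hf'.intervalIntegrable_energy hβ h hQ le_rfl hδ (hδS.trans hSm))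
      (hf'.intervalIntegrable_energy hβ h hQ hδ hδS hSm),
    ← intervalIntegral.integral_add_adjacent_intervals
      (hf.intervalIntegrable_energy hβ h hQ le_rfl hδ (hδS.trans hSm))
      (hf.intervalIntegrable_energy hβ h hQ hδ hδS hSm),
    ← intervalIntegral.integral_add_adjacent_intervals
      (hf'.intervalIntegrable_entropy le_rfl hδ hδS)
      (hf'.intervalIntegrable_entropy hδ hδS le_rfl),
    ← intervalIntegral.integral_add_adjacent_intervals
      (hf.intervalIntegrable_entropy le_rfl hδ hδS)
      (hf.intervalIntegrable_entropy hδ hδS le_rfl)]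
  have e1 : (∫ t in (0 : ℝ)..δ, VectorSpin.cutBelow δ y t *
      frob (xiPrime β (Ψ t) + Matrix.vecMulVec h h) (pathDeriv Ψ t)) = 0 := by
    rw [integral_congr_Ioo (g := fun _ => 0) hδ fun s hs => by rw [cutBelow_of_lt hs.2, zero_mul]]
    simp
  have e2 : (∫ t in δ..S, VectorSpin.cutBelow δ y t *
      frob (xiPrime β (Ψ t) + Matrix.vecMulVec h h) (pathDeriv Ψ t)) =
      ∫ t in δ..S, y t * frob (xiPrime β (Ψ t) + Matrix.vecMulVec h h) (pathDeriv Ψ t) :=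
    integral_congr_Ioo hδS fun s hs => by rw [cutBelow_of_le hs.1.le]
  have e3 : (∫ t in (0 : ℝ)..δ, frob (pathHat (VectorSpin.cutBelow δ y) Ψ t)⁻¹ (pathDeriv Ψ t)) =
      frob (pathHat y Ψ δ)⁻¹ (Ψ δ) := by
    rw [integral_congr_Ioo (g := fun t => frobCLM (pathHat y Ψ δ)⁻¹ (pathDeriv Ψ t)) hδ
        fun s hs => by
      rw [pathHat_cutBelow_of_ge hf hδS hs.1.le hs.2.le, frobCLM_apply]]
    rw [ContinuousLinearMap.intervalIntegral_comp_comm _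
      (hf.intervalIntegrable_deriv le_rfl hδ (hδS.trans hSm)),
      (hf.path.lipDerivOn.mono le_rfl (hδS.trans hSm)).integral_eq_sub hδ, hf.path.left_end,
      sub_zero, frobCLM_apply]
  have e4 : (∫ t in δ..S, frob (pathHat (VectorSpin.cutBelow δ y) Ψ t)⁻¹ (pathDeriv Ψ t)) =
      ∫ t in δ..S, frob (pathHat y Ψ t)⁻¹ (pathDeriv Ψ t) :=
    integral_congr_Ioo hδS fun s hs => by
      rw [pathHat_cutBelow_of_le hf hδS (hδ.trans hs.1.le) hs.1.le (hs.2.le.trans hSm)]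
  rw [e1, e2, e3, e4]
  ring

lemma tendsto_integral_zero {f : ℝ → ℝ} {b : ℝ} (hb : 0 < b)
    (hf : IntervalIntegrable f volume 0 b) :
    Tendsto (fun δ => ∫ t in (0 : ℝ)..δ, f t) (𝓝[>] 0) (𝓝 0) := by
  have h1 := intervalIntegral.continuousOn_primitive_interval'
    hf (left_mem_uIcc : (0 : ℝ) ∈ uIcc 0 b)
  rw [uIcc_of_le hb.le] at h1
  have h2 := h1 0 (left_mem_Icc.2 hb.le)
  have h3 : 𝓝[>] (0 : ℝ) ≤ 𝓝[Icc 0 b] 0 :=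
    nhdsWithin_le_of_mem (mem_of_superset (Ioo_mem_nhdsGT hb) Ioo_subset_Icc_self)
  simpa [ContinuousWithinAt] using h2.mono_left h3

/-- A minimizer among the pairs without an atom at `0` minimizes over all admissible pairs. -/
lemma IsMinimizer.le_of_isFrame (hβ : ∀ j, Summable fun p : ℕ => (2 : ℝ) ^ p * β p j ^ 2)
    {h : Fin m → ℝ} (hQ : IsOverlapConstraint Q) {x : ℝ → ℝ}
    {Φ : ℝ → Matrix (Fin m) (Fin m) ℝ} (hmin : IsMinimizer β h Q x Φ) {T : ℝ}
    (hT : IsCutoff Q x Φ T) (hf : IsFrame Q y Ψ S) {s : ℝ} (hs : s ∈ Icc (0 : ℝ) m)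
    (hys : y s = 1) (hsS : s < S) :
    crisantiSommers β h x Φ T ≤ crisantiSommers β h y Ψ S := by
  have hS0 : 0 < S := hs.1.trans_lt hsS
  have key : ∀ᶠ δ in 𝓝[>] (0 : ℝ), 2 * crisantiSommers β h x Φ T ≤
      2 * crisantiSommers β h y Ψ S
      - (∫ t in (0 : ℝ)..δ, y t * frob (xiPrime β (Ψ t) + Matrix.vecMulVec h h) (pathDeriv Ψ t))
      + (frob (pathHat y Ψ δ)⁻¹ (Ψ δ)
        - ∫ t in (0 : ℝ)..δ, frob (pathHat y Ψ t)⁻¹ (pathDeriv Ψ t)) := by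
    filter_upwards [Ioo_mem_nhdsGT hS0] with δ hδ
    rw [← two_mul_crisantiSommers_cutBelow hβ h hQ hf hδ.1.le hδ.2.le]
    have hmax : max s δ ∈ Icc (0 : ℝ) m :=
      ⟨hs.1.trans (le_max_left _ _), max_le hs.2 (hδ.2.le.trans hf.lt.le)⟩
    obtain ⟨h1, h2⟩ := (hf.cutBelow hδ.2.le).isAdmissible hmax
      (by rw [cutBelow_of_le (le_max_right _ _)]
          exact hf.distr.eq_one_of_le hs hys (le_max_left _ _) hmax.2) (max_lt hsS hδ.2)
    -- For δ > 0 the modified distribution vanishes at 0, so it is a legitimate competitor.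
    have := hmin.2 _ _ h1 (cutBelow_of_lt hδ.1) T S hT h2
    linarith
  have l1 := tendsto_integral_zero hS0 (hf.intervalIntegrable_energy hβ h hQ le_rfl hS0.le hf.lt.le)
  have l3 := tendsto_integral_zero hS0 (hf.intervalIntegrable_entropy le_rfl hS0.le le_rfl)
  have l2 : Tendsto (fun δ => frob (pathHat y Ψ δ)⁻¹ (Ψ δ)) (𝓝[>] 0) (𝓝 0) := by
    have h1 := (continuousOn_frob hf.continuousOn_pathHat_inv
      (hf.continuousOn_path.mono hf.Icc_subset)) 0 (left_mem_Icc.2 hS0.le)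
    have h3 : 𝓝[>] (0 : ℝ) ≤ 𝓝[Icc 0 S] 0 :=
      nhdsWithin_le_of_mem (mem_of_superset (Ioo_mem_nhdsGT hS0) Ioo_subset_Icc_self)
    have h4 := h1.tendsto.mono_left h3
    rwa [hf.path.left_end, frob_zero_right] at h4
  have := ge_of_tendsto ((tendsto_const_nhds.sub l1).add (l2.sub l3)) key
  linarith

end RemoveAtom

/-! ### The perturbed pair and its functional -/

section Perturbation

/-- No differentiability is required: where the derivative does not exist both sides take the
default value 0. So the derivative of the perturbed path is matched pointwise on the open pieces. -/
lemma deriv_rescale (g : ℝ → ℝ) {ρ : ℝ} (hρ : ρ ≠ 0) (s : ℝ) :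
    deriv (fun t => ρ * g (ρ⁻¹ * t)) (ρ * s) = deriv g s := by
  rw [deriv_const_mul_field, deriv_comp_mul_left, inv_mul_cancel_left₀ hρ,
    smul_eq_mul, mul_inv_cancel_left₀ hρ]

lemma deriv_rescale_shift (g : ℝ → ℝ) {ρ : ℝ} (hρ : ρ ≠ 0) (s η d : ℝ) :
    deriv (fun t => ρ * g (ρ⁻¹ * (t - η)) + d) (ρ * s + η) = deriv g s := by
  rw [deriv_add_const, deriv_comp_sub_const (fun t => ρ * g (ρ⁻¹ * t)), add_sub_cancel_right,
    deriv_rescale g hρ]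

/-- The time of the original path that corresponds to time `t` of the perturbed path. -/
def pertTime (τ ρ η r t : ℝ) : ℝ := min τ (min (t / ρ) (max r ((t - η) / ρ)))

/-- The height at time `t` of the jump of total height `η` that starts at time `ρ r`. -/
def pertJump (ρ η r t : ℝ) : ℝ := max 0 (min η (t - ρ * r))

/-- The path `ρ Φ` up to time `τ`, with a jump `η P` inserted at time `r`, continued linearly
to `Q`. -/
def pertPath (Q : Matrix (Fin m) (Fin m) ℝ) (Φ : ℝ → Matrix (Fin m) (Fin m) ℝ)
    (P : Matrix (Fin m) (Fin m) ℝ) (τ ρ η r t : ℝ) : Matrix (Fin m) (Fin m) ℝ :=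
  ρ • Φ (pertTime τ ρ η r t) + pertJump ρ η r t • P
    + (max 0 (t - (ρ * τ + η)) / (m - (ρ * τ + η))) • (Q - (ρ • Φ τ + η • P))

/-- The distribution function that goes with `pertPath`; it has the value `c` along the jump. -/
def pertDistr (x : ℝ → ℝ) (τ ρ η r c t : ℝ) : ℝ :=
  if ρ * r ≤ t ∧ t < ρ * r + η then c else x (pertTime τ ρ η r t)

/-- The conditions under which `pertPath` and `pertDistr` form an admissible pair. -/
structure IsPerturbation (Q : Matrix (Fin m) (Fin m) ℝ) (x : ℝ → ℝ)
    (Φ : ℝ → Matrix (Fin m) (Fin m) ℝ) (P : Matrix (Fin m) (Fin m) ℝ) (τ ρ η r c : ℝ) : Prop where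
  frame : IsFrame Q x Φ τ
  trace_Q : Q.trace = m
  posSemidef : P.PosSemidef
  trace_P : P.trace = 1
  ρ_pos : 0 < ρ
  η_nonneg : 0 ≤ η
  r_mem : r ∈ Icc 0 τ
  c_nonneg : 0 ≤ c
  le_c : ∀ s ∈ Ico 0 r, x s ≤ c
  c_le : c ≤ x r
  lt : ρ * τ + η < m
  posDef : (Q - (ρ • Φ τ + η • P)).PosDef

variable {Q : Matrix (Fin m) (Fin m) ℝ} {x : ℝ → ℝ} {Φ : ℝ → Matrix (Fin m) (Fin m) ℝ}
  {P : Matrix (Fin m) (Fin m) ℝ} {τ ρ η r c : ℝ}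

namespace IsPerturbation

lemma pertTime_left (h : IsPerturbation Q x Φ P τ ρ η r c) {t : ℝ} (ht : t ≤ ρ * r) :
    pertTime τ ρ η r t = t / ρ := by
  have h1 : t / ρ ≤ r := by rw [div_le_iff₀ h.ρ_pos]; linarith
  rw [pertTime, min_eq_left (h1.trans (le_max_left _ _)), min_eq_right (h1.trans h.r_mem.2)]

lemma pertTime_mid (h : IsPerturbation Q x Φ P τ ρ η r c) {t : ℝ} (ht : ρ * r ≤ t)
    (ht' : t ≤ ρ * r + η) : pertTime τ ρ η r t = r := by
  have h1 : r ≤ t / ρ := by rw [le_div_iff₀ h.ρ_pos]; linarith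
  have h2 : (t - η) / ρ ≤ r := by rw [div_le_iff₀ h.ρ_pos]; linarith
  rw [pertTime, max_eq_left h2, min_eq_right h1, min_eq_right h.r_mem.2]

lemma pertTime_right (h : IsPerturbation Q x Φ P τ ρ η r c) {t : ℝ} (ht : ρ * r + η ≤ t)
    (ht' : t ≤ ρ * τ + η) : pertTime τ ρ η r t = (t - η) / ρ := by
  have h1 : r ≤ (t - η) / ρ := by rw [le_div_iff₀ h.ρ_pos]; linarith
  have h2 : (t - η) / ρ ≤ τ := by rw [div_le_iff₀ h.ρ_pos]; linarith
  have h3 : (t - η) / ρ ≤ t / ρ :=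
    div_le_div_of_nonneg_right (by linarith [h.η_nonneg]) h.ρ_pos.le
  rw [pertTime, max_eq_right h1, min_eq_right h3, min_eq_right h2]

lemma pertTime_top (h : IsPerturbation Q x Φ P τ ρ η r c) {t : ℝ} (ht : ρ * τ + η ≤ t) :
    pertTime τ ρ η r t = τ := by
  have h1 : τ ≤ (t - η) / ρ := by rw [le_div_iff₀ h.ρ_pos]; linarith
  have h2 : τ ≤ t / ρ := by rw [le_div_iff₀ h.ρ_pos]; linarith [h.η_nonneg]
  rw [pertTime, min_eq_left (le_min h2 (h1.trans (le_max_right _ _)))]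

lemma monotone_pertTime (h : IsPerturbation Q x Φ P τ ρ η r c) : Monotone (pertTime τ ρ η r) := by
  intro s t hst
  unfold pertTime
  have := h.ρ_pos
  gcongr

lemma continuous_pertTime : Continuous (pertTime τ ρ η r) := by
  unfold pertTime
  fun_prop

lemma pertTime_mem (h : IsPerturbation Q x Φ P τ ρ η r c) {t : ℝ} (ht : 0 ≤ t) :
    pertTime τ ρ η r t ∈ Icc 0 τ :=
  ⟨le_min h.frame.nonneg (le_min (div_nonneg ht h.ρ_pos.le) (h.r_mem.1.trans (le_max_left _ _))),
    min_le_left _ _⟩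

lemma mul_le_mul_top (h : IsPerturbation Q x Φ P τ ρ η r c) : ρ * r ≤ ρ * τ :=
  mul_le_mul_of_nonneg_left h.r_mem.2 h.ρ_pos.le

lemma mul_r_nonneg (h : IsPerturbation Q x Φ P τ ρ η r c) : 0 ≤ ρ * r :=
  mul_nonneg h.ρ_pos.le h.r_mem.1

lemma pertJump_left {t : ℝ} (h : IsPerturbation Q x Φ P τ ρ η r c) (ht : t ≤ ρ * r) :
    pertJump ρ η r t = 0 := by
  rw [pertJump, min_eq_right (by linarith [h.η_nonneg]), max_eq_left (by linarith)]

lemma pertJump_mid {t : ℝ} (ht : ρ * r ≤ t) (ht' : t ≤ ρ * r + η) :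
    pertJump ρ η r t = t - ρ * r := by
  rw [pertJump, min_eq_right (by linarith), max_eq_right (by linarith)]

lemma pertJump_right {t : ℝ} (h : IsPerturbation Q x Φ P τ ρ η r c) (ht : ρ * r + η ≤ t) :
    pertJump ρ η r t = η := by
  rw [pertJump, min_eq_left (by linarith), max_eq_right h.η_nonneg]

lemma pertPath_left (h : IsPerturbation Q x Φ P τ ρ η r c) {t : ℝ} (ht : t ≤ ρ * r) :
    pertPath Q Φ P τ ρ η r t = ρ • Φ (t / ρ) := by
  rw [pertPath, h.pertTime_left ht, h.pertJump_left ht,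
    max_eq_left (by linarith [h.mul_le_mul_top, h.η_nonneg])]
  simp

lemma pertPath_mid (h : IsPerturbation Q x Φ P τ ρ η r c) {t : ℝ} (ht : ρ * r ≤ t)
    (ht' : t ≤ ρ * r + η) : pertPath Q Φ P τ ρ η r t = ρ • Φ r + (t - ρ * r) • P := by
  rw [pertPath, h.pertTime_mid ht ht', pertJump_mid ht ht',
    max_eq_left (by linarith [h.mul_le_mul_top, h.η_nonneg])]
  simp

lemma pertPath_right (h : IsPerturbation Q x Φ P τ ρ η r c) {t : ℝ} (ht : ρ * r + η ≤ t)
    (ht' : t ≤ ρ * τ + η) : pertPath Q Φ P τ ρ η r t = ρ • Φ ((t - η) / ρ) + η • P := by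
  rw [pertPath, h.pertTime_right ht ht', h.pertJump_right ht, max_eq_left (by linarith)]
  simp

lemma pertPath_top (h : IsPerturbation Q x Φ P τ ρ η r c) :
    pertPath Q Φ P τ ρ η r (ρ * τ + η) = ρ • Φ τ + η • P := by
  rw [h.pertPath_right (by linarith [h.mul_le_mul_top]) le_rfl]
  congr 3
  rw [add_sub_cancel_right, mul_div_cancel_left₀ _ h.ρ_pos.ne']

lemma isMatrixPath (h : IsPerturbation Q x Φ P τ ρ η r c) :
    IsMatrixPath Q (pertPath Q Φ P τ ρ η r) := by
  have hgap : 0 < m - (ρ * τ + η) := by linarith [h.lt]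
  refine IsMatrixPath.of_mono (fun s hs t ht hst => ?_) (fun t ht => ?_) ?_ ?_
  · have e : pertPath Q Φ P τ ρ η r t - pertPath Q Φ P τ ρ η r s =
        ρ • (Φ (pertTime τ ρ η r t) - Φ (pertTime τ ρ η r s)) +
        (pertJump ρ η r t - pertJump ρ η r s) • P +
        (max 0 (t - (ρ * τ + η)) / (m - (ρ * τ + η)) -
          max 0 (s - (ρ * τ + η)) / (m - (ρ * τ + η))) • (Q - (ρ • Φ τ + η • P)) := by
      simp only [pertPath, smul_sub, sub_smul]; abel
    rw [e]
    refine ((Matrix.PosSemidef.smul (h.frame.path.mono _ (h.frame.Icc_subset (h.pertTime_mem hs.1))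
      _ (h.frame.Icc_subset (h.pertTime_mem ht.1)) (h.monotone_pertTime hst)) h.ρ_pos.le).add
      -- Each of the three pieces of the increment is a nonnegative multiple of a semidefinite
      -- matrix; the Lipschitz bound then comes for free.
      (h.posSemidef.smul (sub_nonneg.2 ?_))).add (h.posDef.posSemidef.smul (sub_nonneg.2 ?_))
    · unfold pertJump; gcongr
    · gcongr
  · have h1 := h.frame.path.trace_eq _ (h.frame.Icc_subset (h.pertTime_mem ht.1))
    have h2 := h.frame.path.trace_eq _ h.frame.mem_Icc
    rw [pertPath, Matrix.trace_add, Matrix.trace_add, Matrix.trace_smul, Matrix.trace_smul,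
      Matrix.trace_smul, Matrix.trace_sub, Matrix.trace_add, Matrix.trace_smul, Matrix.trace_smul,
      h1, h2, h.trace_P, h.trace_Q]
    simp only [smul_eq_mul, mul_one]
    rw [div_mul_cancel₀ _ hgap.ne']
    rcases le_total t (ρ * r) with h3 | h3
    · rw [h.pertTime_left h3, h.pertJump_left h3,
        max_eq_left (by linarith [h.mul_le_mul_top, h.η_nonneg]), mul_div_cancel₀ _ h.ρ_pos.ne']
      ring
    rcases le_total t (ρ * r + η) with h4 | h4
    · rw [h.pertTime_mid h3 h4, pertJump_mid h3 h4,
        max_eq_left (by linarith [h.mul_le_mul_top, h.η_nonneg])]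
      ring
    rcases le_total t (ρ * τ + η) with h5 | h5
    · rw [h.pertTime_right h4 h5, h.pertJump_right h4, max_eq_left (by linarith),
        mul_div_cancel₀ _ h.ρ_pos.ne']
      ring
    · rw [h.pertTime_top h5, h.pertJump_right h4, max_eq_right (by linarith)]
      ring
  · rw [h.pertPath_left h.mul_r_nonneg, zero_div, h.frame.path.left_end, smul_zero]
  · rw [pertPath, h.pertTime_top h.lt.le,
      h.pertJump_right (by linarith [h.mul_le_mul_top, h.lt]), max_eq_right hgap.le,
      div_self hgap.ne', one_smul]
    abel

lemma pertDistr_left (h : IsPerturbation Q x Φ P τ ρ η r c) {t : ℝ} (ht : t < ρ * r) :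
    pertDistr x τ ρ η r c t = x (t / ρ) := by
  rw [pertDistr, if_neg (fun h' => absurd h'.1 (not_le.2 ht)), h.pertTime_left ht.le]

lemma pertDistr_mid {t : ℝ} (ht : ρ * r ≤ t) (ht' : t < ρ * r + η) :
    pertDistr x τ ρ η r c t = c := if_pos ⟨ht, ht'⟩

lemma pertDistr_of_ge {t : ℝ} (ht : ρ * r + η ≤ t) :
    pertDistr x τ ρ η r c t = x (pertTime τ ρ η r t) :=
  if_neg fun h' => absurd h'.2 (not_lt.2 ht)

lemma isDistributionPath (h : IsPerturbation Q x Φ P τ ρ η r c) :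
    IsDistributionPath m (pertDistr x τ ρ η r c) := by
  have hx := h.frame.distr
  have hmem : ∀ t, 0 ≤ t → pertTime τ ρ η r t ∈ Icc (0 : ℝ) m := fun t ht =>
    h.frame.Icc_subset (h.pertTime_mem ht)
  have hr : r ∈ Icc (0 : ℝ) m := h.frame.Icc_subset h.r_mem
  have hrc : ∀ t ∈ Ico (0 : ℝ) m,
      ContinuousWithinAt (fun t => x (pertTime τ ρ η r t)) (Ici t) t := fun t ht => by
    refine ContinuousWithinAt.comp (t := Ici (pertTime τ ρ η r t))
      (hx.rightCont _ ⟨(hmem t ht.1).1, (h.pertTime_mem ht.1).2.trans_lt h.frame.lt⟩)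
      continuous_pertTime.continuousWithinAt fun s hs => h.monotone_pertTime hs
  refine ⟨fun t ht => ?_, fun s hs t ht hst => ?_, fun t ht => ?_, ?_⟩
  · rw [pertDistr]
    split_ifs
    · exact ⟨h.c_nonneg, h.c_le.trans (hx.mem r hr).2⟩
    · exact hx.mem _ (hmem t ht.1)
  · rcases lt_or_ge t (ρ * r) with h1 | h1
    · rw [h.pertDistr_left h1, h.pertDistr_left (hst.trans_lt h1), ← h.pertTime_left h1.le,
        ← h.pertTime_left (hst.trans h1.le)]
      exact hx.mono (hmem s hs.1) (hmem t ht.1) (h.monotone_pertTime hst)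
    rcases lt_or_ge t (ρ * r + η) with h2 | h2
    · rw [pertDistr_mid h1 h2]
      rcases lt_or_ge s (ρ * r) with h3 | h3
      · rw [h.pertDistr_left h3]
        refine h.le_c _ ⟨div_nonneg hs.1 h.ρ_pos.le, ?_⟩
        rw [div_lt_iff₀ h.ρ_pos]; linarith
      · rw [pertDistr_mid h3 (hst.trans_lt h2)]
    · rw [pertDistr_of_ge h2]
      rw [pertDistr]
      split_ifs with h3
      · refine h.c_le.trans (hx.mono hr (hmem t ht.1) ?_)
        exact (h.pertTime_mid h3.1 h3.2.le).symm.le.trans (h.monotone_pertTime hst)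
      · exact hx.mono (hmem s hs.1) (hmem t ht.1) (h.monotone_pertTime hst)
  · rcases lt_or_ge t (ρ * r) with h1 | h1
    · refine (hrc t ht).congr_of_eventuallyEq ?_ ?_
      · filter_upwards [mem_nhdsWithin_of_mem_nhds (gt_mem_nhds h1)] with s hs
        rw [h.pertDistr_left hs, h.pertTime_left hs.le]
      · rw [h.pertDistr_left h1, h.pertTime_left h1.le]
    rcases lt_or_ge t (ρ * r + η) with h2 | h2
    · refine (continuousWithinAt_const (b := c)).congr_of_eventuallyEq ?_ (pertDistr_mid h1 h2)
      filter_upwards [mem_nhdsWithin_of_mem_nhds (gt_mem_nhds h2), self_mem_nhdsWithin]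
        with s hs hs'
      exact pertDistr_mid (h1.trans hs') hs
    · exact (hrc t ht).congr (fun s hs => pertDistr_of_ge (h2.trans hs)) (pertDistr_of_ge h2)
  · rw [pertDistr_of_ge (by linarith [h.mul_le_mul_top, h.lt]), h.pertTime_top h.lt.le,
      h.frame.eq_one]

lemma isFrame (h : IsPerturbation Q x Φ P τ ρ η r c) :
    IsFrame Q (pertDistr x τ ρ η r c) (pertPath Q Φ P τ ρ η r) (ρ * τ + η) :=
  ⟨h.isDistributionPath, h.isMatrixPath,
    add_nonneg (mul_nonneg h.ρ_pos.le h.frame.nonneg) h.η_nonneg, h.lt,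
    by rw [pertDistr_of_ge (by linarith [h.mul_le_mul_top]), h.pertTime_top le_rfl, h.frame.eq_one],
    by rw [h.pertPath_top]; exact h.posDef⟩

lemma pathDeriv_left (h : IsPerturbation Q x Φ P τ ρ η r c) {s : ℝ} (hs : s < r) :
    pathDeriv (pertPath Q Φ P τ ρ η r) (ρ * s) = pathDeriv Φ s := by
  ext i j
  have h1 : ρ * s < ρ * r := mul_lt_mul_of_pos_left hs h.ρ_pos
  have e : (fun t => pertPath Q Φ P τ ρ η r t i j) =ᶠ[𝓝 (ρ * s)]
      fun t => ρ * (fun u => Φ u i j) (ρ⁻¹ * t) := by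
    filter_upwards [gt_mem_nhds h1] with t ht
    rw [h.pertPath_left ht.le, Matrix.smul_apply, smul_eq_mul, div_eq_inv_mul]
  simp only [pathDeriv, Matrix.of_apply]
  rw [e.deriv_eq]
  exact deriv_rescale (fun u => Φ u i j) h.ρ_pos.ne' s

lemma pathDeriv_mid (h : IsPerturbation Q x Φ P τ ρ η r c) {t : ℝ} (ht : ρ * r < t)
    (ht' : t < ρ * r + η) : pathDeriv (pertPath Q Φ P τ ρ η r) t = P := by
  ext i j
  have e : (fun t => pertPath Q Φ P τ ρ η r t i j) =ᶠ[𝓝 t]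
      fun t => ρ * Φ r i j + (t - ρ * r) * P i j := by
    filter_upwards [gt_mem_nhds ht', lt_mem_nhds ht] with u hu hu'
    rw [h.pertPath_mid hu'.le hu.le]
    simp
  simp only [pathDeriv, Matrix.of_apply]
  rw [e.deriv_eq]
  have := (((hasDerivAt_id t).sub_const (ρ * r)).mul_const (P i j)).const_add (ρ * Φ r i j)
  rw [one_mul] at this
  exact this.deriv

lemma pathDeriv_right (h : IsPerturbation Q x Φ P τ ρ η r c) {s : ℝ} (hs : r < s) (hs' : s < τ) :
    pathDeriv (pertPath Q Φ P τ ρ η r) (ρ * s + η) = pathDeriv Φ s := by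
  ext i j
  have h1 : ρ * r < ρ * s := mul_lt_mul_of_pos_left hs h.ρ_pos
  have h2 : ρ * s < ρ * τ := mul_lt_mul_of_pos_left hs' h.ρ_pos
  have e : (fun t => pertPath Q Φ P τ ρ η r t i j) =ᶠ[𝓝 (ρ * s + η)]
      fun t => ρ * (fun u => Φ u i j) (ρ⁻¹ * (t - η)) + η * P i j := by
    filter_upwards [gt_mem_nhds (show ρ * s + η < ρ * τ + η by linarith),
      lt_mem_nhds (show ρ * r + η < ρ * s + η by linarith)] with t ht ht'
    rw [h.pertPath_right ht'.le ht.le, Matrix.add_apply, Matrix.smul_apply, smul_eq_mul,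
      Matrix.smul_apply, smul_eq_mul, div_eq_inv_mul]
  simp only [pathDeriv, Matrix.of_apply]
  rw [e.deriv_eq]
  exact deriv_rescale_shift (fun u => Φ u i j) h.ρ_pos.ne' s η (η * P i j)

/-- Dilating time and height by the same ρ leaves Φ' unchanged, so the integral of xΦ' picks up a
factor ρ; the constant comes from the value Q - ρΦ(τ) - ηP at the new cutoff. -/
lemma pathHat_right (h : IsPerturbation Q x Φ P τ ρ η r c) {s : ℝ} (hs : s ∈ Icc r τ) :
    pathHat (pertDistr x τ ρ η r c) (pertPath Q Φ P τ ρ η r) (ρ * s + η) =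
      Q + ρ • (pathHat x Φ s - Q) - η • P := by
  have hf := h.isFrame
  have hρs : ρ * s ≤ ρ * τ := mul_le_mul_of_nonneg_left hs.2 h.ρ_pos.le
  have hs0 : 0 ≤ s := h.r_mem.1.trans hs.1
  rw [hf.pathHat_add (by have := mul_nonneg h.ρ_pos.le hs0; linarith [h.η_nonneg])
    (by linarith : ρ * s + η ≤ ρ * τ + η) h.lt.le, hf.pathHat_eq_sub le_rfl h.lt.le, h.pertPath_top,
    ← intervalIntegral.smul_integral_comp_mul_add,
    h.frame.pathHat_add hs0 hs.2 h.frame.lt.le, h.frame.pathHat_eq_sub le_rfl h.frame.lt.le]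
  rw [integral_congr_Ioo (g := fun q => x q • pathDeriv Φ q) hs.2 fun q hq => ?_]
  · simp only [smul_add, smul_sub]; abel
  · have hrq : r < q := hs.1.trans_lt hq.1
    have h1 : ρ * r ≤ ρ * q := mul_le_mul_of_nonneg_left hrq.le h.ρ_pos.le
    have h2 : ρ * q ≤ ρ * τ := mul_le_mul_of_nonneg_left hq.2.le h.ρ_pos.le
    rw [h.pathDeriv_right hrq hq.2, pertDistr_of_ge (by linarith),
      h.pertTime_right (by linarith) (by linarith), add_sub_cancel_right,
      mul_div_cancel_left₀ _ h.ρ_pos.ne']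

/-- The jump is parametrized by ζ in [0, 1] rather than by time, so that its domain does not shrink
with η. -/
lemma pathHat_mid (h : IsPerturbation Q x Φ P τ ρ η r c) {ζ : ℝ} (hζ : ζ ∈ Icc (0 : ℝ) 1) :
    pathHat (pertDistr x τ ρ η r c) (pertPath Q Φ P τ ρ η r) (η * ζ + ρ * r) =
      Q + ρ • (pathHat x Φ r - Q) - η • P + (c * (η * (1 - ζ))) • P := by
  have hf := h.isFrame
  have h1 : 0 ≤ η * ζ := mul_nonneg h.η_nonneg hζ.1
  have h2 : η * ζ ≤ η := mul_le_of_le_one_right h.η_nonneg hζ.2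
  rw [hf.pathHat_add (by linarith [h.mul_r_nonneg]) (by linarith : η * ζ + ρ * r ≤ ρ * r + η)
    (by linarith [h.lt, h.mul_le_mul_top]), h.pathHat_right ⟨le_rfl, h.r_mem.2⟩,
    integral_congr_Ioo (g := fun _ => c • P) (by linarith) fun q hq => ?_]
  · rw [intervalIntegral.integral_const, smul_smul, add_comm]
    congr 2
    ring
  · rw [pertDistr_mid (by linarith [hq.1]) hq.2, h.pathDeriv_mid (by linarith [hq.1]) hq.2]

lemma pathHat_left (h : IsPerturbation Q x Φ P τ ρ η r c) {s : ℝ} (hs : s ∈ Icc 0 r) :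
    pathHat (pertDistr x τ ρ η r c) (pertPath Q Φ P τ ρ η r) (ρ * s) =
      Q + ρ • (pathHat x Φ s - Q) - ((1 - c) * η) • P := by
  have hf := h.isFrame
  have hρs : ρ * s ≤ ρ * r := mul_le_mul_of_nonneg_left hs.2 h.ρ_pos.le
  have hrm : r ≤ m := (h.frame.Icc_subset h.r_mem).2
  have hmid := h.pathHat_mid (ζ := 0) (by simp)
  rw [mul_zero, zero_add] at hmid
  have hint : ∫ q in (ρ * s)..(ρ * r), pertDistr x τ ρ η r c q •
      pathDeriv (pertPath Q Φ P τ ρ η r) q = ρ • ∫ q in s..r, x q • pathDeriv Φ q := by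
    have e := intervalIntegral.smul_integral_comp_mul_add (a := s) (b := r)
      (fun q => pertDistr x τ ρ η r c q • pathDeriv (pertPath Q Φ P τ ρ η r) q) ρ 0
    simp only [add_zero] at e
    rw [← e, integral_congr_Ioo (g := fun q => x q • pathDeriv Φ q) hs.2 fun q hq => ?_]
    rw [h.pathDeriv_left hq.2, h.pertDistr_left (mul_lt_mul_of_pos_left hq.2 h.ρ_pos),
      mul_div_cancel_left₀ _ h.ρ_pos.ne']
  rw [hf.pathHat_add (mul_nonneg h.ρ_pos.le hs.1) hρs
    (by linarith [h.lt, h.mul_le_mul_top, h.η_nonneg]), hmid, hint,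
    h.frame.pathHat_add hs.1 hs.2 hrm]
  simp only [smul_add, smul_sub, sub_mul, sub_smul, one_mul, sub_zero, mul_one]
  abel

/-- Changes of variables bring the three pieces back to intervals independent of ρ and η. The
perturbation is left in the integrands and prefactors only, where it can be differentiated. -/
lemma entropy_eq (h : IsPerturbation Q x Φ P τ ρ η r c) :
    ∫ t in (0 : ℝ)..(ρ * τ + η), frob (pathHat (pertDistr x τ ρ η r c)
        (pertPath Q Φ P τ ρ η r) t)⁻¹ (pathDeriv (pertPath Q Φ P τ ρ η r) t) =
      ρ * (∫ s in (0 : ℝ)..r,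
        frob (Q + ρ • (pathHat x Φ s - Q) - ((1 - c) * η) • P)⁻¹ (pathDeriv Φ s)) +
      η * (∫ ζ in (0 : ℝ)..1,
        frob (Q + ρ • (pathHat x Φ r - Q) - η • P + (c * (η * (1 - ζ))) • P)⁻¹ P) +
      ρ * (∫ s in r..τ, frob (Q + ρ • (pathHat x Φ s - Q) - η • P)⁻¹ (pathDeriv Φ s)) := by
  have hf := h.isFrame
  have hr0 := h.mul_r_nonneg
  have hη := h.η_nonneg
  have hrτ := h.mul_le_mul_top
  rw [← intervalIntegral.integral_add_adjacent_intervals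
      (hf.intervalIntegrable_entropy le_rfl (by linarith : 0 ≤ ρ * r + η) (by linarith))
      (hf.intervalIntegrable_entropy (by linarith) (by linarith : ρ * r + η ≤ ρ * τ + η) le_rfl),
    ← intervalIntegral.integral_add_adjacent_intervals
      (hf.intervalIntegrable_entropy le_rfl hr0 (by linarith))
      (hf.intervalIntegrable_entropy hr0 (by linarith : ρ * r ≤ ρ * r + η) (by linarith))]
  congr 1
  · congr 1
    · have e := intervalIntegral.smul_integral_comp_mul_add (a := 0) (b := r)
        (fun t => frob (pathHat (pertDistr x τ ρ η r c)
        (pertPath Q Φ P τ ρ η r) t)⁻¹ (pathDeriv (pertPath Q Φ P τ ρ η r) t)) ρ 0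
      simp only [add_zero, mul_zero] at e
      rw [← e, smul_eq_mul]
      congr 1
      refine integral_congr_Ioo h.r_mem.1 fun s hs => ?_
      rw [h.pathHat_left ⟨hs.1.le, hs.2.le⟩, h.pathDeriv_left hs.2]
    · have e := intervalIntegral.smul_integral_comp_mul_add (a := 0) (b := 1)
        (fun t => frob (pathHat (pertDistr x τ ρ η r c)
        (pertPath Q Φ P τ ρ η r) t)⁻¹ (pathDeriv (pertPath Q Φ P τ ρ η r) t)) η (ρ * r)
      rw [mul_zero, zero_add, mul_one, add_comm η] at e
      rw [← e, smul_eq_mul]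
      -- Without a jump the middle piece has prefactor 0, and the pointwise identification, which
      -- needs a nonempty jump interval, is not used.
      rcases hη.eq_or_lt with h0 | h0
      · rw [← h0, zero_mul, zero_mul]
      congr 1
      refine integral_congr_Ioo zero_le_one fun ζ hζ => ?_
      have h1 : 0 < η * ζ := mul_pos h0 hζ.1
      have h2 : η * ζ < η := mul_lt_of_lt_one_right h0 hζ.2
      rw [h.pathHat_mid ⟨hζ.1.le, hζ.2.le⟩, h.pathDeriv_mid (by linarith) (by linarith)]
  · rw [← intervalIntegral.smul_integral_comp_mul_add, smul_eq_mul]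
    congr 1
    refine integral_congr_Ioo h.r_mem.2 fun s hs => ?_
    rw [h.pathHat_right ⟨hs.1.le, hs.2.le⟩, h.pathDeriv_right hs.1 hs.2]

variable {β : ℕ → Fin m → ℝ}

/-- The weight is the constant c along the jump, so the energy of that piece is c times the
increment of the primitive `xiTotal`. -/
lemma energy_eq (hβ : ∀ j, Summable fun p : ℕ => (2 : ℝ) ^ p * β p j ^ 2)
    (f : Fin m → ℝ) (hQ : IsOverlapConstraint Q) (h : IsPerturbation Q x Φ P τ ρ η r c) :
    ∫ t in (0 : ℝ)..(ρ * τ + η), pertDistr x τ ρ η r c t *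
      frob (xiPrime β (pertPath Q Φ P τ ρ η r t) + Matrix.vecMulVec f f)
        (pathDeriv (pertPath Q Φ P τ ρ η r) t) =
      (∫ s in (0 : ℝ)..r, x s *
        frob (xiPrime β (ρ • Φ s) + Matrix.vecMulVec f f) (ρ • pathDeriv Φ s)) +
      c * (xiTotal β f (ρ • Φ r + η • P) - xiTotal β f (ρ • Φ r)) +
      ∫ s in r..τ, x s *
        frob (xiPrime β (ρ • Φ s + η • P) + Matrix.vecMulVec f f) (ρ • pathDeriv Φ s) := by
  have hf := h.isFrame
  have hr0 := h.mul_r_nonneg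
  have hη := h.η_nonneg
  have hrτ := h.mul_le_mul_top
  have hlt := h.lt
  rw [← intervalIntegral.integral_add_adjacent_intervals
      (hf.intervalIntegrable_energy hβ f hQ le_rfl (by linarith : 0 ≤ ρ * r + η) (by linarith))
      (hf.intervalIntegrable_energy hβ f hQ (by linarith)
        (by linarith : ρ * r + η ≤ ρ * τ + η) (by linarith)),
    ← intervalIntegral.integral_add_adjacent_intervals
      (hf.intervalIntegrable_energy hβ f hQ le_rfl hr0 (by linarith))
      (hf.intervalIntegrable_energy hβ f hQ hr0 (by linarith : ρ * r ≤ ρ * r + η) (by linarith))]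
  congr 1
  · congr 1
    · have e := intervalIntegral.smul_integral_comp_mul_add (a := 0) (b := r)
        (fun t => pertDistr x τ ρ η r c t *
          frob (xiPrime β (pertPath Q Φ P τ ρ η r t) + Matrix.vecMulVec f f)
          (pathDeriv (pertPath Q Φ P τ ρ η r) t)) ρ 0
      simp only [add_zero, mul_zero] at e
      rw [← e, smul_eq_mul, ← intervalIntegral.integral_const_mul]
      refine integral_congr_Ioo h.r_mem.1 fun s hs => ?_
      have h1 := mul_lt_mul_of_pos_left hs.2 h.ρ_pos
      rw [h.pathDeriv_left hs.2, h.pertDistr_left h1, h.pertPath_left h1.le,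
        mul_div_cancel_left₀ _ h.ρ_pos.ne', frob_smul_right]
      ring
    · rw [integral_congr_Ioo (g := fun t => c *
          frob (xiPrime β (pertPath Q Φ P τ ρ η r t) + Matrix.vecMulVec f f)
          (pathDeriv (pertPath Q Φ P τ ρ η r) t)) (by linarith) fun t ht => by
            rw [pertDistr_mid ht.1.le ht.2],
        intervalIntegral.integral_const_mul,
        ((hf.lipDerivOn_xiTotal hβ f hQ).mono hr0 (by linarith)).integral_eq_sub (by linarith),
        h.pertPath_mid (by linarith) le_rfl, h.pertPath_mid le_rfl (by linarith)]
      simp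
  · rw [← intervalIntegral.smul_integral_comp_mul_add, smul_eq_mul,
      ← intervalIntegral.integral_const_mul]
    refine integral_congr_Ioo h.r_mem.2 fun s hs => ?_
    have h1 : ρ * r < ρ * s := mul_lt_mul_of_pos_left hs.1 h.ρ_pos
    have h2 : ρ * s < ρ * τ := mul_lt_mul_of_pos_left hs.2 h.ρ_pos
    rw [h.pathDeriv_right hs.1 hs.2, pertDistr_of_ge (by linarith),
      h.pertTime_right (by linarith) (by linarith), h.pertPath_right (by linarith) (by linarith),
      add_sub_cancel_right, mul_div_cancel_left₀ _ h.ρ_pos.ne', frob_smul_right]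
    ring

end IsPerturbation

end Perturbation

/-! ### Integration against the Parisi measure -/

section ParisiMeasure

/-- The mass that `μ` gives to `[0, r)`. -/
def leftMass (μ : Measure ℝ) (r : ℝ) : ℝ := μ.real (Ico 0 r)

variable {x : ℝ → ℝ} {μ : Measure ℝ}

lemma IsParisiMeasure.isProbabilityMeasure (hμ : IsParisiMeasure m x μ)
    (hx : IsDistributionPath m x) : IsProbabilityMeasure μ := by
  refine ⟨?_⟩
  rw [← measure_add_measure_compl (measurableSet_Icc : MeasurableSet (Icc (0 : ℝ) m)), hμ.1,
    hμ.2 m (right_mem_Icc.2 (Nat.cast_nonneg m)), hx.right_end]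
  simp

lemma IsParisiMeasure.real_Icc_zero (hμ : IsParisiMeasure m x μ) (hx : IsDistributionPath m x)
    {t : ℝ} (ht : t ∈ Icc (0 : ℝ) m) : μ.real (Icc 0 t) = x t := by
  rw [Measure.real, hμ.2 t ht, ENNReal.toReal_ofReal (hx.mem t ht).1]

/-- The closed interval includes a possible atom at r, which is why the left mass appears in place
of x(r). -/
lemma IsParisiMeasure.real_Icc (hμ : IsParisiMeasure m x μ) (hx : IsDistributionPath m x)
    {r q : ℝ} (hr : 0 ≤ r) (hrq : r ≤ q) (hq : q ≤ m) :
    μ.real (Icc r q) = x q - leftMass μ r := by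
  have := hμ.isProbabilityMeasure hx
  rw [← hμ.real_Icc_zero hx ⟨hr.trans hrq, hq⟩, ← Ico_union_Icc_eq_Icc hr hrq,
    measureReal_union (Set.disjoint_left.2 fun s h1 h2 => absurd h1.2 (not_lt.2 h2.1))
      measurableSet_Icc, leftMass]
  ring

lemma leftMass_nonneg (r : ℝ) : 0 ≤ leftMass μ r := measureReal_nonneg

lemma leftMass_zero : leftMass μ 0 = 0 := by simp [leftMass]

lemma IsParisiMeasure.leftMass_le (hμ : IsParisiMeasure m x μ) (hx : IsDistributionPath m x)
    {r : ℝ} (hr : r ∈ Icc (0 : ℝ) m) : leftMass μ r ≤ x r := by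
  have h := hμ.real_Icc hx hr.1 le_rfl hr.2
  have := measureReal_nonneg (μ := μ) (s := Icc r r)
  linarith

lemma IsParisiMeasure.le_leftMass (hμ : IsParisiMeasure m x μ) (hx : IsDistributionPath m x)
    {r s : ℝ} (hr : r ≤ m) (hs : s ∈ Ico 0 r) : x s ≤ leftMass μ r := by
  have := hμ.isProbabilityMeasure hx
  rw [← hμ.real_Icc_zero hx ⟨hs.1, hs.2.le.trans hr⟩]
  exact measureReal_mono fun q hq => ⟨hq.1, hq.2.trans_lt hs.2⟩

section IBP

variable {R : Type*} [NormedRing R] [NormedAlgebra ℝ R] [CompleteSpace R]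

/-- Integration by parts against the Parisi measure. -/
lemma IsParisiMeasure.setIntegral_eq (hμ : IsParisiMeasure m x μ) (hx : IsDistributionPath m x)
    {τ r : ℝ} (hτ : τ ≤ m) (h1 : x τ = 1) (hr : r ∈ Icc 0 τ) {f f' : ℝ → R}
    (hf : LipDerivOn f f' r τ) :
    ∫ t in Icc r τ, f t ∂μ = f τ - leftMass μ r • f r - ∫ t in r..τ, x t • f' t := by
  have hprob := hμ.isProbabilityMeasure hx
  have hint := hf.intervalIntegrable hr.2
  have hint' : IntervalIntegrable (fun t => leftMass μ r • f' t) volume r τ :=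
    (hint.smul (leftMass μ r) :)
  have hintO : Integrable f' (volume.restrict (Ioc r τ)) :=
    (intervalIntegrable_iff_integrableOn_Ioc_of_le hr.2).1 hint
  have hK : MeasurableSet {z : ℝ × ℝ | z.1 ≤ z.2} := measurableSet_le measurable_fst measurable_snd
  -- Fubini over s ≤ q for f': integrating f' over q first gives f(τ) - f(s), integrating over s
  -- first gives the mass μ([r, q]).
  have key := integral_mul_setIntegral_swap (ν₁ := μ.restrict (Icc r τ))
    (ν₂ := volume.restrict (Ioc r τ)) (f := fun _ => (1 : R)) (integrable_const 1) hintO hK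
  simp only [one_mul, mem_ofPred_eq] at key
  have hL : ∀ s ∈ Icc r τ, ∫ q in {q | s ≤ q}, f' q ∂(volume.restrict (Ioc r τ)) =
      f τ - f s := fun s hs => by
    rw [← (hf.mono hs.1 le_rfl).integral_eq_sub hs.2, intervalIntegral.integral_of_le hs.2,
      Measure.restrict_restrict (show MeasurableSet {q | _ ≤ q} from measurableSet_Ici)]
    rcases hs.1.eq_or_lt with h | h
    · congr 2
      ext q
      exact ⟨fun hq => h ▸ hq.2, fun hq => ⟨hq.1.le, h ▸ hq⟩⟩
    · rw [← integral_Icc_eq_integral_Ioc]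
      congr 2
      ext q
      exact ⟨fun hq => ⟨hq.1, hq.2.2⟩, fun hq => ⟨hq.1, h.trans_le hq.1, hq.2⟩⟩
  have hR : ∀ q ∈ Ioc r τ, (∫ _s in {s | s ≤ q}, (1 : R) ∂(μ.restrict (Icc r τ))) * f' q =
      x q • f' q - leftMass μ r • f' q := fun q hq => by
    rw [setIntegral_const, Measure.real,
      Measure.restrict_apply (show MeasurableSet {q | q ≤ _} from measurableSet_Iic)]
    have e : {s | s ≤ q} ∩ Icc r τ = Icc r q := by
      ext s
      exact ⟨fun h => ⟨h.2.1, h.1⟩, fun h => ⟨h.2, h.1, h.2.trans hq.2⟩⟩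
    have e2 : (μ (Icc r q)).toReal = x q - leftMass μ r :=
      hμ.real_Icc hx hr.1 hq.1.le (hq.2.trans hτ)
    rw [e, e2, smul_mul_assoc, one_mul, sub_smul]
  rw [setIntegral_congr_fun measurableSet_Icc hL, setIntegral_congr_fun measurableSet_Ioc hR,
    ← intervalIntegral.integral_of_le hr.2,
    intervalIntegral.integral_sub (hx.intervalIntegrable_smul hr.1 hτ hr.2 hint)
      hint', intervalIntegral.integral_smul, hf.integral_eq_sub hr.2,
    integral_sub (integrable_const _) (hf.continuousOn.integrableOn_compact isCompact_Icc),
    setIntegral_const, hμ.real_Icc hx hr.1 hr.2 hτ, h1, sub_smul, one_smul] at key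
  rw [smul_sub] at key
  rw [← sub_eq_zero] at key ⊢
  rw [← neg_eq_zero, ← key]
  abel

/-- Fubini's theorem for a primitive multiplied on the left. -/
lemma setIntegral_primitive_mul [IsFiniteMeasure μ] {r τ : ℝ} (hr : r ≤ τ) {S : Set ℝ}
    (hS : MeasurableSet S) (hSr : S ⊆ Icc r τ) {a b : ℝ → R}
    (ha : IntervalIntegrable a volume r τ) (hb : IntegrableOn b S μ) :
    ∫ s in S, (∫ q in r..s, a q) * b s ∂μ = ∫ q in r..τ, a q * ∫ s in S ∩ Ici q, b s ∂μ := by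
  have hK : MeasurableSet {z : ℝ × ℝ | z.1 ≤ z.2} := measurableSet_le measurable_fst measurable_snd
  have key := integral_mul_setIntegral_swap (ν₁ := volume.restrict (Ioc r τ))
    (ν₂ := μ.restrict S) ((intervalIntegrable_iff_integrableOn_Ioc_of_le hr).1 ha) hb hK
  simp only [mem_ofPred_eq] at key
  rw [intervalIntegral.integral_of_le hr]
  have e1 : ∀ q, ∫ s in {s | q ≤ s}, b s ∂(μ.restrict S) = ∫ s in S ∩ Ici q, b s ∂μ := fun q => by
    rw [Measure.restrict_restrict (show MeasurableSet {q | _ ≤ q} from measurableSet_Ici),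
      inter_comm]
    rfl
  simp only [e1] at key
  rw [key]
  refine setIntegral_congr_fun hS fun s hs => ?_
  have hs' := hSr hs
  rw [intervalIntegral.integral_of_le hs'.1,
    Measure.restrict_restrict (show MeasurableSet {q | q ≤ _} from measurableSet_Iic)]
  congr 3
  ext q
  exact ⟨fun h => ⟨h.2, h.1, h.2.trans hs'.2⟩, fun h => ⟨h.2.1, h.1⟩⟩

/-- Fubini's theorem for a primitive multiplied on the right. -/
lemma setIntegral_mul_primitive [IsFiniteMeasure μ] {r τ : ℝ} (hr : r ≤ τ) {S : Set ℝ}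
    (hS : MeasurableSet S) (hSr : S ⊆ Icc r τ) {a b : ℝ → R}
    (ha : IntervalIntegrable a volume r τ) (hb : IntegrableOn b S μ) :
    ∫ s in S, b s * (∫ q in r..s, a q) ∂μ = ∫ q in r..τ, (∫ s in S ∩ Ici q, b s ∂μ) * a q := by
  have hK : MeasurableSet {z : ℝ × ℝ | z.2 ≤ z.1} := measurableSet_le measurable_snd measurable_fst
  have key := integral_mul_setIntegral_swap (ν₁ := μ.restrict S)
    (ν₂ := volume.restrict (Ioc r τ)) hb
    ((intervalIntegrable_iff_integrableOn_Ioc_of_le hr).1 ha) hK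
  simp only [mem_ofPred_eq] at key
  rw [intervalIntegral.integral_of_le hr]
  have e1 : ∀ q, ∫ s in {s | q ≤ s}, b s ∂(μ.restrict S) = ∫ s in S ∩ Ici q, b s ∂μ := fun q => by
    rw [Measure.restrict_restrict (show MeasurableSet {q | _ ≤ q} from measurableSet_Ici),
      inter_comm]
    rfl
  simp only [e1] at key
  rw [← key]
  refine setIntegral_congr_fun hS fun s hs => ?_
  have hs' := hSr hs
  rw [intervalIntegral.integral_of_le hs'.1,
    Measure.restrict_restrict (show MeasurableSet {q | q ≤ _} from measurableSet_Iic)]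
  congr 3
  ext q
  exact ⟨fun h => ⟨h.2, h.1, h.2.trans hs'.2⟩, fun h => ⟨h.2.1, h.1⟩⟩

end IBP

end ParisiMeasure

/-! ### First variation of the functional -/

section FirstOrder

variable {Q : Matrix (Fin m) (Fin m) ℝ} {x : ℝ → ℝ} {Φ : ℝ → Matrix (Fin m) (Fin m) ℝ}
  {P : Matrix (Fin m) (Fin m) ℝ} {τ ρ η r : ℝ} {β : ℕ → Fin m → ℝ} {μ : Measure ℝ}

/-- Integration by parts on `[0, r)` against the Parisi measure. -/
lemma IsParisiMeasure.setIntegral_Ico_eq {R : Type*} [NormedRing R] [NormedAlgebra ℝ R]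
    [CompleteSpace R] (hμ : IsParisiMeasure m x μ) (hx : IsDistributionPath m x)
    (hτ : τ ≤ m) (h1 : x τ = 1) (hr : r ∈ Icc 0 τ) {f f' : ℝ → R} (hf : LipDerivOn f f' 0 τ) :
    ∫ t in Ico 0 r, f t ∂μ = leftMass μ r • f r - ∫ t in (0 : ℝ)..r, x t • f' t := by
  have hprob := hμ.isProbabilityMeasure hx
  have hi : IntegrableOn f (Icc 0 τ) μ := hf.continuousOn.integrableOn_compact isCompact_Icc
  have e1 := hμ.setIntegral_eq hx hτ h1 ⟨le_rfl, hr.1.trans hr.2⟩ hf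
  have e2 := hμ.setIntegral_eq hx hτ h1 hr (hf.mono hr.1 le_rfl)
  have hint := hf.intervalIntegrable (hr.1.trans hr.2)
  rw [← Ico_union_Icc_eq_Icc hr.1 hr.2, setIntegral_union
    (Set.disjoint_left.2 fun s h1 h2 => absurd h1.2 (not_lt.2 h2.1)) measurableSet_Icc
    (hi.mono_set fun s hs => ⟨hs.1, hs.2.le.trans hr.2⟩) (hi.mono_set (Icc_subset_Icc_left hr.1)),
    e2, leftMass_zero, zero_smul, ← intervalIntegral.integral_add_adjacent_intervals
      (hx.intervalIntegrable_smul le_rfl (hr.2.trans hτ) hr.1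
        ((hf.mono le_rfl hr.2).intervalIntegrable hr.1))
      (hx.intervalIntegrable_smul hr.1 hτ hr.2 ((hf.mono hr.1 le_rfl).intervalIntegrable hr.2))]
    at e1
  rw [eq_sub_of_add_eq e1]
  abel

/-- The value of the functional at the perturbed pair. -/
lemma IsPerturbation.two_mul_crisantiSommers
    (hβ : ∀ j, Summable fun p : ℕ => (2 : ℝ) ^ p * β p j ^ 2) (f : Fin m → ℝ)
    (hQ : IsOverlapConstraint Q) (hμ : IsParisiMeasure m x μ)
    (h : IsPerturbation Q x Φ P τ ρ η r (leftMass μ r)) :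
    2 * crisantiSommers β f (pertDistr x τ ρ η r (leftMass μ r)) (pertPath Q Φ P τ ρ η r)
        (ρ * τ + η) =
      xiTotal β f Q - (∫ t in Ico 0 r, xiTotal β f (ρ • Φ t) ∂μ)
      - (∫ t in Icc r τ, xiTotal β f (ρ • Φ t + η • P) ∂μ)
      + Real.log (Q - (ρ • Φ τ + η • P)).det
      + (ρ * (∫ s in (0 : ℝ)..r,
        frob (Q + ρ • (pathHat x Φ s - Q) - ((1 - leftMass μ r) * η) • P)⁻¹ (pathDeriv Φ s)) +
      η * (∫ ζ in (0 : ℝ)..1, frob (Q + ρ • (pathHat x Φ r - Q) - η • P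
        + (leftMass μ r * (η * (1 - ζ))) • P)⁻¹ P) +
      ρ * (∫ s in r..τ, frob (Q + ρ • (pathHat x Φ s - Q) - η • P)⁻¹ (pathDeriv Φ s))) := by
  have hf := h.frame
  have hx := hf.distr
  have hpsd : ∀ s ∈ Icc 0 τ, (ρ • Φ s).PosSemidef ∧ (Q - (ρ • Φ s + η • P)).PosSemidef ∧
      (η • P).PosSemidef := fun s hs => by
    refine ⟨(hf.path.posSemidef s (hf.Icc_subset hs)).smul h.ρ_pos.le, ?_,
      h.posSemidef.smul h.η_nonneg⟩
    have e : Q - (ρ • Φ s + η • P) = (Q - (ρ • Φ τ + η • P)) + ρ • (Φ τ - Φ s) := by module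
    rw [e]
    exact h.posDef.posSemidef.add ((hf.path.mono s (hf.Icc_subset hs) τ hf.mem_Icc hs.2).smul
      h.ρ_pos.le)
  have b1 : ∀ s ∈ Icc 0 τ, ∀ i j, |(ρ • Φ s) i j| ≤ 1 := fun s hs =>
    abs_entry_le_one (hpsd s hs).1 (by
      have e : Q - ρ • Φ s = (Q - (ρ • Φ s + η • P)) + η • P := by module
      rw [e]
      exact (hpsd s hs).2.1.add (hpsd s hs).2.2) hQ.diag
  have b2 : ∀ s ∈ Icc 0 τ, ∀ i j, |(ρ • Φ s + η • P) i j| ≤ 1 := fun s hs =>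
    abs_entry_le_one ((hpsd s hs).1.add (hpsd s hs).2.2) (hpsd s hs).2.1 hQ.diag
  have hΦ : LipDerivOn (fun t => ρ • Φ t) (fun t => ρ • pathDeriv Φ t) 0 τ :=
    (hf.path.lipDerivOn.mono le_rfl hf.lt.le).clm
      (ρ • ContinuousLinearMap.id ℝ (Matrix (Fin m) (Fin m) ℝ))
  have hΦ2 : LipDerivOn (fun t => ρ • Φ t + η • P) (fun t => ρ • pathDeriv Φ t) 0 τ :=
    (hΦ.add (LipDerivOn.const (η • P) 0 τ)).congr_deriv (by simp)
  -- Integration by parts leaves boundary terms at r weighted by the left mass. They cancel the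
  -- energy of the jump exactly because the jump carries c = μ([0, r)); all the mass of [r, τ], an
  -- atom at r included, is then moved by ηP.
  have e1 := hμ.setIntegral_Ico_eq hx hf.lt.le hf.eq_one h.r_mem (hΦ.xiTotal hβ f b1)
  have e2 := hμ.setIntegral_eq hx hf.lt.le hf.eq_one h.r_mem
    ((hΦ2.mono h.r_mem.1 le_rfl).xiTotal hβ f fun s hs => b2 s ⟨h.r_mem.1.trans hs.1, hs.2⟩)
  simp only [smul_eq_mul] at e1 e2
  rw [h.isFrame.two_mul_crisantiSommers hβ f hQ, h.energy_eq hβ f hQ, h.entropy_eq, h.pertPath_top,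
    e1, e2]
  ring

lemma nonneg_of_hasDerivAt {W : ℝ → ℝ} {L : ℝ} (h : HasDerivAt W L 0)
    (hW : ∀ᶠ ε in 𝓝[>] (0 : ℝ), W 0 ≤ W ε) : 0 ≤ L := by
  refine ge_of_tendsto h.tendsto_slope_zero_right ?_
  filter_upwards [hW, self_mem_nhdsWithin] with ε h1 h2
  rw [zero_add, smul_eq_mul]
  exact mul_nonneg (inv_nonneg.2 (le_of_lt h2)) (sub_nonneg.2 h1)

/-- The first variation of the functional at a minimizer. -/
lemma IsMinimizer.firstVariation_nonneg
    (hβ : ∀ j, Summable fun p : ℕ => (2 : ℝ) ^ p * β p j ^ 2) {f : Fin m → ℝ}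
    (hQ : IsOverlapConstraint Q) (hmin : IsMinimizer β f Q x Φ) (hμ : IsParisiMeasure m x μ)
    (hτ : IsCutoff Q x Φ τ) (hr : r ∈ Icc 0 τ) (hP : P.PosSemidef) (htr : P.trace = 1)
    {a b : ℝ} (hb : 0 ≤ b) :
    0 ≤ -(∫ t in Ico 0 r, frob (xiPrime β (Φ t) + Matrix.vecMulVec f f) (-(a • Φ t)) ∂μ)
      - (∫ t in Icc r τ, frob (xiPrime β (Φ t) + Matrix.vecMulVec f f) (b • P - a • Φ t) ∂μ)
      + ((Q - Φ τ)⁻¹ * (a • Φ τ - b • P)).trace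
      + (-a * (∫ t in (0 : ℝ)..r, frob (pathHat x Φ t)⁻¹ (pathDeriv Φ t))
        - ∫ t in (0 : ℝ)..r, frob ((pathHat x Φ t)⁻¹ *
          (a • (Q - pathHat x Φ t) - ((1 - leftMass μ r) * b) • P) * (pathHat x Φ t)⁻¹)
          (pathDeriv Φ t))
      + b * frob (pathHat x Φ r)⁻¹ P
      + (-a * (∫ t in r..τ, frob (pathHat x Φ t)⁻¹ (pathDeriv Φ t))
        - ∫ t in r..τ, frob ((pathHat x Φ t)⁻¹ * (a • (Q - pathHat x Φ t) - b • P) *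
          (pathHat x Φ t)⁻¹) (pathDeriv Φ t)) := by
  have hf := hmin.1.isFrame hτ
  have hprob := hμ.isProbabilityMeasure hf.distr
  set c := leftMass μ r with hc
  have hΦc : ContinuousOn Φ (Icc 0 τ) := hf.continuousOn_path.mono hf.Icc_subset
  have hDc : ContinuousOn (pathHat x Φ) (Icc 0 τ) := hf.continuousOn_pathHat.mono hf.Icc_subset
  have hΦ1 : ∀ t ∈ Icc 0 τ, ∀ i j, |Φ t i j| ≤ 1 := fun t ht =>
    hf.path.abs_entry_le_one hQ (hf.Icc_subset ht)
  have s1 : Icc 0 r ⊆ Icc 0 τ := Icc_subset_Icc_right hr.2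
  have s2 : Icc r τ ⊆ Icc 0 τ := Icc_subset_Icc_left hr.1
  have d1 := hasDerivAt_integral_xiTotal hβ f (μ := μ) (s := Ico 0 r)
    (fun t ht => ⟨ht.1, ht.2.le.trans hr.2⟩) hΦc (V := fun t => -(a • Φ t))
    (hΦc.const_smul a).neg hΦ1
  have d2 := hasDerivAt_integral_xiTotal hβ f (μ := μ) s2 hΦc (V := fun t => b • P - a • Φ t)
    (continuousOn_const.sub (hΦc.const_smul a)) hΦ1
  have d3 := hasDerivAt_log_det (M := a • Φ τ - b • P)
    ((Matrix.isUnit_iff_isUnit_det _).1 hf.posDef.isUnit)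
  have d4 := hasDerivAt_integral_frob_inv hr.1 (hDc.mono s1)
    (M := fun t => a • (Q - pathHat x Φ t) - ((1 - c) * b) • P)
    (((continuousOn_const.sub (hDc.mono s1)).const_smul a).sub continuousOn_const)
    (fun t ht => hf.isUnit_pathHat (s1 ht))
    (hf.intervalIntegrable_deriv le_rfl hr.1 (hr.2.trans hf.lt.le))
  -- This integral is multiplied by η = bε, which vanishes at ε = 0, so only its value at 0 survives
  -- in the derivative of the product.
  have d5 := hasDerivAt_integral_frob_inv (zero_le_one' ℝ) (D := fun _ => pathHat x Φ r)
    (M := fun ζ => a • (Q - pathHat x Φ r) - b • P + (c * (b * (1 - ζ))) • P)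
    (Z := fun _ => P) continuousOn_const (by fun_prop) (fun _ _ => hf.isUnit_pathHat hr)
    intervalIntegrable_const
  have d6 := hasDerivAt_integral_frob_inv hr.2 (hDc.mono s2)
    (M := fun t => a • (Q - pathHat x Φ t) - b • P)
    (((continuousOn_const.sub (hDc.mono s2)).const_smul a).sub continuousOn_const)
    (fun t ht => hf.isUnit_pathHat (s2 ht))
    (hf.intervalIntegrable_deriv hr.1 hr.2 hf.lt.le)
  have dρ : HasDerivAt (fun ε : ℝ => 1 - a * ε) (-a) 0 := by
    simpa using ((hasDerivAt_id (0 : ℝ)).const_mul a).const_sub 1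
  have dη : HasDerivAt (fun ε : ℝ => b * ε) b 0 := by
    simpa using (hasDerivAt_id (0 : ℝ)).const_mul b
  have dW := ((d1.neg.sub d2).add d3).add (((dρ.mul d4).add (dη.mul d5)).add (dρ.mul d6))
  have hL := nonneg_of_hasDerivAt dW ?_
  · simp only [zero_smul, add_zero, mul_zero, sub_zero, one_mul, zero_mul,
      intervalIntegral.integral_const, smul_eq_mul] at hL
    convert hL using 1
    ring
  -- Positivity of ε keeps η = bε nonnegative; the other conditions keep the scale positive, the new
  -- cutoff below m and the final segment increasing.
  have hsmall : ∀ᶠ ε in 𝓝[>] (0 : ℝ), 0 < ε ∧ 0 < 1 - a * ε ∧ (1 - a * ε) * τ + b * ε < m ∧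
      ((Q - Φ τ) + ε • (a • Φ τ - b • P)).PosDef := by
    have hS : (a • Φ τ - b • P).transpose = a • Φ τ - b • P := by
      rw [Matrix.transpose_sub, Matrix.transpose_smul, Matrix.transpose_smul,
        transpose_eq_of_posSemidef hP, transpose_eq_of_posSemidef (hf.path.posSemidef τ hf.mem_Icc)]
    have g1 : ∀ᶠ ε in 𝓝 (0 : ℝ), 0 < 1 - a * ε :=
      (by fun_prop : Continuous fun ε : ℝ => 1 - a * ε).continuousAt.eventually
        (lt_mem_nhds (by simp))
    have g2 : ∀ᶠ ε in 𝓝 (0 : ℝ), (1 - a * ε) * τ + b * ε < m :=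
      (by fun_prop : Continuous fun ε : ℝ => (1 - a * ε) * τ + b * ε).continuousAt.eventually
        (gt_mem_nhds (by simpa using hf.lt))
    filter_upwards [self_mem_nhdsWithin, mem_nhdsWithin_of_mem_nhds g1,
      mem_nhdsWithin_of_mem_nhds g2,
      mem_nhdsWithin_of_mem_nhds (eventually_posDef_add_smul hf.posDef hS)] with ε h1 h2 h3 h4
    exact ⟨h1, h2, h3, h4⟩
  have hLip := (hf.lipDerivOn_xiTotal hβ f hQ).mono le_rfl hf.lt.le
  have e1 := hμ.setIntegral_Ico_eq hf.distr hf.lt.le hf.eq_one hr hLip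
  have e2 := hμ.setIntegral_eq hf.distr hf.lt.le hf.eq_one hr (hLip.mono hr.1 le_rfl)
  have h0 := hf.two_mul_crisantiSommers hβ f hQ
  rw [← intervalIntegral.integral_add_adjacent_intervals
      (hf.intervalIntegrable_energy hβ f hQ le_rfl hr.1 (hr.2.trans hf.lt.le))
      (hf.intervalIntegrable_energy hβ f hQ hr.1 hr.2 hf.lt.le),
    ← intervalIntegral.integral_add_adjacent_intervals
      (hf.intervalIntegrable_entropy le_rfl hr.1 hr.2)
      (hf.intervalIntegrable_entropy hr.1 hr.2 le_rfl)] at h0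
  simp only [smul_eq_mul] at e1 e2
  filter_upwards [hsmall] with ε hε
  have E2 : ∀ A : Matrix (Fin m) (Fin m) ℝ,
      (1 - a * ε) • A + (b * ε) • P = A + ε • (b • P - a • A) := fun A => by module
  have E1 : ∀ A : Matrix (Fin m) (Fin m) ℝ, (1 - a * ε) • A = A + ε • -(a • A) :=
    fun A => by module
  have E3 : Q - (Φ τ + ε • (b • P - a • Φ τ)) = Q - Φ τ + ε • (a • Φ τ - b • P) := by module
  have E4 : ∀ A : Matrix (Fin m) (Fin m) ℝ, Q + (1 - a * ε) • (A - Q) - ((1 - c) * (b * ε)) • P =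
      A + ε • (a • (Q - A) - ((1 - c) * b) • P) := fun A => by module
  have E5 : ∀ ζ : ℝ, Q + (1 - a * ε) • (pathHat x Φ r - Q) - (b * ε) • P +
      (c * (b * ε * (1 - ζ))) • P = pathHat x Φ r +
      ε • (a • (Q - pathHat x Φ r) - b • P + (c * (b * (1 - ζ))) • P) := fun ζ => by module
  have E6 : ∀ A : Matrix (Fin m) (Fin m) ℝ, Q + (1 - a * ε) • (A - Q) - (b * ε) • P =
      A + ε • (a • (Q - A) - b • P) := fun A => by module
  have hrm := hf.Icc_subset hr
  have hpert : IsPerturbation Q x Φ P τ (1 - a * ε) (b * ε) r c :=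
    ⟨hf, hQ.trace, hP, htr, hε.2.1, mul_nonneg hb hε.1.le, hr, leftMass_nonneg r,
      fun s hs => hμ.le_leftMass hf.distr hrm.2 hs, hμ.leftMass_le hf.distr hrm, hε.2.2.1,
      by rw [E2, E3]; exact hε.2.2.2⟩
  have hval := hpert.two_mul_crisantiSommers hβ f hQ hμ
  have hle : crisantiSommers β f x Φ τ ≤ crisantiSommers β f (pertDistr x τ (1 - a * ε) (b * ε) r c)
      (pertPath Q Φ P τ (1 - a * ε) (b * ε) r) ((1 - a * ε) * τ + b * ε) := by
    -- A point where x is already 1 before τ is carried to one where the new distribution is 1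
    -- before the new cutoff; its image is shifted by η when it is not before the jump.
    obtain ⟨s, hs, h1, hsτ⟩ := exists_eq_one_of_topTime_lt hf.distr hτ.1
    have hlt : (1 - a * ε) * s < (1 - a * ε) * τ := mul_lt_mul_of_pos_left hsτ hε.2.1
    have hs0 : 0 ≤ (1 - a * ε) * s := mul_nonneg hε.2.1.le hs.1
    have hη := hpert.η_nonneg
    rcases lt_or_ge s r with hsr | hsr
    · refine hmin.le_of_isFrame hβ hQ hτ hpert.isFrame (s := (1 - a * ε) * s)
        ⟨hs0, by linarith [hε.2.2.1]⟩ ?_ (by linarith)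
      rw [hpert.pertDistr_left (mul_lt_mul_of_pos_left hsr hε.2.1),
        mul_div_cancel_left₀ _ hε.2.1.ne', h1]
    · have hrs : (1 - a * ε) * r ≤ (1 - a * ε) * s := mul_le_mul_of_nonneg_left hsr hε.2.1.le
      refine hmin.le_of_isFrame hβ hQ hτ hpert.isFrame (s := (1 - a * ε) * s + b * ε)
        ⟨by linarith, by linarith [hε.2.2.1]⟩ ?_ (by linarith)
      rw [IsPerturbation.pertDistr_of_ge (by linarith),
        hpert.pertTime_right (by linarith) (by linarith), add_sub_cancel_right,
        mul_div_cancel_left₀ _ hε.2.1.ne', h1]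
  rw [← hc] at hval
  simp_rw [E2, E3, E4, E5, E6, E1] at hval
  simp only [Pi.add_apply, Pi.sub_apply, Pi.neg_apply, Pi.mul_apply, zero_smul, add_zero, mul_zero,
    sub_zero, one_mul, zero_mul]
  linarith

end FirstOrder

/-! ### Integrability of the iterated integrals -/

section FubiniIntegrable

variable {R : Type*} [NormedRing R] [NormedAlgebra ℝ R] [CompleteSpace R]

lemma integrable_mul_setIntegral {ν₁ ν₂ : Measure ℝ} [SFinite ν₁] [SFinite ν₂] {f g : ℝ → R}
    (hf : Integrable f ν₁) (hg : Integrable g ν₂) {K : Set (ℝ × ℝ)} (hK : MeasurableSet K) :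
    Integrable (fun s => f s * ∫ q in {q | (s, q) ∈ K}, g q ∂ν₂) ν₁ := by
  refine ((hf.mul_prod hg).indicator hK).integral_prod_left.congr (Eventually.of_forall fun s => ?_)
  have h1 : MeasurableSet {q | (s, q) ∈ K} := measurable_prodMk_left hK
  beta_reduce
  rw [← integral_const_mul_ring _ hg.integrableOn, ← integral_indicator h1]
  rfl

lemma integrable_setIntegral_mul {ν₁ ν₂ : Measure ℝ} [SFinite ν₁] [SFinite ν₂] {f g : ℝ → R}
    (hf : Integrable f ν₁) (hg : Integrable g ν₂) {K : Set (ℝ × ℝ)} (hK : MeasurableSet K) :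
    Integrable (fun q => (∫ s in {s | (s, q) ∈ K}, f s ∂ν₁) * g q) ν₂ := by
  refine ((hf.mul_prod hg).indicator hK).integral_prod_right.congr
    (Eventually.of_forall fun q => ?_)
  have h1 : MeasurableSet {s | (s, q) ∈ K} := measurable_prodMk_right hK
  beta_reduce
  rw [← integral_mul_const_ring hf.integrableOn, ← integral_indicator h1]
  rfl

lemma restrict_inter_Ici (μ : Measure ℝ) (S : Set ℝ) (q : ℝ) :
    (μ.restrict S).restrict {s | q ≤ s} = μ.restrict (S ∩ Ici q) := by
  rw [Measure.restrict_restrict (show MeasurableSet {s | q ≤ s} from measurableSet_Ici), inter_comm]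
  rfl

lemma intervalIntegrable_mul_tail {μ : Measure ℝ} [IsFiniteMeasure μ] {r τ : ℝ} (hr : r ≤ τ)
    {S : Set ℝ} {a b : ℝ → R} (ha : IntervalIntegrable a volume r τ) (hb : IntegrableOn b S μ) :
    IntervalIntegrable (fun q => a q * ∫ s in S ∩ Ici q, b s ∂μ) volume r τ := by
  have h := integrable_mul_setIntegral ((intervalIntegrable_iff_integrableOn_Ioc_of_le hr).1 ha) hb
    (K := {z : ℝ × ℝ | z.1 ≤ z.2}) (measurableSet_le measurable_fst measurable_snd)
  simp only [mem_ofPred_eq, restrict_inter_Ici] at h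
  exact (intervalIntegrable_iff_integrableOn_Ioc_of_le hr).2 h

lemma intervalIntegrable_tail_mul {μ : Measure ℝ} [IsFiniteMeasure μ] {r τ : ℝ} (hr : r ≤ τ)
    {S : Set ℝ} {a b : ℝ → R} (ha : IntervalIntegrable a volume r τ) (hb : IntegrableOn b S μ) :
    IntervalIntegrable (fun q => (∫ s in S ∩ Ici q, b s ∂μ) * a q) volume r τ := by
  have h := integrable_setIntegral_mul hb ((intervalIntegrable_iff_integrableOn_Ioc_of_le hr).1 ha)
    (K := {z : ℝ × ℝ | z.2 ≤ z.1}) (measurableSet_le measurable_snd measurable_fst)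
  simp only [mem_ofPred_eq, restrict_inter_Ici] at h
  exact (intervalIntegrable_iff_integrableOn_Ioc_of_le hr).2 h

end FubiniIntegrable

/-! ### The defect of the critical point equation -/

section Defect

variable {Q : Matrix (Fin m) (Fin m) ℝ} {x : ℝ → ℝ} {Φ : ℝ → Matrix (Fin m) (Fin m) ℝ}
  {τ r : ℝ} {β : ℕ → Fin m → ℝ} {μ : Measure ℝ}

/-- The integral `∫_0^t Φ̂⁻¹ Φ' Φ̂⁻¹`. -/
def conjIntegral (x : ℝ → ℝ) (Φ : ℝ → Matrix (Fin m) (Fin m) ℝ) (t : ℝ) :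
    Matrix (Fin m) (Fin m) ℝ :=
  ∫ s in (0 : ℝ)..t, (pathHat x Φ s)⁻¹ * pathDeriv Φ s * (pathHat x Φ s)⁻¹

/-- The difference of the two sides of the critical point equation. -/
def defect (β : ℕ → Fin m → ℝ) (f : Fin m → ℝ) (x : ℝ → ℝ)
    (Φ : ℝ → Matrix (Fin m) (Fin m) ℝ) (t : ℝ) : Matrix (Fin m) (Fin m) ℝ :=
  xiPrime β (Φ t) + Matrix.vecMulVec f f - conjIntegral x Φ t

namespace IsFrame

lemma lipDerivOn_path (hf : IsFrame Q x Φ τ) : LipDerivOn Φ (pathDeriv Φ) 0 τ :=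
  hf.path.lipDerivOn.mono le_rfl hf.lt.le

/-- As Φ̂' = -xΦ', the two signs cancel and the derivative of Φ̂⁻¹ is x times that of
`conjIntegral`. This makes the integral of `conjIntegral` against μ explicit. -/
lemma lipDerivOn_pathHat_inv (hf : IsFrame Q x Φ τ) :
    LipDerivOn (fun t => (pathHat x Φ t)⁻¹)
      (fun t => x t • ((pathHat x Φ t)⁻¹ * pathDeriv Φ t * (pathHat x Φ t)⁻¹)) 0 τ :=
  ((hf.lipDerivOn_pathHat.mono le_rfl hf.lt.le).matrix_inv fun _ ht =>
    hf.isUnit_pathHat ht).congr_deriv (Eventually.of_forall fun t _ => by simp)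

lemma intervalIntegrable_conj (hf : IsFrame Q x Φ τ) {t : ℝ} (ht : t ∈ Icc 0 τ) :
    IntervalIntegrable (fun s => (pathHat x Φ s)⁻¹ * pathDeriv Φ s * (pathHat x Φ s)⁻¹)
      volume 0 t := by
  have hc : ContinuousOn (fun t => (pathHat x Φ t)⁻¹) (uIcc 0 t) := by
    rw [uIcc_of_le ht.1]
    exact hf.continuousOn_pathHat_inv.mono (Icc_subset_Icc_right ht.2)
  exact ((hf.intervalIntegrable_deriv le_rfl ht.1 (ht.2.trans hf.lt.le)).continuousOn_mul
    hc).mul_continuousOn hc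

lemma lipDerivOn_conjIntegral (hf : IsFrame Q x Φ τ) :
    LipDerivOn (conjIntegral x Φ)
      (fun s => (pathHat x Φ s)⁻¹ * pathDeriv Φ s * (pathHat x Φ s)⁻¹) 0 τ := by
  obtain ⟨C, hC⟩ := hf.lipDerivOn_path.exists_norm_deriv_le
  obtain ⟨A, hA⟩ := isCompact_Icc.exists_bound_of_continuousOn hf.continuousOn_pathHat_inv
  refine LipDerivOn.of_integral (C := A * C * A) hf.nonneg
    (hf.intervalIntegrable_conj (right_mem_Icc.2 hf.nonneg)) ?_ (left_mem_Icc.2 hf.nonneg)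
  filter_upwards [hC] with t ht hm
  have h1 := hA t (Ioo_subset_Icc_self hm)
  have h2 := (norm_nonneg _).trans h1
  have h3 := (norm_nonneg _).trans (ht hm)
  refine (norm_mul_le _ _).trans (mul_le_mul ((norm_mul_le _ _).trans ?_) h1 (norm_nonneg _)
    (mul_nonneg h2 h3))
  exact mul_le_mul h1 (ht hm) (norm_nonneg _) h2

lemma posSemidef_conj_deriv (hf : IsFrame Q x Φ τ) : ∀ᵐ t, t ∈ Ioo 0 τ →
    ((pathHat x Φ t)⁻¹ * pathDeriv Φ t * (pathHat x Φ t)⁻¹).PosSemidef := by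
  filter_upwards [hf.path.posSemidef_deriv] with t ht hm
  exact posSemidef_conj_symm (ht ⟨hm.1, hm.2.trans hf.lt⟩)
    (transpose_eq_of_posSemidef (hf.posDef_pathHat (Ioo_subset_Icc_self hm)).inv.posSemidef)

lemma posSemidef_conjIntegral (hf : IsFrame Q x Φ τ) {t : ℝ} (ht : t ∈ Icc 0 τ) :
    (conjIntegral x Φ t).PosSemidef := by
  refine posSemidef_intervalIntegral ht.1 (hf.intervalIntegrable_conj ht) ?_
  filter_upwards [hf.posSemidef_conj_deriv] with s hs hm using hs ⟨hm.1, hm.2.trans_le ht.2⟩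

/-- The integral of `conjIntegral` against the Parisi measure. -/
lemma setIntegral_conjIntegral (hf : IsFrame Q x Φ τ) (hμ : IsParisiMeasure m x μ)
    (hr : r ∈ Icc 0 τ) :
    ∫ t in Icc r τ, conjIntegral x Φ t ∂μ = conjIntegral x Φ τ
      - leftMass μ r • conjIntegral x Φ r - ((pathHat x Φ τ)⁻¹ - (pathHat x Φ r)⁻¹) := by
  rw [hμ.setIntegral_eq hf.distr hf.lt.le hf.eq_one hr
    (hf.lipDerivOn_conjIntegral.mono hr.1 le_rfl),
    (hf.lipDerivOn_pathHat_inv.mono hr.1 le_rfl).integral_eq_sub hr.2]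

/-- After integration by parts the remaining integrand is x(D⁻¹Φ'D⁻¹Φ + BΦ'). It is the derivative
of D⁻¹Φ - BD, since the terms D⁻¹Φ' of the two products cancel. -/
lemma setIntegral_conjIntegral_mul (hf : IsFrame Q x Φ τ) (hμ : IsParisiMeasure m x μ) :
    ∫ t in Icc 0 τ, conjIntegral x Φ t * Φ t ∂μ =
      conjIntegral x Φ τ * Q - (pathHat x Φ τ)⁻¹ * Φ τ := by
  have hD := hf.lipDerivOn_pathHat.mono (c := 0) (d := τ) le_rfl hf.lt.le
  have h0 : (0 : ℝ) ∈ Icc 0 τ := left_mem_Icc.2 hf.nonneg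
  have hU := ((hf.lipDerivOn_pathHat_inv.mul hf.lipDerivOn_path).sub
    (hf.lipDerivOn_conjIntegral.mul hD)).congr_deriv (g' := fun t => x t •
      ((pathHat x Φ t)⁻¹ * pathDeriv Φ t * (pathHat x Φ t)⁻¹ * Φ t +
        conjIntegral x Φ t * pathDeriv Φ t)) (Eventually.of_forall fun t ht => by
      have hu := hf.isUnit_pathHat (Ioo_subset_Icc_self ht)
      simp only [mul_neg, mul_smul_comm, smul_mul_assoc, smul_add]
      rw [Matrix.mul_assoc _ _ (pathHat x Φ t), Matrix.nonsing_inv_mul _ hu, Matrix.mul_one]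
      abel)
  rw [hμ.setIntegral_eq hf.distr hf.lt.le hf.eq_one h0
    (hf.lipDerivOn_conjIntegral.mul hf.lipDerivOn_path), hU.integral_eq_sub hf.nonneg,
    hf.path.left_end, hf.pathHat_eq_sub le_rfl hf.lt.le]
  have hB0 : conjIntegral x Φ 0 = 0 := intervalIntegral.integral_same
  rw [hB0, leftMass_zero]
  simp only [mul_zero, zero_mul, zero_smul, sub_zero, mul_sub]
  abel

lemma lipDerivOn_xiPrime (hβ : ∀ j, Summable fun p : ℕ => (2 : ℝ) ^ p * β p j ^ 2)
    (hQ : IsOverlapConstraint Q) (f : Fin m → ℝ) (hf : IsFrame Q x Φ τ) :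
    LipDerivOn (fun t => xiPrime β (Φ t) + Matrix.vecMulVec f f)
      (fun t => Matrix.of fun i j => xiEntryDeriv₂ β i j (Φ t i j) * pathDeriv Φ t i j) 0 τ :=
  ((hf.lipDerivOn_path.xiPrime hβ fun _ ht =>
    hf.path.abs_entry_le_one hQ (hf.Icc_subset ht)).add
    (LipDerivOn.const (Matrix.vecMulVec f f) 0 τ)).congr_deriv
    (Eventually.of_forall fun _ _ => add_zero _)

lemma posSemidef_xiPrime_sub (hβ : ∀ j, Summable fun p : ℕ => (2 : ℝ) ^ p * β p j ^ 2)
    (hQ : IsOverlapConstraint Q) (hf : IsFrame Q x Φ τ) {s t : ℝ} (hs : 0 ≤ s) (hst : s ≤ t)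
    (ht : t ≤ m) : (xiPrime β (Φ t) - xiPrime β (Φ s)).PosSemidef := by
  have hs' : s ∈ Icc (0 : ℝ) m := ⟨hs, hst.trans ht⟩
  have ht' : t ∈ Icc (0 : ℝ) m := ⟨hs.trans hst, ht⟩
  exact VectorSpin.posSemidef_xiPrime_sub hβ (hf.path.posSemidef s hs') (hf.path.posSemidef t ht')
    (hf.path.mono s hs' t ht' hst) (hf.path.abs_entry_le_one hQ hs')
    (hf.path.abs_entry_le_one hQ ht')

/-- ξ' is monotone along the increasing path by the Schur product theorem; differentiate. -/
lemma posSemidef_xiPrime_deriv (hβ : ∀ j, Summable fun p : ℕ => (2 : ℝ) ^ p * β p j ^ 2)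
    (hQ : IsOverlapConstraint Q) (hf : IsFrame Q x Φ τ) : ∀ᵐ t, t ∈ Ioo 0 τ →
      (Matrix.of fun i j => xiEntryDeriv₂ β i j (Φ t i j) * pathDeriv Φ t i j).PosSemidef := by
  filter_upwards [(hf.lipDerivOn_xiPrime hβ hQ 0).deriv] with t ht hm
  refine HasDerivAt.posSemidef (ht hm) ?_
  filter_upwards [Ioo_mem_nhdsGT hm.2] with s hs
  rw [add_sub_add_right_eq_sub]
  exact hf.posSemidef_xiPrime_sub hβ hQ hm.1.le hs.1.le (hs.2.trans hf.lt).le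

lemma lipDerivOn_defect (hβ : ∀ j, Summable fun p : ℕ => (2 : ℝ) ^ p * β p j ^ 2)
    (hQ : IsOverlapConstraint Q) (f : Fin m → ℝ) (hf : IsFrame Q x Φ τ) :
    LipDerivOn (defect β f x Φ)
      (fun t => (Matrix.of fun i j => xiEntryDeriv₂ β i j (Φ t i j) * pathDeriv Φ t i j)
        - (pathHat x Φ t)⁻¹ * pathDeriv Φ t * (pathHat x Φ t)⁻¹) 0 τ :=
  (hf.lipDerivOn_xiPrime hβ hQ f).sub hf.lipDerivOn_conjIntegral

lemma defect_zero (f : Fin m → ℝ) (hf : IsFrame Q x Φ τ) :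
    defect β f x Φ 0 = Matrix.vecMulVec f f := by
  have hB0 : conjIntegral x Φ 0 = 0 := intervalIntegral.integral_same
  rw [defect, hf.path.left_end, xiPrime_zero, hB0, zero_add, sub_zero]

lemma posSemidef_energy_deriv (hβ : ∀ j, Summable fun p : ℕ => (2 : ℝ) ^ p * β p j ^ 2)
    (hQ : IsOverlapConstraint Q) (f : Fin m → ℝ) (hf : IsFrame Q x Φ τ) {t : ℝ} (ht : t ∈ Icc 0 τ) :
    (xiPrime β (Φ t) + Matrix.vecMulVec f f).PosSemidef := by
  have h := hf.posSemidef_xiPrime_sub hβ hQ le_rfl ht.1 (ht.2.trans hf.lt.le)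
  rw [hf.path.left_end, xiPrime_zero, sub_zero] at h
  exact h.add (posSemidef_vecMulVec f)

lemma transpose_defect (hβ : ∀ j, Summable fun p : ℕ => (2 : ℝ) ^ p * β p j ^ 2)
    (hQ : IsOverlapConstraint Q) (f : Fin m → ℝ) (hf : IsFrame Q x Φ τ) {t : ℝ}
    (ht : t ∈ Icc 0 τ) : (defect β f x Φ t).transpose = defect β f x Φ t := by
  rw [defect, Matrix.transpose_sub,
    transpose_eq_of_posSemidef (hf.posSemidef_energy_deriv hβ hQ f ht),
    transpose_eq_of_posSemidef (hf.posSemidef_conjIntegral ht)]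

end IsFrame

end Defect

/-! ### Sign of the tails and complementary slackness -/

section Stationarity

variable {Q : Matrix (Fin m) (Fin m) ℝ} {x : ℝ → ℝ} {Φ : ℝ → Matrix (Fin m) (Fin m) ℝ}
  {τ r : ℝ} {β : ℕ → Fin m → ℝ} {f : Fin m → ℝ} {μ : Measure ℝ}

lemma frob_conj {E : Matrix (Fin m) (Fin m) ℝ} (hE : E.transpose = E)
    (P X : Matrix (Fin m) (Fin m) ℝ) : frob (E * P * E) X = frob P (E * X * E) := by
  rw [frob_eq_trace, frob_eq_trace, Matrix.transpose_mul, Matrix.transpose_mul, hE,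
    Matrix.mul_assoc E, Matrix.trace_mul_comm, ← Matrix.mul_assoc, ← Matrix.mul_assoc]

lemma IsFrame.transpose_pathHat_inv (hf : IsFrame Q x Φ τ) {t : ℝ} (ht : t ∈ Icc 0 τ) :
    ((pathHat x Φ t)⁻¹).transpose = (pathHat x Φ t)⁻¹ :=
  transpose_eq_of_posSemidef (hf.posDef_pathHat ht).inv.posSemidef

lemma IsFrame.integral_frob_conj (hf : IsFrame Q x Φ τ) {a b : ℝ} (ha : 0 ≤ a) (hab : a ≤ b)
    (hb : b ≤ τ) (P : Matrix (Fin m) (Fin m) ℝ) :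
    ∫ t in a..b, frob ((pathHat x Φ t)⁻¹ * P * (pathHat x Φ t)⁻¹) (pathDeriv Φ t) =
      frob P (conjIntegral x Φ b - conjIntegral x Φ a) := by
  rw [← ((hf.lipDerivOn_conjIntegral.mono ha hb).clm (frobCLM P)).integral_eq_sub hab |>.trans
    (map_sub (frobCLM P) _ _).symm |>.trans (frobCLM_apply _ _)]
  refine intervalIntegral.integral_congr fun t ht => ?_
  rw [uIcc_of_le hab] at ht
  exact frob_conj (hf.transpose_pathHat_inv ⟨ha.trans ht.1, ht.2.trans hb⟩) _ _

lemma setIntegral_frob {G : ℝ → Matrix (Fin m) (Fin m) ℝ} {S : Set ℝ} (hG : IntegrableOn G S μ)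
    (P : Matrix (Fin m) (Fin m) ℝ) :
    ∫ t in S, frob (G t) P ∂μ = frob (∫ t in S, G t ∂μ) P := by
  rw [frob_comm, ← frobCLM_apply, ← (frobCLM P).integral_comp_comm hG]
  simp only [frobCLM_apply, frob_comm P]

lemma setIntegral_trace {G : ℝ → Matrix (Fin m) (Fin m) ℝ} {S : Set ℝ} (hG : IntegrableOn G S μ) :
    (∫ t in S, G t ∂μ).trace = ∫ t in S, (G t).trace ∂μ :=
  (traceCLM.integral_comp_comm hG).symm

lemma intervalIntegral_trace {G : ℝ → Matrix (Fin m) (Fin m) ℝ} {a b : ℝ}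
    (hG : IntervalIntegrable G volume a b) :
    (∫ t in a..b, G t).trace = ∫ t in a..b, (G t).trace :=
  (traceCLM.intervalIntegral_comp_comm hG).symm

/-- Raising the path after time `r` does not lower the functional. -/
lemma IsMinimizer.frob_setIntegral_defect_nonpos
    (hβ : ∀ j, Summable fun p : ℕ => (2 : ℝ) ^ p * β p j ^ 2)
    (hQ : IsOverlapConstraint Q) (hmin : IsMinimizer β f Q x Φ) (hμ : IsParisiMeasure m x μ)
    (hτ : IsCutoff Q x Φ τ) (hr : r ∈ Icc 0 τ) {P : Matrix (Fin m) (Fin m) ℝ}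
    (hP : P.PosSemidef) (htr : P.trace = 1) :
    frob (∫ t in Icc r τ, defect β f x Φ t ∂μ) P ≤ 0 := by
  have hf := hmin.1.isFrame hτ
  have hprob := hμ.isProbabilityMeasure hf.distr
  have s2 : Icc r τ ⊆ Icc 0 τ := Icc_subset_Icc_left hr.1
  have hA : IntegrableOn (fun t => xiPrime β (Φ t) + Matrix.vecMulVec f f) (Icc r τ) μ :=
    ((hf.lipDerivOn_xiPrime hβ hQ f).continuousOn.mono s2).integrableOn_compact isCompact_Icc
  have hB : IntegrableOn (conjIntegral x Φ) (Icc r τ) μ :=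
    (hf.lipDerivOn_conjIntegral.continuousOn.mono s2).integrableOn_compact isCompact_Icc
  -- Pure jump: a = 0, b = 1.
  have h := hmin.firstVariation_nonneg hβ hQ hμ hτ hr hP htr (a := 0) zero_le_one
  have hB0 : conjIntegral x Φ 0 = 0 := intervalIntegral.integral_same
  simp only [zero_smul, zero_sub, mul_one, one_smul, sub_zero, neg_zero, zero_mul, one_mul,
    frob_zero_right, integral_zero, hf.integral_frob_conj le_rfl hr.1 hr.2,
    hf.integral_frob_conj hr.1 hr.2 le_rfl, setIntegral_frob hA] at h
  have h1 : ∫ t in Icc r τ, defect β f x Φ t ∂μ =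
      (∫ t in Icc r τ, (xiPrime β (Φ t) + Matrix.vecMulVec f f) ∂μ) -
      (conjIntegral x Φ τ - leftMass μ r • conjIntegral x Φ r
        - ((pathHat x Φ τ)⁻¹ - (pathHat x Φ r)⁻¹)) := by
    rw [← hf.setIntegral_conjIntegral hμ hr]
    exact integral_sub hA hB
  have h2 : ((Q - Φ τ)⁻¹ * -P).trace = -frob (pathHat x Φ τ)⁻¹ P := by
    rw [hf.pathHat_eq_sub le_rfl hf.lt.le, frob_eq_trace, mul_neg, Matrix.trace_neg,
      transpose_eq_of_posSemidef hf.posDef.inv.posSemidef]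
  rw [h2, hB0, sub_zero, frob_neg_left, frob_neg_left, frob_smul_left, frob_sub_right,
    frob_comm P, frob_comm P] at h
  rw [h1]
  simp only [frob_sub_left, frob_smul_left]
  linarith

/-- Shrinking the path does not lower the functional. -/
lemma IsMinimizer.trace_setIntegral_defect_mul_nonneg
    (hβ : ∀ j, Summable fun p : ℕ => (2 : ℝ) ^ p * β p j ^ 2)
    (hQ : IsOverlapConstraint Q) (hmin : IsMinimizer β f Q x Φ) (hμ : IsParisiMeasure m x μ)
    (hτ : IsCutoff Q x Φ τ) : 0 ≤ (∫ t in Icc 0 τ, defect β f x Φ t * Φ t ∂μ).trace := by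
  have hf := hmin.1.isFrame hτ
  have hprob := hμ.isProbabilityMeasure hf.distr
  have h0 : (0 : ℝ) ∈ Icc 0 τ := left_mem_Icc.2 hf.nonneg
  have hm : (0 : ℝ) < m := hf.nonneg.trans_lt hf.lt
  have hA : IntegrableOn (fun t => (xiPrime β (Φ t) + Matrix.vecMulVec f f) * Φ t) (Icc 0 τ) μ :=
    ((hf.lipDerivOn_xiPrime hβ hQ f).continuousOn.mul
      hf.lipDerivOn_path.continuousOn).integrableOn_compact isCompact_Icc
  have hB : IntegrableOn (fun t => conjIntegral x Φ t * Φ t) (Icc 0 τ) μ :=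
    (hf.lipDerivOn_conjIntegral.continuousOn.mul
      hf.lipDerivOn_path.continuousOn).integrableOn_compact isCompact_Icc
  -- Pure shrinking: a = 1, b = 0. The jump has height zero, and Q/m is merely some semidefinite
  -- matrix of trace 1.
  have h := hmin.firstVariation_nonneg hβ hQ hμ hτ h0 (P := (m : ℝ)⁻¹ • Q)
    (hQ.posSemidef.smul (inv_nonneg.2 hm.le))
    (by rw [Matrix.trace_smul, hQ.trace, smul_eq_mul, inv_mul_cancel₀ hm.ne']) (a := 1) le_rfl
  have hi : IntervalIntegrable (fun t => frob ((pathHat x Φ t)⁻¹ * Q * (pathHat x Φ t)⁻¹)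
      (pathDeriv Φ t)) volume 0 τ :=
    intervalIntegrable_frob hf.nonneg ((hf.continuousOn_pathHat_inv.mul continuousOn_const).mul
      hf.continuousOn_pathHat_inv) (hf.intervalIntegrable_deriv le_rfl hf.nonneg hf.lt.le)
  have e1 : ∫ t in (0 : ℝ)..τ, frob ((pathHat x Φ t)⁻¹ * (Q - pathHat x Φ t) * (pathHat x Φ t)⁻¹)
      (pathDeriv Φ t) = frob Q (conjIntegral x Φ τ)
        - ∫ t in (0 : ℝ)..τ, frob (pathHat x Φ t)⁻¹ (pathDeriv Φ t) := by
    have hB0 : conjIntegral x Φ 0 = 0 := intervalIntegral.integral_same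
    have := hf.integral_frob_conj le_rfl hf.nonneg le_rfl Q
    rw [hB0, sub_zero] at this
    rw [← this, ← intervalIntegral.integral_sub hi
      (hf.intervalIntegrable_entropy le_rfl hf.nonneg le_rfl)]
    refine intervalIntegral.integral_congr fun t ht => ?_
    rw [uIcc_of_le hf.nonneg] at ht
    rw [mul_sub, sub_mul, Matrix.nonsing_inv_mul _ (hf.isUnit_pathHat ht), one_mul, frob_sub_left]
  have e2 : ∫ t in Icc 0 τ, frob (xiPrime β (Φ t) + Matrix.vecMulVec f f) (-Φ t) ∂μ =
      -(∫ t in Icc 0 τ, (xiPrime β (Φ t) + Matrix.vecMulVec f f) * Φ t ∂μ).trace := by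
    rw [setIntegral_trace hA, ← integral_neg]
    refine setIntegral_congr_fun measurableSet_Icc fun t ht => ?_
    rw [frob_eq_trace, transpose_eq_of_posSemidef (hf.posSemidef_energy_deriv hβ hQ f ht), mul_neg,
      Matrix.trace_neg]
  simp only [zero_smul, zero_sub, mul_zero, one_smul, sub_zero, neg_mul, zero_mul, one_mul, e1, e2,
    Ico_self, setIntegral_empty, intervalIntegral.integral_same, neg_zero, neg_neg, add_zero] at h
  have h1 : ∫ t in Icc 0 τ, defect β f x Φ t * Φ t ∂μ =
      (∫ t in Icc 0 τ, (xiPrime β (Φ t) + Matrix.vecMulVec f f) * Φ t ∂μ) -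
      (conjIntegral x Φ τ * Q - (pathHat x Φ τ)⁻¹ * Φ τ) := by
    rw [← hf.setIntegral_conjIntegral_mul hμ, ← integral_sub hA hB]
    simp only [defect, sub_mul]
  rw [h1, Matrix.trace_sub, Matrix.trace_sub, hf.pathHat_eq_sub le_rfl hf.lt.le]
  rw [frob_eq_trace, transpose_eq_of_posSemidef hQ.posSemidef, Matrix.trace_mul_comm Q] at h
  linarith

/-- Jumps in all directions vvᵀ, normalized to trace 1, test the whole semidefinite cone. -/
lemma IsMinimizer.posSemidef_neg_setIntegral_defect
    (hβ : ∀ j, Summable fun p : ℕ => (2 : ℝ) ^ p * β p j ^ 2)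
    (hQ : IsOverlapConstraint Q) (hmin : IsMinimizer β f Q x Φ) (hμ : IsParisiMeasure m x μ)
    (hτ : IsCutoff Q x Φ τ) (hr : r ∈ Icc 0 τ) :
    (-∫ t in Icc r τ, defect β f x Φ t ∂μ).PosSemidef := by
  have hf := hmin.1.isFrame hτ
  have hprob := hμ.isProbabilityMeasure hf.distr
  have hF : IntegrableOn (defect β f x Φ) (Icc r τ) μ :=
    ((hf.lipDerivOn_defect hβ hQ f).continuousOn.mono
      (Icc_subset_Icc_left hr.1)).integrableOn_compact isCompact_Icc
  have hent : ∀ i j, (∫ t in Icc r τ, defect β f x Φ t ∂μ) i j =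
      ∫ t in Icc r τ, defect β f x Φ t i j ∂μ := fun i j =>
    ((entryCLM i j).integral_comp_comm hF).symm
  refine posSemidef_iff_frob_vecMulVec.2 ⟨?_, fun v => ?_⟩
  · ext i j
    rw [Matrix.transpose_apply, Matrix.neg_apply, Matrix.neg_apply, hent, hent]
    congr 1
    refine setIntegral_congr_fun measurableSet_Icc fun t ht => ?_
    exact congrFun₂ (hf.transpose_defect hβ hQ f ⟨hr.1.trans ht.1, ht.2⟩) i j
  · have hV := posSemidef_vecMulVec v
    rcases hV.trace_nonneg.eq_or_lt with h | h
    · rw [hV.trace_eq_zero_iff.1 h.symm, frob_zero_right]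
    · have := hmin.frob_setIntegral_defect_nonpos hβ hQ hμ hτ hr (hV.smul (inv_nonneg.2 h.le))
        (by rw [Matrix.trace_smul, smul_eq_mul, inv_mul_cancel₀ h.ne'])
      rw [frob_smul_right] at this
      rw [frob_neg_left]
      have h2 := nonpos_of_mul_nonpos_right this (inv_pos.2 h)
      linarith

lemma Icc_inter_Ici_of_le {a b c : ℝ} (h : a ≤ c) : Icc a b ∩ Ici c = Icc c b := by
  ext s
  exact ⟨fun hs => ⟨hs.2, hs.1.2⟩, fun hs => ⟨⟨h.trans hs.1, hs.2⟩, hs.1⟩⟩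

/-- Complementary slackness. -/
lemma IsMinimizer.setIntegral_defect_mul_deriv
    (hβ : ∀ j, Summable fun p : ℕ => (2 : ℝ) ^ p * β p j ^ 2)
    (hQ : IsOverlapConstraint Q) (hmin : IsMinimizer β f Q x Φ) (hμ : IsParisiMeasure m x μ)
    (hτ : IsCutoff Q x Φ τ) : ∀ᵐ q, q ∈ Ioo 0 τ →
      (∫ t in Icc q τ, defect β f x Φ t ∂μ) * pathDeriv Φ q = 0 := by
  have hf := hmin.1.isFrame hτ
  have hprob := hμ.isProbabilityMeasure hf.distr
  have hF : IntegrableOn (defect β f x Φ) (Icc 0 τ) μ :=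
    (hf.lipDerivOn_defect hβ hQ f).continuousOn.integrableOn_compact isCompact_Icc
  have hΦ' := hf.intervalIntegrable_deriv le_rfl hf.nonneg hf.lt.le
  -- Writing Φ(s) = ∫_0^s Φ' and exchanging integrals, ∫ F Φ dμ becomes ∫ N(q) Φ'(q) dq.
  have e1 := setIntegral_mul_primitive hf.nonneg measurableSet_Icc subset_rfl hΦ' hF
  have hi := intervalIntegrable_tail_mul hf.nonneg hΦ' hF
  have e2 : ∫ s in Icc 0 τ, defect β f x Φ s * (∫ q in (0 : ℝ)..s, pathDeriv Φ q) ∂μ =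
      ∫ s in Icc 0 τ, defect β f x Φ s * Φ s ∂μ :=
    setIntegral_congr_fun measurableSet_Icc fun s hs => by
      rw [hf.lipDerivOn_path.eq_add_integral hs, hf.path.left_end, zero_add]
  have hpos : ∀ᵐ q, q ∈ Ioo 0 τ →
      (-∫ t in Icc q τ, defect β f x Φ t ∂μ).PosSemidef ∧ (pathDeriv Φ q).PosSemidef := by
    filter_upwards [hf.path.posSemidef_deriv] with q hq hm
    exact ⟨hmin.posSemidef_neg_setIntegral_defect hβ hQ hμ hτ (Ioo_subset_Icc_self hm),
      hq ⟨hm.1, hm.2.trans hf.lt⟩⟩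
  have hnn : 0 ≤ᵐ[volume.restrict (Ioo 0 τ)] fun q =>
      -((∫ s in Icc 0 τ ∩ Ici q, defect β f x Φ s ∂μ) * pathDeriv Φ q).trace := by
    rw [EventuallyLE, ae_restrict_iff' measurableSet_Ioo]
    filter_upwards [hpos] with q hq hm
    rw [Icc_inter_Ici_of_le hm.1.le, ← Matrix.trace_neg, ← neg_mul]
    exact trace_mul_nonneg (hq hm).1 (hq hm).2
  have hi' : Integrable (fun q =>
      -((∫ s in Icc 0 τ ∩ Ici q, defect β f x Φ s ∂μ) * pathDeriv Φ q).trace)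
      (volume.restrict (Ioo 0 τ)) :=
    (traceCLM.integrable_comp (((intervalIntegrable_iff_integrableOn_Ioc_of_le hf.nonneg).1
      hi).mono_set Ioo_subset_Ioc_self)).neg
  -- The integrand -tr(N Φ') is nonnegative by the jump variation, and the shrinking variation
  -- bounds its integral by 0.
  have hle : ∫ q in Ioo 0 τ,
      -((∫ s in Icc 0 τ ∩ Ici q, defect β f x Φ s ∂μ) * pathDeriv Φ q).trace ≤ 0 := by
    rw [integral_neg, ← integral_Ioc_eq_integral_Ioo, ← intervalIntegral.integral_of_le hf.nonneg,
      ← intervalIntegral_trace hi, ← e1, e2]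
    exact neg_nonpos.2 (hmin.trace_setIntegral_defect_mul_nonneg hβ hQ hμ hτ)
  have hz := (integral_eq_zero_iff_of_nonneg_ae hnn hi').1
    (le_antisymm hle (integral_nonneg_of_ae hnn))
  rw [EventuallyEq, ae_restrict_iff' measurableSet_Ioo] at hz
  filter_upwards [hz, hpos] with q hq hp hm
  have h1 := hq hm
  rw [Icc_inter_Ici_of_le hm.1.le, Pi.zero_apply, ← Matrix.trace_neg, ← neg_mul] at h1
  have h2 := mul_eq_zero_of_trace_mul_eq_zero (hp hm).1 (hp hm).2 h1
  rwa [neg_mul, neg_eq_zero] at h2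

end Stationarity

/-! ### Slackness forces the defect to vanish -/

section Rigidity

variable {Q : Matrix (Fin m) (Fin m) ℝ} {x : ℝ → ℝ} {Φ : ℝ → Matrix (Fin m) (Fin m) ℝ}
  {τ r : ℝ} {μ : Measure ℝ} {F A' : ℝ → Matrix (Fin m) (Fin m) ℝ}

lemma integral_congr_ae_Ioo {E : Type*} [NormedAddCommGroup E] [NormedSpace ℝ E] {f g : ℝ → E}
    {a b : ℝ} (hab : a ≤ b) (h : ∀ᵐ t, t ∈ Ioo a b → f t = g t) :
    ∫ t in a..b, f t = ∫ t in a..b, g t := by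
  rw [intervalIntegral.integral_of_le hab, intervalIntegral.integral_of_le hab,
    integral_Ioc_eq_integral_Ioo, integral_Ioc_eq_integral_Ioo]
  exact setIntegral_congr_ae measurableSet_Ioo h

/-- The properties of the defect of a minimizer that force it to vanish: `F` has derivative
`A' - Φ̂⁻¹ Φ' Φ̂⁻¹`, and its tail integrals are negative semidefinite and orthogonal to `Φ'`. -/
structure IsSlackDefect (Q : Matrix (Fin m) (Fin m) ℝ) (x : ℝ → ℝ)
    (Φ : ℝ → Matrix (Fin m) (Fin m) ℝ) (τ : ℝ) (μ : Measure ℝ)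
    (F A' : ℝ → Matrix (Fin m) (Fin m) ℝ) : Prop where
  frame : IsFrame Q x Φ τ
  parisi : IsParisiMeasure m x μ
  lipDerivOn : LipDerivOn F
    (fun t => A' t - (pathHat x Φ t)⁻¹ * pathDeriv Φ t * (pathHat x Φ t)⁻¹) 0 τ
  transpose_eq : ∀ t ∈ Icc 0 τ, (F t).transpose = F t
  posSemidef_zero : (F 0).PosSemidef
  posSemidef_deriv : ∀ᵐ t, t ∈ Ioo 0 τ → (A' t).PosSemidef
  posSemidef_tail : ∀ r ∈ Icc 0 τ, (-∫ t in Icc r τ, F t ∂μ).PosSemidef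
  tail_mul_deriv : ∀ᵐ q, q ∈ Ioo 0 τ → (∫ t in Icc q τ, F t ∂μ) * pathDeriv Φ q = 0

namespace IsSlackDefect

lemma isProbabilityMeasure (h : IsSlackDefect Q x Φ τ μ F A') : IsProbabilityMeasure μ :=
  h.parisi.isProbabilityMeasure h.frame.distr

lemma continuousOn_pathHat (h : IsSlackDefect Q x Φ τ μ F A') :
    ContinuousOn (pathHat x Φ) (Icc 0 τ) :=
  h.frame.continuousOn_pathHat.mono h.frame.Icc_subset

lemma intervalIntegrable_deriv (h : IsSlackDefect Q x Φ τ μ F A') :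
    IntervalIntegrable A' volume 0 τ := by
  have h1 := h.lipDerivOn.add h.frame.lipDerivOn_conjIntegral
  simp only [sub_add_cancel] at h1
  exact h1.intervalIntegrable h.frame.nonneg

lemma deriv_mul_tail (h : IsSlackDefect Q x Φ τ μ F A') : ∀ᵐ q, q ∈ Ioo 0 τ →
    pathDeriv Φ q * (∫ t in Icc q τ, F t ∂μ) = 0 := by
  filter_upwards [h.tail_mul_deriv, h.frame.path.posSemidef_deriv] with q h1 h2 hq
  have h3 := transpose_eq_of_posSemidef (h.posSemidef_tail q (Ioo_subset_Icc_self hq))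
  rw [Matrix.transpose_neg, neg_inj] at h3
  have h4 := congrArg Matrix.transpose (h1 hq)
  rwa [Matrix.transpose_mul, h3, transpose_eq_of_posSemidef (h2 ⟨hq.1, hq.2.trans h.frame.lt⟩),
    Matrix.transpose_zero] at h4

/-- Write D(t) as D(r) plus the integral of D' = -xΦ'. By Fubini the correction is the integral of
N(q) D'(q), zero by slackness: the tail behaves as if D were frozen at r. -/
lemma setIntegral_mul_pathHat (h : IsSlackDefect Q x Φ τ μ F A') (hr : r ∈ Icc 0 τ) :
    ∫ t in Icc r τ, F t * pathHat x Φ t ∂μ = (∫ t in Icc r τ, F t ∂μ) * pathHat x Φ r := by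
  have hf := h.frame
  have hprob := h.isProbabilityMeasure
  have s2 : Icc r τ ⊆ Icc 0 τ := Icc_subset_Icc_left hr.1
  have hD := hf.lipDerivOn_pathHat.mono hr.1 hf.lt.le
  have hFi : IntegrableOn F (Icc r τ) μ :=
    (h.lipDerivOn.continuousOn.mono s2).integrableOn_compact isCompact_Icc
  have hFD : IntegrableOn (fun t => F t * pathHat x Φ t) (Icc r τ) μ :=
    ((h.lipDerivOn.continuousOn.mul h.continuousOn_pathHat).mono s2).integrableOn_compact
      isCompact_Icc
  have e := setIntegral_mul_primitive hr.2 measurableSet_Icc subset_rfl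
    (hD.intervalIntegrable hr.2) hFi
  have e0 : ∫ q in r..τ, (∫ s in Icc r τ ∩ Ici q, F s ∂μ) * -(x q • pathDeriv Φ q) = 0 := by
    rw [integral_congr_ae_Ioo (g := fun _ => 0) hr.2, intervalIntegral.integral_zero]
    filter_upwards [h.tail_mul_deriv] with q hq hm
    rw [Icc_inter_Ici_of_le hm.1.le, mul_neg, mul_smul_comm, hq ⟨hr.1.trans_lt hm.1, hm.2⟩,
      smul_zero, neg_zero]
  rw [← integral_mul_const_ring hFi, ← sub_eq_zero, ← integral_sub hFD (hFi.mul_const _), ← e0, ← e]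
  refine setIntegral_congr_fun measurableSet_Icc fun s hs => ?_
  rw [hD.eq_add_integral hs, mul_add, add_sub_cancel_left]

/-- The freezing argument on the left factor: the inner tail is N(q) D(q) by the right-hand version,
and Φ'N = 0 kills the correction. -/
lemma setIntegral_conj_pathHat (h : IsSlackDefect Q x Φ τ μ F A') (hr : r ∈ Icc 0 τ) :
    ∫ t in Icc r τ, pathHat x Φ t * F t * pathHat x Φ t ∂μ =
      pathHat x Φ r * (∫ t in Icc r τ, F t ∂μ) * pathHat x Φ r := by
  have hf := h.frame
  have hprob := h.isProbabilityMeasure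
  have s2 : Icc r τ ⊆ Icc 0 τ := Icc_subset_Icc_left hr.1
  have hD := hf.lipDerivOn_pathHat.mono hr.1 hf.lt.le
  have hFD : IntegrableOn (fun t => F t * pathHat x Φ t) (Icc r τ) μ :=
    ((h.lipDerivOn.continuousOn.mul h.continuousOn_pathHat).mono s2).integrableOn_compact
      isCompact_Icc
  have hDFD : IntegrableOn (fun t => pathHat x Φ t * F t * pathHat x Φ t) (Icc r τ) μ :=
    (((h.continuousOn_pathHat.mul h.lipDerivOn.continuousOn).mul h.continuousOn_pathHat).mono
      s2).integrableOn_compact isCompact_Icc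
  have e := setIntegral_primitive_mul hr.2 measurableSet_Icc subset_rfl
    (hD.intervalIntegrable hr.2) hFD
  have e0 : ∫ q in r..τ, -(x q • pathDeriv Φ q) *
      (∫ s in Icc r τ ∩ Ici q, F s * pathHat x Φ s ∂μ) = 0 := by
    rw [integral_congr_ae_Ioo (g := fun _ => 0) hr.2, intervalIntegral.integral_zero]
    filter_upwards [h.deriv_mul_tail] with q hq hm
    have hm' : q ∈ Ioo 0 τ := ⟨hr.1.trans_lt hm.1, hm.2⟩
    rw [Icc_inter_Ici_of_le hm.1.le, h.setIntegral_mul_pathHat (Ioo_subset_Icc_self hm'), neg_mul,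
      smul_mul_assoc, ← mul_assoc, hq hm', zero_mul, smul_zero, neg_zero]
  rw [mul_assoc, ← h.setIntegral_mul_pathHat hr, ← integral_const_mul_ring _ hFD, ← sub_eq_zero,
    ← integral_sub hDFD (hFD.const_mul _), ← e0, ← e]
  refine setIntegral_congr_fun measurableSet_Icc fun s hs => ?_
  rw [hD.eq_add_integral hs]
  noncomm_ring

lemma posSemidef_conj_tail (h : IsSlackDefect Q x Φ τ μ F A') (hr : r ∈ Icc 0 τ) :
    (-∫ t in Icc r τ, pathHat x Φ t * F t * pathHat x Φ t ∂μ).PosSemidef := by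
  rw [h.setIntegral_conj_pathHat hr, ← neg_mul, ← mul_neg]
  exact posSemidef_conj_symm (h.posSemidef_tail r hr)
    (transpose_eq_of_posSemidef (h.frame.posDef_pathHat hr).posSemidef)

lemma integrableOn_conj (h : IsSlackDefect Q x Φ τ μ F A') :
    IntegrableOn (fun t => pathHat x Φ t * F t * pathHat x Φ t) (Icc 0 τ) μ :=
  have := h.isProbabilityMeasure
  ((h.continuousOn_pathHat.mul h.lipDerivOn.continuousOn).mul
    h.continuousOn_pathHat).integrableOn_compact isCompact_Icc

lemma setIntegral_Ico_add {E : Type*} [NormedAddCommGroup E] [NormedSpace ℝ E] {G : ℝ → E}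
    {a b c : ℝ} (hG : IntegrableOn G (Icc a c) μ) (hab : a ≤ b) (hbc : b ≤ c) :
    ∫ t in Ico a b, G t ∂μ + ∫ t in Icc b c, G t ∂μ = ∫ t in Icc a c, G t ∂μ := by
  rw [← Ico_union_Icc_eq_Icc hab hbc, setIntegral_union
    (Set.disjoint_left.2 fun s h1 h2 => absurd h1.2 (not_lt.2 h2.1)) measurableSet_Icc
    (hG.mono_set fun s hs => ⟨hs.1, hs.2.le.trans hbc⟩) (hG.mono_set (Icc_subset_Icc_left hab))]

/-- Let M be the tail of G = DFD. Fubini on [0, s) and D⁻¹Φ'D⁻¹M = D⁻¹Φ'ND = 0 give F(s)M(s) =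
F(0)M(0) + ∫_0^s A'M dq - ∫_{[0,s)} FG dμ. The only part of F' without a favourable sign drops out,
and the traces on the right are nonpositive because F(0) ≥ 0, A' ≥ 0, M ≤ 0 and tr(FDFD) ≥ 0. -/
lemma trace_mul_conj_tail_nonpos (h : IsSlackDefect Q x Φ τ μ F A') {s : ℝ} (hs : s ∈ Icc 0 τ) :
    (F s * ∫ t in Icc s τ, pathHat x Φ t * F t * pathHat x Φ t ∂μ).trace ≤ 0 := by
  have hf := h.frame
  have hprob := h.isProbabilityMeasure
  set G : ℝ → Matrix (Fin m) (Fin m) ℝ := fun t => pathHat x Φ t * F t * pathHat x Φ t with hGdef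
  have hG : IntegrableOn G (Icc 0 τ) μ := h.integrableOn_conj
  have hsub : Ico 0 s ⊆ Icc 0 τ := fun t ht => ⟨ht.1, ht.2.le.trans hs.2⟩
  have hF := h.lipDerivOn.mono le_rfl hs.2
  have hF' := hF.intervalIntegrable hs.1
  have hA' : IntervalIntegrable A' volume 0 s :=
    h.intervalIntegrable_deriv.mono_set (by
      rw [uIcc_of_le hs.1, uIcc_of_le hf.nonneg]; exact Icc_subset_Icc_right hs.2)
  have hAG := intervalIntegrable_mul_tail hs.1 hA' hG
  have hFG : IntegrableOn (fun t => F t * G t) (Ico 0 s) μ :=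
    ((h.lipDerivOn.continuousOn.mul ((h.continuousOn_pathHat.mul h.lipDerivOn.continuousOn).mul
      h.continuousOn_pathHat)).integrableOn_compact isCompact_Icc).mono_set hsub
  have e := setIntegral_primitive_mul hs.1 measurableSet_Ico Ico_subset_Icc_self hF'
    (hG.mono_set hsub)
  have e1 : ∫ q in (0 : ℝ)..s, (A' q - (pathHat x Φ q)⁻¹ * pathDeriv Φ q * (pathHat x Φ q)⁻¹) *
      (∫ t in Ico 0 s ∩ Ici q, G t ∂μ) =
      (∫ q in (0 : ℝ)..s, A' q * ∫ t in Icc 0 τ ∩ Ici q, G t ∂μ)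
        - (F s - F 0) * ∫ t in Icc s τ, G t ∂μ := by
    have hFc := hF.mul_const (∫ t in Icc s τ, G t ∂μ)
    rw [sub_mul, ← hFc.integral_eq_sub hs.1,
      ← intervalIntegral.integral_sub hAG (hFc.intervalIntegrable hs.1)]
    refine integral_congr_ae_Ioo hs.1 ?_
    filter_upwards [h.deriv_mul_tail] with q hq hm
    have hm' : q ∈ Ioo 0 τ := ⟨hm.1, hm.2.trans_le hs.2⟩
    have hu := hf.isUnit_pathHat (Ioo_subset_Icc_self hm')
    have e2 : Ico 0 s ∩ Ici q = Ico q s := by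
      ext t
      exact ⟨fun ht => ⟨ht.2, ht.1.2⟩, fun ht => ⟨⟨hm.1.le.trans ht.1, ht.2⟩, ht.1⟩⟩
    -- The inner integral over [q, s) is M(q) - M(s); the constant M(s) integrates F' back to F(s) -
    -- F(0).
    have e3 := setIntegral_Ico_add (hG.mono_set (Icc_subset_Icc_left hm.1.le)) hm.2.le hs.2
    have e4 : (pathHat x Φ q)⁻¹ * pathDeriv Φ q * (pathHat x Φ q)⁻¹ * (∫ t in Icc q τ, G t ∂μ) =
        0 := by
      rw [h.setIntegral_conj_pathHat (Ioo_subset_Icc_self hm'), ← mul_assoc, ← mul_assoc,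
        mul_assoc _ (pathHat x Φ q)⁻¹, Matrix.nonsing_inv_mul _ hu, mul_one, mul_assoc _ _
        (∫ t in Icc q τ, F t ∂μ), hq hm', mul_zero, zero_mul]
    rw [e2, Icc_inter_Ici_of_le hm.1.le, eq_sub_of_add_eq e3, mul_sub,
      sub_mul _ _ (∫ t in Icc q τ, G t ∂μ),
      e4, sub_zero]
  have e5 : ∫ p in Ico 0 s, (∫ q in (0 : ℝ)..p,
      (A' q - (pathHat x Φ q)⁻¹ * pathDeriv Φ q * (pathHat x Φ q)⁻¹)) * G p ∂μ =
      (∫ p in Ico 0 s, F p * G p ∂μ) - F 0 * ∫ p in Ico 0 s, G p ∂μ := by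
    rw [← integral_const_mul_ring _ (hG.mono_set hsub),
      ← integral_sub hFG ((hG.mono_set hsub).const_mul _)]
    refine setIntegral_congr_fun measurableSet_Ico fun p hp => ?_
    rw [hF.eq_add_integral (Ico_subset_Icc_self hp)]
    noncomm_ring
  rw [e5, e1, eq_sub_of_add_eq (setIntegral_Ico_add hG hs.1 hs.2)] at e
  have key : F s * ∫ t in Icc s τ, G t ∂μ = -((∫ p in Ico 0 s, F p * G p ∂μ) +
      F 0 * (-∫ t in Icc 0 τ, G t ∂μ) +
      -∫ q in (0 : ℝ)..s, A' q * ∫ t in Icc 0 τ ∩ Ici q, G t ∂μ) := by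
    rw [← sub_eq_zero] at e
    rw [← sub_eq_zero, ← e]
    noncomm_ring
  have t1 : 0 ≤ (∫ p in Ico 0 s, F p * G p ∂μ).trace := by
    rw [setIntegral_trace hFG]
    exact setIntegral_nonneg measurableSet_Ico fun p hp =>
      trace_mul_conj_self_nonneg (h.transpose_eq p (hsub hp))
        (hf.posDef_pathHat (hsub hp)).posSemidef
  have t2 : 0 ≤ (F 0 * (-∫ t in Icc 0 τ, G t ∂μ)).trace :=
    trace_mul_nonneg h.posSemidef_zero (h.posSemidef_conj_tail (left_mem_Icc.2 hf.nonneg))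
  have t3 : 0 ≤ (-∫ q in (0 : ℝ)..s, A' q * ∫ t in Icc 0 τ ∩ Ici q, G t ∂μ).trace := by
    rw [Matrix.trace_neg, intervalIntegral_trace hAG, ← intervalIntegral.integral_neg]
    rw [integral_congr_ae_Ioo (g := fun q => (A' q * (-∫ t in Icc q τ, G t ∂μ)).trace) hs.1
      (Eventually.of_forall fun q hq => by
        rw [Icc_inter_Ici_of_le hq.1.le, mul_neg, Matrix.trace_neg]),
      intervalIntegral.integral_of_le hs.1, integral_Ioc_eq_integral_Ioo]
    refine setIntegral_nonneg_of_ae_restrict ?_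
    rw [EventuallyLE, ae_restrict_iff' measurableSet_Ioo]
    filter_upwards [h.posSemidef_deriv] with q hq hm
    have hm' : q ∈ Ioo 0 τ := ⟨hm.1, hm.2.trans_le hs.2⟩
    exact trace_mul_nonneg (hq hm') (h.posSemidef_conj_tail (Ioo_subset_Icc_self hm'))
  rw [key, Matrix.trace_neg, Matrix.trace_add, Matrix.trace_add]
  linarith

/-- The tail integrals of the defect vanish. -/
lemma tail_eq_zero (h : IsSlackDefect Q x Φ τ μ F A') (hr : r ∈ Icc 0 τ) :
    ∫ t in Icc r τ, F t ∂μ = 0 := by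
  have hf := h.frame
  have hprob := h.isProbabilityMeasure
  have s2 : Icc r τ ⊆ Icc 0 τ := Icc_subset_Icc_left hr.1
  set G : ℝ → Matrix (Fin m) (Fin m) ℝ := fun t => pathHat x Φ t * F t * pathHat x Φ t with hGdef
  have hG : IntegrableOn G (Icc r τ) μ := h.integrableOn_conj.mono_set s2
  have hF0 : IntegrableOn F (Icc 0 τ) μ :=
    h.lipDerivOn.continuousOn.integrableOn_compact isCompact_Icc
  have hF : IntegrableOn F (Icc r τ) μ := hF0.mono_set s2
  have hK1 : MeasurableSet {z : ℝ × ℝ | z.1 ≤ z.2} := measurableSet_le measurable_fst measurable_snd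
  have hK2 : MeasurableSet {z : ℝ × ℝ | z.2 < z.1} := measurableSet_lt measurable_snd measurable_fst
  have i1 := integrable_mul_setIntegral hF hG hK1
  have i2 := integrable_mul_setIntegral hF hG hK2
  have i3 := integrable_setIntegral_mul hF hG hK2
  have sw := integral_mul_setIntegral_swap hF hG hK2
  simp only [mem_ofPred_eq] at i1 i2 i3 sw
  have a1 : ∀ s ∈ Icc r τ, (μ.restrict (Icc r τ)).restrict {q | s ≤ q} = μ.restrict (Icc s τ) :=
    fun s hs => by rw [restrict_inter_Ici, Icc_inter_Ici_of_le hs.1]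
  have a2 : ∀ s ∈ Icc r τ, (μ.restrict (Icc r τ)).restrict {q | q < s} = μ.restrict (Ico r s) :=
    fun s hs => by
      rw [Measure.restrict_restrict (show MeasurableSet {q | q < s} from measurableSet_Iio)]
      congr 1
      ext q
      exact ⟨fun hq => ⟨hq.2.1, hq.1⟩, fun hq => ⟨hq.2, hq.1, hq.2.le.trans hs.2⟩⟩
  -- The open half of the diagonal splitting leaves N(q) without the atom at q.
  have a3 : ∀ q ∈ Icc r τ, ∫ s in {s | q < s}, F s ∂(μ.restrict (Icc r τ)) =
      (∫ s in Icc q τ, F s ∂μ) - μ.real {q} • F q := fun q hq => by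
    have e : {s | q < s} ∩ Icc r τ = Ioc q τ := by
      ext s
      exact ⟨fun hs => ⟨hs.1, hs.2.2⟩, fun hs => ⟨hs.1, hq.1.trans hs.1.le, hs.2⟩⟩
    rw [Measure.restrict_restrict (show MeasurableSet {s | q < s} from measurableSet_Ioi), e,
      ← Icc_sdiff_left, setIntegral_sdiff (measurableSet_singleton q)
        (hF.mono_set (Icc_subset_Icc_left hq.1)) (by simpa using hq.2), integral_singleton]
  -- The product of the two tails is a double integral over the square; it is split into s ≤ q,
  -- summed over q first, and q < s, summed over s first.
  have split : (∫ s in Icc r τ, F s ∂μ) * (∫ q in Icc r τ, G q ∂μ) =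
      (∫ s in Icc r τ, F s * (∫ q in {q | s ≤ q}, G q ∂(μ.restrict (Icc r τ))) ∂μ) +
      ∫ q in Icc r τ, (∫ s in {s | q < s}, F s ∂(μ.restrict (Icc r τ))) * G q ∂μ := by
    rw [← sw, ← integral_add i1 i2, ← integral_mul_const_ring hF]
    refine setIntegral_congr_fun measurableSet_Icc fun s hs => ?_
    rw [a1 s hs, a2 s hs, ← mul_add, add_comm, setIntegral_Ico_add hG hs.1 hs.2]
  have hle : ((∫ s in Icc r τ, F s ∂μ) * (∫ q in Icc r τ, G q ∂μ)).trace ≤ 0 := by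
    rw [split, Matrix.trace_add, setIntegral_trace i1, setIntegral_trace i3]
    refine add_nonpos (setIntegral_nonpos measurableSet_Icc fun s hs => ?_)
      (setIntegral_nonpos measurableSet_Icc fun q hq => ?_)
    · rw [a1 s hs]
      exact h.trace_mul_conj_tail_nonpos (s2 hs)
    · have h1 := h.trace_mul_conj_tail_nonpos (s2 hq)
      have h2 := trace_mul_conj_self_nonneg (h.transpose_eq q (s2 hq))
        (hf.posDef_pathHat (s2 hq)).posSemidef
      rw [h.setIntegral_conj_pathHat (s2 hq)] at h1
      -- Cyclicity moves both copies of D onto N: tr(N D F D) = tr(F D N D) = tr(F M), which is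
      -- again nonpositive. The atom only subtracts a nonnegative multiple of tr(FG).
      have h3 : ((∫ s in Icc q τ, F s ∂μ) * G q).trace = (F q * (pathHat x Φ q *
          (∫ t in Icc q τ, F t ∂μ) * pathHat x Φ q)).trace := by
        rw [hGdef]
        beta_reduce
        rw [Matrix.trace_mul_comm, mul_assoc, mul_assoc, Matrix.trace_mul_comm]
        simp only [mul_assoc]
      rw [a3 q hq, sub_mul, Matrix.trace_sub, smul_mul_assoc, Matrix.trace_smul, h3]
      have h4 : 0 ≤ μ.real {q} • (F q * G q).trace := mul_nonneg measureReal_nonneg h2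
      linarith
  rw [h.setIntegral_conj_pathHat hr] at hle
  refine neg_eq_zero.1 (eq_zero_of_trace_mul_conj_eq_zero (h.posSemidef_tail r hr)
    (hf.posDef_pathHat hr) ?_)
  simp only [mul_neg, neg_mul, neg_neg]
  exact hle

/-- The defect vanishes almost everywhere for the Parisi measure. -/
lemma ae_eq_zero (h : IsSlackDefect Q x Φ τ μ F A') : ∀ᵐ t ∂μ, t ∈ Icc 0 τ → F t = 0 := by
  have hf := h.frame
  have hprob := h.isProbabilityMeasure
  have h0 : (0 : ℝ) ∈ Icc 0 τ := left_mem_Icc.2 hf.nonneg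
  have hF : IntegrableOn F (Icc 0 τ) μ :=
    h.lipDerivOn.continuousOn.integrableOn_compact isCompact_Icc
  have hFF : IntegrableOn (fun t => F t * F t) (Icc 0 τ) μ :=
    (h.lipDerivOn.continuousOn.mul h.lipDerivOn.continuousOn).integrableOn_compact isCompact_Icc
  have e := setIntegral_primitive_mul hf.nonneg measurableSet_Icc subset_rfl
    (h.lipDerivOn.intervalIntegrable hf.nonneg) hF
  rw [integral_congr_ae_Ioo (g := fun _ => 0) hf.nonneg (Eventually.of_forall fun q hq => by
    rw [Icc_inter_Ici_of_le hq.1.le, h.tail_eq_zero (Ioo_subset_Icc_self hq), mul_zero]),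
    intervalIntegral.integral_zero] at e
  -- Subtracting F(0)N(0) = 0 replaces the left factor F by the primitive of F', whose integral
  -- against F is a pairing of F' with vanishing tails.
  have e1 : ∫ t in Icc 0 τ, F t * F t ∂μ = 0 := by
    rw [← e, ← sub_zero (∫ t in Icc 0 τ, F t * F t ∂μ), ← mul_zero (F 0), ← h.tail_eq_zero h0,
      ← integral_const_mul_ring _ hF, ← integral_sub hFF (hF.const_mul _)]
    refine setIntegral_congr_fun measurableSet_Icc fun t ht => ?_
    rw [← sub_mul, ← (h.lipDerivOn.mono le_rfl ht.2).integral_eq_sub ht.1]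
  have e2 := congrArg Matrix.trace e1
  rw [setIntegral_trace hFF, Matrix.trace_zero] at e2
  have hnn : 0 ≤ᵐ[μ.restrict (Icc 0 τ)] fun t => (F t * F t).trace := by
    rw [EventuallyLE, ae_restrict_iff' measurableSet_Icc]
    filter_upwards with t ht
    have := (Matrix.posSemidef_conjTranspose_mul_self (F t)).trace_nonneg
    rwa [Matrix.conjTranspose_eq_transpose_of_trivial, h.transpose_eq t ht] at this
  have hz := (integral_eq_zero_iff_of_nonneg_ae hnn (traceCLM.integrable_comp hFF)).1 e2
  rw [EventuallyEq, ae_restrict_iff' measurableSet_Icc] at hz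
  filter_upwards [hz] with t ht hm
  have h1 := ht hm
  have h2 := Matrix.trace_conjTranspose_mul_self_eq_zero_iff (A := F t)
  rw [Matrix.conjTranspose_eq_transpose_of_trivial, h.transpose_eq t hm] at h2
  exact h2.1 h1

end IsSlackDefect

end Rigidity

/-! ### The equation on the support -/

section CriticalPoint

variable {Q : Matrix (Fin m) (Fin m) ℝ} {x : ℝ → ℝ} {Φ : ℝ → Matrix (Fin m) (Fin m) ℝ}
  {τ : ℝ} {β : ℕ → Fin m → ℝ} {f : Fin m → ℝ} {μ : Measure ℝ}

/-- The determinant of Q - Φ is continuous and positive at t_x, so it stays positive slightly to the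
right. -/
lemma IsAdmissible.exists_isCutoff (h : IsAdmissible Q x Φ) : ∃ τ, IsCutoff Q x Φ τ := by
  have hc : ContinuousWithinAt (fun t => (Q - Φ t).det) (Icc (0 : ℝ) m) (topTime m x) :=
    (continuous_const.sub continuous_id).matrix_det.continuousAt.comp_continuousWithinAt
      (h.path.lipDerivOn.continuousOn _ ⟨topTime_nonneg, h.topTime_lt.le⟩)
  have h1 : ∀ᶠ t in 𝓝[>] (topTime m x), 0 < (Q - Φ t).det := by
    have h2 := hc.mono (s := Ioo (topTime m x) m) fun t ht =>
      ⟨topTime_nonneg.trans ht.1.le, ht.2.le⟩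
    rw [ContinuousWithinAt, nhdsWithin_Ioo_eq_nhdsGT h.topTime_lt] at h2
    exact h2.eventually (lt_mem_nhds h.det_pos)
  obtain ⟨τ, h2, h3⟩ := (h1.and (Ioo_mem_nhdsGT h.topTime_lt)).exists
  exact ⟨τ, h3.1, h3.2, h2⟩

lemma IsMinimizer.isSlackDefect (hβ : ∀ j, Summable fun p : ℕ => (2 : ℝ) ^ p * β p j ^ 2)
    (hQ : IsOverlapConstraint Q) (hmin : IsMinimizer β f Q x Φ) (hμ : IsParisiMeasure m x μ)
    (hτ : IsCutoff Q x Φ τ) :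
    IsSlackDefect Q x Φ τ μ (defect β f x Φ)
      (fun t => Matrix.of fun i j => xiEntryDeriv₂ β i j (Φ t i j) * pathDeriv Φ t i j) := by
  have hf := hmin.1.isFrame hτ
  refine ⟨hf, hμ, hf.lipDerivOn_defect hβ hQ f, fun t ht => hf.transpose_defect hβ hQ f ht, ?_,
    hf.posSemidef_xiPrime_deriv hβ hQ,
    fun r hr => hmin.posSemidef_neg_setIntegral_defect hβ hQ hμ hτ hr,
    hmin.setIntegral_defect_mul_deriv hβ hQ hμ hτ⟩
  rw [hf.defect_zero]
  exact posSemidef_vecMulVec f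

/-- All the mass lies in a closed interval [0, s] with x(s) = 1 and s < τ, and that interval
contains the support. -/
lemma IsParisiMeasure.mem_Ico_of_mem_support (hμ : IsParisiMeasure m x μ)
    (hx : IsDistributionPath m x) (hτ : topTime m x < τ) {t : ℝ} (ht : t ∈ μ.support) :
    t ∈ Ico 0 τ := by
  have := hμ.isProbabilityMeasure hx
  obtain ⟨s, hs, h1, hsτ⟩ := exists_eq_one_of_topTime_lt hx hτ
  have h2 : Icc 0 s ∈ ae μ := by
    rw [mem_ae_iff, prob_compl_eq_zero_iff measurableSet_Icc, hμ.2 s hs, h1, ENNReal.ofReal_one]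
  have h3 := Measure.support_subset_of_isClosed isClosed_Icc h2 ht
  exact ⟨h3.1, h3.2.trans_lt hsτ⟩

/-- The defect of a minimizer vanishes on the support of the Parisi measure. -/
lemma IsMinimizer.defect_eq_zero (hβ : ∀ j, Summable fun p : ℕ => (2 : ℝ) ^ p * β p j ^ 2)
    (hQ : IsOverlapConstraint Q) (hmin : IsMinimizer β f Q x Φ) (hμ : IsParisiMeasure m x μ)
    (hτ : IsCutoff Q x Φ τ) {t : ℝ} (ht : t ∈ μ.support) : defect β f x Φ t = 0 := by
  have hd := hmin.isSlackDefect hβ hQ hμ hτ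
  have ht' := hμ.mem_Ico_of_mem_support hd.frame.distr hτ.1 ht
  by_contra hne
  have h1 : ∀ᶠ s in 𝓝[Icc 0 τ] t, defect β f x Φ s ≠ 0 :=
    (hd.lipDerivOn.continuousOn t (Ico_subset_Icc_self ht')).eventually
      (isOpen_ne.mem_nhds hne)
  rw [eventually_nhdsWithin_iff] at h1
  -- A two-sided neighbourhood of t is needed, but the defect is controlled on [0, τ] only. Points
  -- above τ are removed since t < τ, and negative points carry no mass.
  have h2 : μ ({s | s ∈ Icc 0 τ → defect β f x Φ s ≠ 0} ∩ Iio τ) = 0 := by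
    refine measure_mono_null (t := {s | ¬(s ∈ Icc 0 τ → defect β f x Φ s = 0)} ∪
      (Icc (0 : ℝ) m)ᶜ) (fun s hs => ?_) (measure_union_null hd.ae_eq_zero hμ.1)
    rcases le_or_gt 0 s with h0 | h0
    · have hm : s ∈ Icc 0 τ := ⟨h0, le_of_lt hs.2⟩
      exact Or.inl fun h => hs.1 hm (h hm)
    · exact Or.inr fun h => absurd h.1 (not_le.2 h0)
  exact absurd h2 ((Measure.mem_support_iff_forall t).1 ht _
    (inter_mem h1 (Iio_mem_nhds ht'.2))).ne'

end CriticalPoint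

end VectorSpin

end

theorem mainTheorem5 (m : ℕ) (hm : 1 ≤ m)
    (β : ℕ → Fin m → ℝ)
    (hβ_even : ∀ p : ℕ, 3 ≤ p → Odd p → ∀ j, β p j = 0)
    (hβ_sum : ∀ j, Summable fun p : ℕ => (2 : ℝ) ^ p * β p j ^ 2)
    (h : Fin m → ℝ)
    (Q : Matrix (Fin m) (Fin m) ℝ) (hQ : VectorSpin.IsOverlapConstraint Q)
    (x : ℝ → ℝ) (Φ : ℝ → Matrix (Fin m) (Fin m) ℝ)
    (hmin : VectorSpin.IsMinimizer β h Q x Φ)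
    (μ : MeasureTheory.Measure ℝ) (hμ : VectorSpin.IsParisiMeasure m x μ)
    (t : ℝ) (ht : t ∈ μ.support) :
    (∀ s ∈ Set.Icc 0 t, IsUnit (VectorSpin.pathHat x Φ s).det) ∧
    ∀ i j : Fin m,
      IntervalIntegrable (fun s => ((VectorSpin.pathHat x Φ s)⁻¹ * VectorSpin.pathDeriv Φ s *
        (VectorSpin.pathHat x Φ s)⁻¹) i j) MeasureTheory.volume 0 t ∧
      (VectorSpin.xiPrime β (Φ t) + Matrix.vecMulVec h h) i j =
        ∫ s in (0 : ℝ)..t, ((VectorSpin.pathHat x Φ s)⁻¹ * VectorSpin.pathDeriv Φ s *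
          (VectorSpin.pathHat x Φ s)⁻¹) i j := by
  obtain ⟨τ, hτ⟩ := hmin.1.exists_isCutoff
  have hf := hmin.1.isFrame hτ
  have ht' := hμ.mem_Ico_of_mem_support hf.distr hτ.1 ht
  have hint := hf.intervalIntegrable_conj (Set.Ico_subset_Icc_self ht')
  refine ⟨fun s hs => hf.isUnit_pathHat ⟨hs.1, hs.2.trans ht'.2.le⟩, fun i j =>
    ⟨VectorSpin.intervalIntegrable_clm hint (VectorSpin.entryCLM i j), ?_⟩⟩
  rw [sub_eq_zero.1 (hmin.defect_eq_zero hβ_sum hQ hμ hτ ht)]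
  exact ((VectorSpin.entryCLM i j).intervalIntegral_comp_comm hint).symm
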